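/- Let $\mathbb{k}$ be an algebraically closed field and let $R=\bigoplus_{\gamma\in\mathbb{R}_{\ge 0}}R_\gamma$ be an $\mathbb{R}_{\ge 0}$-graded integral domain, finitely generated as an algebra over $R_0=\mathbb{k}$, of Krull dimension $n\ge 1$. For a finitely generated torsion-free $\mathbb{R}$-graded $R$-module $N=\bigoplus_{\lambda\in\mathbb{R}}N_\lambda$ put $N_{\le x}:=\bigoplus_{\lambda\le x}N_\lambda$. Then there are unique real numbers $a_n(N)$, $a_{n-1}(N)$ such that $$\dim_{\mathbb{k}} N_{\le x}=\frac{a_n(N)}{n!}x^n+O(x^{n-1})\quad(x\to\infty),$$ $$\lim_{T\to\infty}\frac1{T^n}\int_1^T\Bigl(\dim_{\mathbb{k}} N_{\le x}-\frac{a_n(N)}{n!}x^n-\frac{a_{n-1}(N)}{(n-1)!}x^{n-1}\Bigr)dx=0 ;$$ this applies in particular to $N=R$. Put $\deg(N):=a_{n-1}(N)-\operatorname{rank}(N)\,a_{n-1}(R)$ and, when $a_n(N)\ne 0$ (equivalently, $N\neq 0$), $\mu(N):=\deg(N)/a_n(N)$. A nonzero finitely generated torsion-free $\mathbb{R}$-graded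 $R$-module $N$ is called semistable if $\mu(N')\le\mu(N)$ for every nonzero graded submodule $N'\subseteq N$. Let $M$ be a finitely generated torsion-free $\mathbb{R}$-graded $R$-module. Then there exists a unique filtration $$0=M_0\subset M_1\subset\dots\subset M_l=M$$ (of some length $l\ge 0$, which is also unique) by graded submodules such that 1. each $M_i/M_{i-1}$ $(1\le i\le l)$, with the induced grading, is nonzero, torsion-free and semistable; 2. $\mu(M_1)>\mu(M_2/M_1)>\dots>\mu(M_l/M_{l-1})$. -/

import Mathlib

open Filter Topology Asymptotics

noncomputable section

/-- `dim_k (M_{≤ x})`, where `M_{≤ x}` is the sum of the graded pieces `M_t` with `t ≤ x`. -/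
def dimLE {k M : Type*} [Field k] [AddCommGroup M] [Module k M]
    (ℳ : ℝ → Submodule k M) (x : ℝ) : ℝ :=
  (Module.finrank k (⨆ t : Set.Iic x, ℳ t : Submodule k M) : ℝ)

/-- `a = a_n(M)` and `b = a_{n-1}(M)` are Riemann-Roch coefficients of the graded module `M`
(for `n ≥ 1`): `dim M_{≤ x} = a / n! * x ^ n + O(x ^ (n - 1))`, and the remainder after subtracting
`a / n! * x ^ n + b / (n - 1)! * x ^ (n - 1)` averages out in the sense of Cesàro. -/
structure IsRiemannRoch {k M : Type*} [Field k] [AddCommGroup M] [Module k M]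
    (n : ℕ) (ℳ : ℝ → Submodule k M) (a b : ℝ) : Prop where
  leading : (fun x : ℝ => dimLE ℳ x - a / (n.factorial : ℝ) * x ^ n)
    =O[atTop] (fun x : ℝ => x ^ (n - 1))
  cesaro : Tendsto (fun T : ℝ => 1 / T ^ n *
      ∫ x in (1 : ℝ)..T, (dimLE ℳ x - a / (n.factorial : ℝ) * x ^ n
        - b / ((n - 1).factorial : ℝ) * x ^ (n - 1)))
    atTop (𝓝 0)

/-- The pair `(a_n(M), a_{n-1}(M))` of Riemann-Roch coefficients. -/
def rrCoeff {k M : Type*} [Field k] [AddCommGroup M] [Module k M]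
    (n : ℕ) (ℳ : ℝ → Submodule k M) : ℝ × ℝ :=
  Classical.epsilon fun c : ℝ × ℝ => IsRiemannRoch n ℳ c.1 c.2

section Graded

variable {k R M : Type*} [Field k] [CommRing R] [Algebra k R]
  [AddCommGroup M] [Module R M] [Module k M] [IsScalarTower k R M]

/-- The degree `a_{n-1}(M) - rank(M) * a_{n-1}(R)`. For a domain `R`, `Module.finrank R M` is the
rank of the finitely generated module `M`. -/
def gradedDegree (n : ℕ) (𝒜 : ℝ → Submodule k R) (ℳ : ℝ → Submodule k M) : ℝ :=
  (rrCoeff n ℳ).2 - (Module.finrank R M : ℝ) * (rrCoeff n 𝒜).2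

/-- The slope `deg(M) / a_n(M)` (meaningful when `a_n(M) ≠ 0`). -/
def gradedSlope (n : ℕ) (𝒜 : ℝ → Submodule k R) (ℳ : ℝ → Submodule k M) : ℝ :=
  gradedDegree n 𝒜 ℳ / (rrCoeff n ℳ).1

/-- `N` is a graded submodule: `N` is the sum of the subspaces `N ∩ M_t`. -/
def IsGradedSubmodule (ℳ : ℝ → Submodule k M) (N : Submodule R M) : Prop :=
  N.restrictScalars k = ⨆ t : ℝ, N.restrictScalars k ⊓ ℳ t

/-- For a graded module this is Mathlib's notion of a homogeneous submodule. -/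
theorem isGradedSubmodule_iff_isHomogeneous (ℳ : ℝ → Submodule k M) [DirectSum.Decomposition ℳ]
    (N : Submodule R M) : IsGradedSubmodule ℳ N ↔ N.IsHomogeneous ℳ := by
  classical
  constructor
  · intro h i m hm
    have hm' : m ∈ ⨆ t : ℝ, N.restrictScalars k ⊓ ℳ t := by
      rw [← h]; exact hm
    refine Submodule.iSup_induction (fun t : ℝ => N.restrictScalars k ⊓ ℳ t)
      (motive := fun m => (DirectSum.decompose ℳ m i : M) ∈ N) hm' ?_ ?_ ?_
    · rintro t x ⟨hx, hxt⟩
      by_cases hti : t = i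
      · subst hti
        rw [DirectSum.decompose_of_mem_same ℳ hxt]; exact hx
      · rw [DirectSum.decompose_of_mem_ne ℳ hxt hti]; exact N.zero_mem
    · simp
    · intro x y hx hy
      simpa using N.add_mem hx hy
  · intro h
    refine le_antisymm ?_ (iSup_le fun t => inf_le_left)
    intro m hm
    rw [← DirectSum.sum_support_decompose ℳ m]
    refine Submodule.sum_mem _ fun t _ => ?_
    exact Submodule.mem_iSup_of_mem t ⟨h t hm, (DirectSum.decompose ℳ m t).2⟩

/-- The induced grading on a submodule `P`: `P_t = P ∩ M_t`. -/
def subGrading (ℳ : ℝ → Submodule k M) (P : Submodule R M) : ℝ → Submodule k P :=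
  fun t => (ℳ t).comap (P.subtype.restrictScalars k)

/-- The induced grading on a quotient `M / N`: `(M / N)_t` is the image of `M_t`. -/
def quotGrading (ℳ : ℝ → Submodule k M) (N : Submodule R M) : ℝ → Submodule k (M ⧸ N) :=
  fun t => (ℳ t).map (N.mkQ.restrictScalars k)

/-- The induced grading on `P / N` for `N ≤ P ≤ M`. -/
def subquotGrading (ℳ : ℝ → Submodule k M) (N P : Submodule R M) :
    ℝ → Submodule k (P ⧸ N.submoduleOf P) :=
  quotGrading (subGrading ℳ P) (N.submoduleOf P)

/-- A graded module `M` is torsion-free and semistable. The condition `a_n(M) ≠ 0`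
(equivalently `M ≠ 0`, for torsion-free `M`) is the one under which the slope of `M` is defined. -/
structure IsSemistable (n : ℕ) (𝒜 : ℝ → Submodule k R) (ℳ : ℝ → Submodule k M) : Prop where
  torsionFree : Module.IsTorsionFree R M
  leading_ne_zero : (rrCoeff n ℳ).1 ≠ 0
  slope_le : ∀ N : Submodule R M, IsGradedSubmodule ℳ N → N ≠ ⊥ →
    gradedSlope n 𝒜 (subGrading ℳ N) ≤ gradedSlope n 𝒜 ℳ

/-- `0 = F 0 ⊆ F 1 ⊆ ⋯ ⊆ F l = M` is a Harder-Narasimhan filtration of the graded module `M`. -/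
structure IsHarderNarasimhan (n : ℕ) (𝒜 : ℝ → Submodule k R) (ℳ : ℝ → Submodule k M)
    {l : ℕ} (F : Fin (l + 1) → Submodule R M) : Prop where
  graded : ∀ i, IsGradedSubmodule ℳ (F i)
  mono : Monotone F
  bot : F 0 = ⊥
  top : F (Fin.last l) = ⊤
  semistable : ∀ i : Fin l, IsSemistable n 𝒜 (subquotGrading ℳ (F i.castSucc) (F i.succ))
  slope_strictAnti : StrictAnti fun i : Fin l =>
    gradedSlope n 𝒜 (subquotGrading ℳ (F i.castSucc) (F i.succ))

end Graded

end

/-! Write `a` and `b` for the coefficients a_n and a_{n-1} of a graded submodule. Dimensions of sums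
and intersections make both modular on the lattice of graded submodules of M. Moreover a(N) =
rank(N) a(R), so the slope of P/N is (b(P) - b(N)) / (a(P) - a(N)) minus the constant b(R)/a(R), and
only the lattice slope matters.

Let μ be the largest slope of an interval starting at x. The modular function μa - b attains its
minimum over [x, ⊤] at x, and the elements where it does so are closed under joins. The largest of
them is the first step of the filtration, and the chain condition lets the construction be repeated
above it. Conversely, modularity shows that every Harder-Narasimhan filtration begins with this
element (`IsFiltration.isDestabilizing`), which gives uniqueness.

It remains to see that the largest slope exists. Degrees are real numbers, so a bound on the slopes
does not suffice; some discreteness is needed, and it comes from Hilbert functions. If R has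
homogeneous generators of weights w_i > 0, the Hilbert function of each graded subquotient of M is a
finite sum of translates of functions counting natural exponents with ∑ a_i w_i ≤ x, taken over
sublists of the weights (`isWeightSum_moduleHilbertFun`). The integral of such a count has a
second-order expansion, which yields `a` and `b`. Translation by c changes b by -c a, so b is not
controlled in general. But if a = 0, then b is a sum of numbers 1/∏ w from a finite set, and such
sums form a partially well-ordered set. Induction on generators of M turns this into partial
well-ordering of the set of all -b(Q) (`isPWO_neg_subCoeff`). As `a` takes finitely many values, the
largest slope is attained.

Noether normalization supplies the exponent n: it bounds Hilbert functions above by a multiple of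
x^n, and that of R below as well, so that a(R) > 0. -/

namespace HarderNarasimhan

/-! ### Harder-Narasimhan filtrations in a lattice with two modular functions -/

variable {L : Type*} [Lattice L]

/-- The slope of the interval `[x, y]` with respect to the additive invariants `a` and `b`. -/
noncomputable def slope (a b : L → ℝ) (x y : L) : ℝ := (b y - b x) / (a y - a x)

/-- The interval `[x, y]` is torsion-free and semistable. -/
structure IsStep (a b : L → ℝ) (x y : L) : Prop where
  lt : x < y
  rank_lt : ∀ z, x < z → z ≤ y → a x < a z
  slope_le : ∀ z, x < z → z ≤ y → slope a b x z ≤ slope a b x y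

/-- `F` is a Harder-Narasimhan filtration of the interval `[x, ⊤]`. -/
structure IsFiltration [OrderTop L] (a b : L → ℝ) (x : L) {l : ℕ} (F : Fin (l + 1) → L) : Prop where
  zero : F 0 = x
  last : F (Fin.last l) = ⊤
  step : ∀ i : Fin l, IsStep a b (F i.castSucc) (F i.succ)
  strictAnti : StrictAnti fun i : Fin l => slope a b (F i.castSucc) (F i.succ)

/-- `y` is the largest element for which `[x, y]` has the maximal slope `μ`. -/
structure IsDestabilizing (a b : L → ℝ) (x y : L) (μ : ℝ) : Prop where
  lt : x < y
  rank_lt : a x < a y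
  eq : μ * a y - b y = μ * a x - b x
  le : ∀ z, x ≤ z → μ * a x - b x ≤ μ * a z - b z
  le_of_eq : ∀ z, x ≤ z → μ * a z - b z = μ * a x - b x → z ≤ y

theorem IsDestabilizing.slope_eq {a b : L → ℝ} {x y : L} {μ : ℝ}
    (h : IsDestabilizing a b x y μ) : slope a b x y = μ := by
  have := h.eq
  have := h.rank_lt
  rw [slope, div_eq_iff (by linarith)]
  linarith

/-- Testing the minimality of each element against the other one forces the two slopes to agree;
then each is at most the other by maximality. -/
theorem IsDestabilizing.unique {a b : L → ℝ} {x y y' : L} {μ μ' : ℝ}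
    (h : IsDestabilizing a b x y μ) (h' : IsDestabilizing a b x y' μ') : y = y' := by
  have hμ : μ = μ' := by
    have h1 := h.le y' h'.lt.le
    have h2 := h'.le y h.lt.le
    have h3 := h.eq
    have h4 := h'.eq
    have h5 := h.rank_lt
    have h6 := h'.rank_lt
    apply le_antisymm
    · by_contra! hlt
      nlinarith
    · by_contra! hlt
      nlinarith
  subst hμ
  exact le_antisymm (h'.le_of_eq y h.lt.le h.eq) (h.le_of_eq y' h'.lt.le h'.eq)

variable {a b : L → ℝ}

theorem IsStep.lt_of_slope_lt {x y : L} (h : IsStep a b x y) {ν : ℝ}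
    (hν : slope a b x y < ν) {z : L} (hz : x < z) (hzy : z ≤ y) :
    ν * a x - b x < ν * a z - b z := by
  have h1 := h.slope_le z hz hzy
  have h2 := h.rank_lt z hz hzy
  rw [slope] at h1
  rw [div_le_iff₀ (by linarith)] at h1
  nlinarith

theorem IsStep.le {x y : L} (h : IsStep a b x y) {z : L} (hz : x ≤ z) (hzy : z ≤ y) :
    slope a b x y * a x - b x ≤ slope a b x y * a z - b z := by
  rcases hz.eq_or_lt with rfl | hz
  · exact le_rfl
  have h1 := h.slope_le z hz hzy
  have h2 := h.rank_lt z hz hzy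
  rw [slope, div_le_iff₀ (by linarith)] at h1
  nlinarith

theorem IsDestabilizing.isStep {x y : L} {μ : ℝ} (h : IsDestabilizing a b x y μ)
    (hx : ∀ z, x < z → a x < a z) : IsStep a b x y := by
  refine ⟨h.lt, fun z hz _ => hx z hz, fun z hz _ => ?_⟩
  have h1 := hx z hz
  have h2 := h.le z hz.le
  rw [h.slope_eq, slope, div_le_iff₀ (by linarith)]
  linarith

/-- This is torsion-freeness of the quotient by the destabilizing element. If `a` did not grow from
y to z, then `b` could only grow, so `μ * a - b` would still be minimal at z, against the maximality
of y. -/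
theorem IsDestabilizing.rank_lt_of_lt (hmono : Monotone a)
    (hmono' : ∀ x y, x ≤ y → a x = a y → b x ≤ b y) {x y : L} {μ : ℝ}
    (h : IsDestabilizing a b x y μ) {z : L} (hz : y < z) : a y < a z := by
  refine (hmono hz.le).lt_of_ne fun heq => ?_
  have h1 := hmono' y z hz.le heq
  have h2 := h.le z (h.lt.le.trans hz.le)
  have h3 := h.eq
  rw [heq] at h3
  exact absurd (h.le_of_eq z (h.lt.le.trans hz.le) (by linarith)) hz.not_ge

theorem IsDestabilizing.slope_lt {x y : L} {μ : ℝ}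
    (h : IsDestabilizing a b x y μ) {z : L} (hz : y < z) (hz' : a y < a z) :
    slope a b y z < μ := by
  have h2 := h.le z (h.lt.le.trans hz.le)
  have h3 := h.eq
  have h4 : μ * a z - b z ≠ μ * a x - b x := fun heq =>
    absurd (h.le_of_eq z (h.lt.le.trans hz.le) heq) hz.not_ge
  have h5 := lt_of_le_of_ne h2 h4.symm
  rw [slope, div_lt_iff₀ (by linarith)]
  linarith

section Filtration

variable [OrderTop L]
  (ha : ∀ x y, a (x ⊔ y) + a (x ⊓ y) = a x + a y)
  (hb : ∀ x y, b (x ⊔ y) + b (x ⊓ y) = b x + b y)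

theorem IsFiltration.tail {x : L} {l : ℕ} {F : Fin (l + 1 + 1) → L} (h : IsFiltration a b x F) :
    IsFiltration a b (F 1) (Fin.tail F) where
  zero := rfl
  last := h.last
  step _ := h.step (Fin.succ _)
  strictAnti _ _ hij := h.strictAnti (Fin.succ_lt_succ_iff.2 hij)

include ha hb in
-- If all slopes of the filtration are below ν, then ν a - b has its strict minimum at the bottom.
-- By modularity its value at z is its value at z ⊔ F 1, plus that at z ⊓ F 1, minus that at F 1;
-- the tail of the filtration controls the join and the first step controls the meet.
theorem IsFiltration.eq_of_slope_lt {l : ℕ} : ∀ {x : L} {F : Fin (l + 1) → L},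
    IsFiltration a b x F → ∀ {ν : ℝ}, (∀ i : Fin l, slope a b (F i.castSucc) (F i.succ) < ν) →
    ∀ z, x ≤ z → ν * a x - b x ≤ ν * a z - b z ∧ (ν * a z - b z = ν * a x - b x → z = x) := by
  induction l with
  | zero =>
    intro x F h ν _ z hz
    have hx : x = ⊤ := h.zero.symm.trans h.last
    have : z = x := le_antisymm (hx ▸ le_top) hz
    subst this
    simp
  | succ l ih =>
    intro x F h ν hν z hz
    have h0 : IsStep a b x (F 1) := by
      have := h.step 0
      rwa [Fin.castSucc_zero, h.zero] at this
    have hs : slope a b x (F 1) < ν := by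
      have := hν 0
      rwa [Fin.castSucc_zero, h.zero] at this
    obtain ⟨h1, h2⟩ := ih h.tail (fun i => hν i.succ) (z ⊔ F 1) le_sup_right
    have ha' := congrArg (ν * ·) (ha z (F 1))
    have hb' := hb z (F 1)
    simp only [mul_add] at ha'
    have hxz : x ≤ z ⊓ F 1 := le_inf hz h0.lt.le
    rcases hxz.eq_or_lt with hx | hx
    · rw [← hx] at ha' hb'
      refine ⟨by linarith, fun heq => ?_⟩
      have := h2 (by linarith)
      have : z ≤ F 1 := by rw [← this]; exact le_sup_left
      rw [hx, inf_eq_left.2 this]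
    · have h3 := h0.lt_of_slope_lt hs hx inf_le_right
      exact ⟨by linarith, fun heq => absurd heq (by linarith)⟩

include ha hb in
-- The same splitting along `F 1`, now with ν equal to the first slope. The tail has strictly
-- smaller slopes, so a minimiser z must satisfy z ⊔ F 1 = F 1.
theorem IsFiltration.isDestabilizing {x : L} {l : ℕ} {F : Fin (l + 1 + 1) → L}
    (h : IsFiltration a b x F) : IsDestabilizing a b x (F 1) (slope a b x (F 1)) := by
  have h0 : IsStep a b x (F 1) := by
    have := h.step 0
    rwa [Fin.castSucc_zero, h.zero] at this
  have hν : ∀ i : Fin l, slope a b (Fin.tail F i.castSucc) (Fin.tail F i.succ) <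
      slope a b x (F 1) := by
    intro i
    have := h.strictAnti (Fin.succ_pos i)
    simp only [Fin.castSucc_zero, h.zero] at this
    exact this
  have hx := h0.rank_lt _ h0.lt le_rfl
  set ν := slope a b x (F 1) with hνdef
  have heq : ν * a (F 1) - b (F 1) = ν * a x - b x := by
    rw [slope, eq_div_iff (by linarith)] at hνdef
    linarith
  have key : ∀ z, x ≤ z → ν * a x - b x ≤ ν * a z - b z ∧
      (ν * a z - b z = ν * a x - b x → z ≤ F 1) := by
    intro z hz
    obtain ⟨h1, h2⟩ := h.tail.eq_of_slope_lt ha hb hν (z ⊔ F 1) le_sup_right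
    have ha' := congrArg (ν * ·) (ha z (F 1))
    have hb' := hb z (F 1)
    simp only [mul_add] at ha'
    have h3 := h0.le (le_inf hz h0.lt.le) (inf_le_right : z ⊓ F 1 ≤ F 1)
    rw [← hνdef] at h3
    refine ⟨by linarith, fun heq => ?_⟩
    rw [← h2 (by linarith)]
    exact le_sup_left
  exact ⟨h0.lt, hx, heq, fun z hz => (key z hz).1, fun z hz => (key z hz).2⟩

include ha hb in
theorem IsFiltration.unique {l : ℕ} : ∀ {x : L} {F : Fin (l + 1) → L} {l' : ℕ}
    {G : Fin (l' + 1) → L}, IsFiltration a b x F → IsFiltration a b x G →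
    (⟨l, F⟩ : (l : ℕ) × (Fin (l + 1) → L)) = ⟨l', G⟩ := by
  induction l with
  | zero =>
    intro x F l' G hF hG
    have hx : x = ⊤ := hF.zero.symm.trans hF.last
    cases l' with
    | zero =>
      congr 1
      funext i
      rw [Fin.fin_one_eq_zero i, hF.zero, hG.zero]
    | succ l' =>
      have := (hG.step 0).lt
      rw [Fin.castSucc_zero, hG.zero, hx] at this
      exact absurd this not_top_lt
  | succ l ih =>
    intro x F l' G hF hG
    cases l' with
    | zero =>
      have hx : x = ⊤ := hG.zero.symm.trans hG.last
      have := (hF.step 0).lt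
      rw [Fin.castSucc_zero, hF.zero, hx] at this
      exact absurd this not_top_lt
    | succ l' =>
      have h1 : F 1 = G 1 := (hF.isDestabilizing ha hb).unique (hG.isDestabilizing ha hb)
      have h2 := ih hF.tail (h1 ▸ hG.tail)
      obtain ⟨rfl, h2⟩ := Sigma.mk.inj_iff.1 h2
      have h2 := eq_of_heq h2
      congr 1
      rw [← Fin.cons_self_tail F, ← Fin.cons_self_tail G, h2, hF.zero, hG.zero]

theorem IsFiltration.cons {x y : L} {μ : ℝ} {l : ℕ} {F : Fin (l + 1) → L}
    (h : IsFiltration a b y F) (hy : IsDestabilizing a b x y μ) (hx : ∀ z, x < z → a x < a z) :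
    IsFiltration a b x (Fin.cons x F : Fin (l + 1 + 1) → L) where
  zero := rfl
  last := h.last
  step i := by
    cases i using Fin.cases with
    | zero =>
      have := hy.isStep hx
      simpa [h.zero] using this
    | succ i => simpa [← Fin.succ_castSucc] using h.step i
  strictAnti := by
    intro i j hij
    cases j using Fin.cases with
    | zero => exact absurd hij (Fin.not_lt_zero i)
    | succ j =>
    have hsucc : slope a b ((Fin.cons x F : Fin (l + 1 + 1) → L) j.succ.castSucc)
        ((Fin.cons x F : Fin (l + 1 + 1) → L) j.succ.succ) =
        slope a b (F j.castSucc) (F j.succ) := by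
      simp
    simp only [hsucc]
    cases i using Fin.cases with
    | zero =>
      obtain ⟨l, rfl⟩ : ∃ l', l = l' + 1 := ⟨l - 1, by have := j.pos; omega⟩
      have h0 : slope a b (F j.castSucc) (F j.succ) ≤ slope a b y (F 1) := by
        have := h.strictAnti.antitone (Fin.zero_le j)
        simpa [h.zero] using this
      have h1 := h.step 0
      rw [Fin.castSucc_zero, h.zero] at h1
      have h2 := hy.slope_lt h1.lt (h1.rank_lt _ h1.lt le_rfl)
      have h3 := hy.slope_eq
      simp only [Fin.castSucc_zero, Fin.cons_zero, Fin.cons_succ, h.zero]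
      rw [Fin.succ_zero_eq_one'] at h2
      linarith
    | succ i =>
      have := h.strictAnti (Fin.succ_lt_succ_iff.1 hij)
      simpa [← Fin.succ_castSucc] using this

include ha hb in
theorem exists_isDestabilizing [WellFoundedGT L] (hfin : (Set.range a).Finite)
    (hpwo : (Set.range fun x => -b x).IsPWO) {x : L} (hx : ∀ z, x < z → a x < a z) (hxt : x < ⊤) :
    ∃ y μ, IsDestabilizing a b x y μ := by
  -- For a fixed value α of `a`, the negated slope is an increasing function of `-b z`; there are
  -- only finitely many α. Hence the negated slopes are partially well-ordered and have a least
  -- element.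
  have hS : {s : ℝ | ∃ z, x < z ∧ s = -slope a b x z}.IsPWO := by
    have hU : (⋃ α ∈ Set.range a ∩ Set.Ioi (a x),
        (fun t => (t + b x) / (α - a x)) '' Set.range fun x => -b x).IsPWO := by
      have hfin' := hfin.subset (Set.inter_subset_left (t := Set.Ioi (a x)))
      rw [← hfin'.coe_toFinset]
      refine (Finset.isPWO_bUnion _).2 fun α hα => ?_
      refine hpwo.image_of_monotone fun s t hst => ?_
      have : 0 < α - a x := sub_pos.2 (hfin'.mem_toFinset.1 hα).2
      gcongr
    refine hU.mono ?_
    rintro s ⟨z, hz, rfl⟩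
    simp only [Set.mem_iUnion]
    refine ⟨a z, ⟨⟨z, rfl⟩, hx z hz⟩, -b z, ⟨z, rfl⟩, ?_⟩
    rw [slope]
    ring
  obtain ⟨s, ⟨z, hz, rfl⟩, hs⟩ : ∃ s ∈ {s : ℝ | ∃ z, x < z ∧ s = -slope a b x z},
      ∀ t ∈ {s : ℝ | ∃ z, x < z ∧ s = -slope a b x z}, s ≤ t := by
    have hne : {s : ℝ | ∃ z, x < z ∧ s = -slope a b x z}.Nonempty := ⟨_, ⊤, hxt, rfl⟩
    exact ⟨_, hS.isWF.min_mem hne, fun t ht => hS.isWF.min_le hne ht⟩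
  set μ := slope a b x z with hμ
  have hle : ∀ w, x ≤ w → μ * a x - b x ≤ μ * a w - b w := by
    intro w hw
    rcases hw.eq_or_lt with rfl | hw
    · exact le_rfl
    have h1 := hs _ ⟨w, hw, rfl⟩
    have h2 := hx w hw
    have h3 : slope a b x w ≤ μ := by linarith
    rw [slope, div_le_iff₀ (by linarith)] at h3
    linarith
  have hzeq : μ * a z - b z = μ * a x - b x := by
    have h2 := hx z hz
    rw [slope, eq_div_iff (by linarith)] at hμ
    linarith
  -- The chain condition gives a maximal minimiser. Joins of minimisers are minimisers, since the
  -- values at join and meet are both bounded below and their sum is fixed; so the maximal one is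
  -- the largest.
  obtain ⟨y, ⟨hxy, hy⟩, hymax⟩ := WellFounded.has_min (wellFounded_gt (α := L))
    {w | x < w ∧ μ * a w - b w = μ * a x - b x} ⟨z, hz, hzeq⟩
  refine ⟨y, μ, hxy, hx y hxy, hy, hle, fun w hw hweq => ?_⟩
  have h1 := hle (w ⊔ y) (hw.trans le_sup_left)
  have h2 := hle (w ⊓ y) (le_inf hw hxy.le)
  have ha' := congrArg (μ * ·) (ha w y)
  have hb' := hb w y
  simp only [mul_add] at ha'
  have h3 := hymax (w ⊔ y) ⟨hxy.trans_le le_sup_right, by linarith⟩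
  by_contra hwy
  exact h3 (lt_of_le_of_ne le_sup_right fun h => hwy (h ▸ le_sup_left))

include ha hb in
-- Induction downwards from ⊤. The condition on x says that the quotient by x is torsion-free, and
-- it passes to the destabilizing element by `rank_lt_of_lt`.
theorem exists_isFiltration [WellFoundedGT L] (hmono : Monotone a)
    (hmono' : ∀ x y, x ≤ y → a x = a y → b x ≤ b y) (hfin : (Set.range a).Finite)
    (hpwo : (Set.range fun x => -b x).IsPWO) (x : L) : (∀ z, x < z → a x < a z) →
    ∃ F : (l : ℕ) × (Fin (l + 1) → L), IsFiltration a b x F.2 := by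
  induction x using WellFoundedGT.induction with
  | ind x ih =>
    intro hx
    rcases (le_top : x ≤ ⊤).eq_or_lt with rfl | hxt
    · exact ⟨⟨0, fun _ => ⊤⟩, rfl, rfl, fun i => i.elim0, fun i => i.elim0⟩
    · obtain ⟨y, μ, hy⟩ := exists_isDestabilizing ha hb hfin hpwo hx hxt
      obtain ⟨F, hF⟩ := ih y hy.lt fun z hz => hy.rank_lt_of_lt hmono hmono' hz
      exact ⟨⟨_, _⟩, hF.cons hy hx⟩

include ha hb in
/-- In a lattice with ascending chain condition and two modular functions, the interval `[x, ⊤]`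
has a unique Harder-Narasimhan filtration. -/
theorem existsUnique_isFiltration [WellFoundedGT L] (hmono : Monotone a)
    (hmono' : ∀ x y, x ≤ y → a x = a y → b x ≤ b y) (hfin : (Set.range a).Finite)
    (hpwo : (Set.range fun x => -b x).IsPWO) (x : L) (hx : ∀ z, x < z → a x < a z) :
    ∃! F : (l : ℕ) × (Fin (l + 1) → L), IsFiltration a b x F.2 := by
  obtain ⟨F, hF⟩ := exists_isFiltration ha hb hmono hmono' hfin hpwo x hx
  exact ⟨F, hF, fun G hG => hG.unique ha hb hF⟩

end Filtration

end HarderNarasimhan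

/-! ### Sums of powers along an arithmetic progression -/

section PowerSums

/-- The left side is the error at u of the tangent at v to the power p + 2. Multiplying it by u
gives the next error up to (p + 2) v^(p + 1) (u - v)^2. -/
theorem exists_abs_pow_tangent_le (p : ℕ) : ∃ C : ℝ, 0 ≤ C ∧ ∀ u v : ℝ, 0 ≤ v → v ≤ u →
    |u ^ (p + 2) - (p + 2) * u * v ^ (p + 1) + (p + 1) * v ^ (p + 2)| ≤
      C * (u - v) ^ 2 * u ^ p := by
  induction p with
  | zero =>
    refine ⟨1, zero_le_one, fun u v _ _ => le_of_eq ?_⟩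
    rw [show u ^ (0 + 2) - ((0 : ℕ) + 2) * u * v ^ (0 + 1) + ((0 : ℕ) + 1) * v ^ (0 + 2) =
      (u - v) ^ 2 by push_cast; ring, abs_of_nonneg (sq_nonneg _)]
    ring
  | succ p ih =>
    obtain ⟨C, hC, h⟩ := ih
    refine ⟨C + (p + 2), by positivity, fun u v hv huv => ?_⟩
    have hu := hv.trans huv
    have h1 := h u v hv huv
    have h2 : v ^ (p + 1) ≤ u ^ (p + 1) := pow_le_pow_left₀ hv huv _
    calc _ = |u * (u ^ (p + 2) - (p + 2) * u * v ^ (p + 1) + (p + 1) * v ^ (p + 2)) +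
          (p + 2) * v ^ (p + 1) * (u - v) ^ 2| := by
            congr 1; push_cast; ring
      _ ≤ u * (C * (u - v) ^ 2 * u ^ p) + (p + 2) * u ^ (p + 1) * (u - v) ^ 2 := by
        refine (abs_add_le _ _).trans (add_le_add ?_ ?_)
        · rw [abs_mul, abs_of_nonneg hu]
          gcongr
        · rw [abs_of_nonneg (by positivity)]
          gcongr
      _ = _ := by ring

/-- The error of the trapezoidal rule for the monomial of degree `p + 1`. -/
theorem exists_abs_trapezoid_le (p : ℕ) : ∃ C : ℝ, 0 ≤ C ∧ ∀ u v : ℝ, 0 ≤ v → v ≤ u →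
    |2 * (u ^ (p + 2) - v ^ (p + 2)) - (p + 2) * (u - v) * (u ^ (p + 1) + v ^ (p + 1))| ≤
      C * p * (u - v) ^ 3 * u ^ (p - 1) := by
  induction p with
  | zero =>
    refine ⟨0, le_rfl, fun u v _ _ => le_of_eq ?_⟩
    rw [abs_eq_zero.2 (by push_cast; ring)]
    simp
  | succ p ih =>
    obtain ⟨C, hC, h⟩ := ih
    obtain ⟨D, hD, h'⟩ := exists_abs_pow_tangent_le p
    refine ⟨C + D, by positivity, fun u v hv huv => ?_⟩
    have hu := hv.trans huv
    have huv' := sub_nonneg.2 huv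
    -- The factor `p` of the bound absorbs the truncated exponent `p - 1`: both sides vanish at p =
    -- 0, where the trapezoidal rule is exact.
    have hpow : (p : ℝ) * (u * u ^ (p - 1)) = p * u ^ p := by
      rcases p with _ | p
      · simp
      · simp [pow_succ']
    calc _ = |u * (2 * (u ^ (p + 2) - v ^ (p + 2)) -
            (p + 2) * (u - v) * (u ^ (p + 1) + v ^ (p + 1))) -
          (u - v) * (u ^ (p + 2) - (p + 2) * u * v ^ (p + 1) + (p + 1) * v ^ (p + 2))| := by
            congr 1; push_cast; ring
      _ ≤ u * (C * p * (u - v) ^ 3 * u ^ (p - 1)) + (u - v) * (D * (u - v) ^ 2 * u ^ p) := by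
        refine (abs_sub _ _).trans (add_le_add ?_ ?_)
        · rw [abs_mul, abs_of_nonneg hu]
          exact mul_le_mul_of_nonneg_left (h u v hv huv) hu
        · rw [abs_mul, abs_of_nonneg huv']
          exact mul_le_mul_of_nonneg_left (h' u v hv huv) huv'
      _ = C * (u - v) ^ 3 * (p * (u * u ^ (p - 1))) + D * (u - v) ^ 3 * u ^ p := by ring
      _ = (C * p + D) * ((u - v) ^ 3 * u ^ p) := by rw [hpow]; ring
      _ ≤ ((C + D) * (p + 1)) * ((u - v) ^ 3 * u ^ p) := by
        gcongr
        nlinarith [(Nat.cast_nonneg p : (0 : ℝ) ≤ p)]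
      _ = _ := by push_cast; ring

/-- The number of indices `i` with `i * w ≤ x`. -/
theorem natFloor_div_add_one_le {w x : ℝ} (hw : 0 < w) (hx : 0 ≤ x) :
    ((⌊x / w⌋₊ + 1 : ℕ) : ℝ) ≤ (1 / w + 1) * (1 + x) := by
  have h := Nat.floor_le (div_nonneg hx hw.le)
  push_cast
  have : x / w = 1 / w * x := by ring
  have h1 : 0 < 1 / w := by positivity
  nlinarith

theorem mul_le_of_lt_natFloor_div_add_one {w x : ℝ} (hw : 0 < w) (hx : 0 ≤ x) {i : ℕ}
    (hi : i < ⌊x / w⌋₊ + 1) : i * w ≤ x := by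
  rw [← le_div_iff₀ hw]
  exact (Nat.le_floor_iff (div_nonneg hx hw.le)).1 (Nat.lt_succ_iff.1 hi)

/-- Euler-Maclaurin expansion of a sum of powers to second order. -/
theorem exists_abs_powerSum_sub_le {w : ℝ} (hw : 0 < w) (p : ℕ) : ∃ C : ℝ, 0 ≤ C ∧ ∀ x : ℝ,
    0 ≤ x → |∑ i ∈ Finset.range (⌊x / w⌋₊ + 1), (x - i * w) ^ p -
      (x ^ (p + 1) / ((p + 1) * w) + x ^ p / 2)| ≤ C * (1 + x) ^ (p - 1) := by
  rcases p with _ | p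
  · refine ⟨1, zero_le_one, fun x hx => ?_⟩
    have h1 := Nat.floor_le (div_nonneg hx hw.le)
    have h2 := Nat.lt_floor_add_one (x / w)
    simp only [pow_zero, Finset.sum_const, Finset.card_range, nsmul_eq_mul, mul_one]
    push_cast
    rw [abs_le]
    simp only [zero_add, pow_one, one_mul, pow_zero, mul_one]
    constructor <;> linarith
  · obtain ⟨C, hC, h⟩ := exists_abs_trapezoid_le p
    refine ⟨w ^ (p + 1) / 2 + w ^ (p + 2) / ((p + 2) * w) + C * p * w ^ 2 / (2 * (p + 2) * w),
      by positivity, fun x hx => ?_⟩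
    set K := ⌊x / w⌋₊ with hK
    have hKle : K * w ≤ x := mul_le_of_lt_natFloor_div_add_one hw hx (Nat.lt_succ_self K)
    have hKlt : x < (K + 1) * w := by
      rw [← div_lt_iff₀ hw]
      exact Nat.lt_floor_add_one (x / w)
    set S := ∑ i ∈ Finset.range (K + 1), (x - i * w) ^ (p + 1) with hS
    set r := x - K * w with hr
    have hr0 : 0 ≤ r := by linarith
    have hrw : r ≤ w := by linarith
    -- E collects the trapezoidal errors on the K full intervals of length w between r and x. The
    -- power differences telescope and the trapezoid areas add up to S with corrections at the ends,
    -- so S can be solved for.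
    set E := ∑ i ∈ Finset.range K, (2 * ((x - i * w) ^ (p + 2) - (x - (i + 1 : ℕ) * w) ^ (p + 2)) -
      (p + 2) * w * ((x - i * w) ^ (p + 1) + (x - (i + 1 : ℕ) * w) ^ (p + 1))) with hE
    have hEabs : |E| ≤ C * p * w ^ 2 * (1 + x) ^ p := by
      calc |E| ≤ ∑ i ∈ Finset.range K, C * p * w ^ 3 * x ^ (p - 1) := by
            refine (Finset.abs_sum_le_sum_abs _ _).trans (Finset.sum_le_sum fun i hi => ?_)
            have hi' : ((i + 1 : ℕ) : ℝ) * w ≤ x :=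
              mul_le_of_lt_natFloor_div_add_one hw hx
                (Nat.succ_lt_succ (Finset.mem_range.1 hi))
            have hi'' : (0 : ℝ) ≤ i * w := by positivity
            have h1 := h (x - i * w) (x - (i + 1 : ℕ) * w) (by linarith)
              (by push_cast; nlinarith)
            rw [show x - i * w - (x - (i + 1 : ℕ) * w) = w by push_cast; ring] at h1
            refine h1.trans ?_
            have : 0 ≤ x - i * w := by push_cast at hi'; nlinarith
            gcongr
            linarith
        _ = C * w ^ 2 * (p * (K * w * x ^ (p - 1))) := by
            rw [Finset.sum_const, Finset.card_range, nsmul_eq_mul]; ring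
        _ ≤ C * w ^ 2 * (p * (1 + x) ^ p) := by
            rcases p with _ | p
            · simp
            · have : K * w * x ^ p ≤ (1 + x) ^ (p + 1) := by
                rw [pow_succ']
                gcongr <;> linarith
              simp only [add_tsub_cancel_right]
              gcongr
        _ = _ := by ring
    have hsum1 : ∑ i ∈ Finset.range K, ((x - i * w) ^ (p + 2) - (x - (i + 1 : ℕ) * w) ^ (p + 2)) =
        x ^ (p + 2) - r ^ (p + 2) := by
      rw [Finset.sum_range_sub' (fun i : ℕ => (x - i * w) ^ (p + 2))]
      simp [hr]
    have hsum2 : ∑ i ∈ Finset.range K, (x - i * w) ^ (p + 1) = S - r ^ (p + 1) := by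
      rw [hS, Finset.sum_range_succ]; ring
    have hsum3 : ∑ i ∈ Finset.range K, (x - (i + 1 : ℕ) * w) ^ (p + 1) = S - x ^ (p + 1) := by
      rw [hS, Finset.sum_range_succ']; simp
    have hEeq : E = 2 * (x ^ (p + 2) - r ^ (p + 2)) -
        (p + 2) * w * (2 * S - r ^ (p + 1) - x ^ (p + 1)) := by
      rw [hE, Finset.sum_sub_distrib, ← Finset.mul_sum, ← Finset.mul_sum, hsum1,
        Finset.sum_add_distrib, hsum2, hsum3]
      ring
    -- Beyond the two main terms only the contribution of the incomplete interval [0, r], bounded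
    -- since r ≤ w, and the accumulated error E remain.
    have hfinal : S - (x ^ (p + 1 + 1) / (((p + 1 : ℕ) + 1) * w) + x ^ (p + 1) / 2) =
        r ^ (p + 1) / 2 - r ^ (p + 2) / ((p + 2) * w) - E / (2 * (p + 2) * w) := by
      rw [hEeq]
      push_cast
      rw [show (p : ℝ) + 1 + 1 = p + 2 by ring]
      field_simp
      ring
    rw [hfinal]
    have hone : 1 ≤ (1 + x) ^ p := one_le_pow₀ (by linarith)
    have b1 : |r ^ (p + 1) / 2| ≤ w ^ (p + 1) / 2 * (1 + x) ^ p := by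
      rw [abs_of_nonneg (by positivity)]
      refine le_trans ?_ (le_mul_of_one_le_right (by positivity) hone)
      gcongr
    have b2 : |r ^ (p + 2) / ((p + 2) * w)| ≤ w ^ (p + 2) / ((p + 2) * w) * (1 + x) ^ p := by
      rw [abs_of_nonneg (by positivity)]
      refine le_trans ?_ (le_mul_of_one_le_right (by positivity) hone)
      gcongr
    have b3 : |E / (2 * (p + 2) * w)| ≤ C * p * w ^ 2 / (2 * (p + 2) * w) * (1 + x) ^ p := by
      rw [abs_div, abs_of_nonneg (by positivity : 0 ≤ 2 * ((p : ℝ) + 2) * w), div_mul_eq_mul_div]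
      gcongr
    simp only [add_tsub_cancel_right]
    calc _ ≤ |r ^ (p + 1) / 2| + |r ^ (p + 2) / ((p + 2) * w)| + |E / (2 * (p + 2) * w)| :=
          (abs_sub _ _).trans (add_le_add_left (abs_sub _ _) _)
      _ ≤ _ := by
        refine (add_le_add (add_le_add b1 b2) b3).trans_eq ?_
        ring

theorem exists_abs_powerSum_sub_le' {w : ℝ} (hw : 0 < w) (p : ℕ) : ∃ C : ℝ, 0 ≤ C ∧ ∀ x : ℝ,
    0 ≤ x → |∑ i ∈ Finset.range (⌊x / w⌋₊ + 1), (x - i * w) ^ p -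
      x ^ (p + 1) / ((p + 1) * w)| ≤ C * (1 + x) ^ p := by
  obtain ⟨C, hC, h⟩ := exists_abs_powerSum_sub_le hw p
  refine ⟨C + 1 / 2, by positivity, fun x hx => ?_⟩
  have h1 : |x ^ p / 2| ≤ 1 / 2 * (1 + x) ^ p := by
    rw [abs_of_nonneg (by positivity)]
    have : x ^ p ≤ (1 + x) ^ p := pow_le_pow_left₀ hx (by linarith) _
    linarith
  have h2 : C * (1 + x) ^ (p - 1) ≤ C * (1 + x) ^ p := by
    gcongr
    · linarith
    · omega
  have h3 := h x hx
  rw [abs_le] at *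
  constructor <;> linarith [h3.1, h3.2, h1.1, h1.2]

end PowerSums

/-! ### Counting exponents of bounded weight -/

section WeightCount

/-- The number of `a : ℕ ^ ws` with `∑ i, a i * ws i ≤ x`. -/
noncomputable def weightCount : List ℝ → ℝ → ℝ
  | [], x => if 0 ≤ x then 1 else 0
  | w :: ws, x => ∑ i ∈ Finset.range (⌊x / w⌋₊ + 1), weightCount ws (x - i * w)

/-- The integral of `weightCount ws` over `(-∞, x]`. -/
noncomputable def weightArea : List ℝ → ℝ → ℝ
  | [], x => max x 0
  | w :: ws, x => ∑ i ∈ Finset.range (⌊x / w⌋₊ + 1), weightArea ws (x - i * w)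

/-- The floor only cuts off terms with negative argument, which vanish. A common range for several x
allows termwise comparison and integration. -/
theorem sum_range_natFloor_eq_of_le {w : ℝ} (hw : 0 < w) {g : ℝ → ℝ} (hg : ∀ x < 0, g x = 0)
    {x : ℝ} {N : ℕ} (hN : ⌊x / w⌋₊ + 1 ≤ N) :
    ∑ i ∈ Finset.range (⌊x / w⌋₊ + 1), g (x - i * w) = ∑ i ∈ Finset.range N, g (x - i * w) := by
  refine Finset.sum_subset (Finset.range_mono hN) fun i _ hi => hg _ ?_
  have hi : ⌊x / w⌋₊ < i := by simpa [Nat.lt_succ_iff] using hi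
  rw [sub_neg, ← div_lt_iff₀ hw]
  exact Nat.lt_of_floor_lt hi

theorem weightCount_of_neg {ws : List ℝ} (hws : ∀ w ∈ ws, 0 < w) :
    ∀ x < 0, weightCount ws x = 0 := by
  induction ws with
  | nil => intro x hx; simp [weightCount, hx]
  | cons w ws ih =>
    intro x hx
    have hw : 0 < w := hws w (by simp)
    refine Finset.sum_eq_zero fun i _ => ih (fun v hv => hws v (by simp [hv])) _ ?_
    have : 0 ≤ i * w := by positivity
    linarith

theorem weightCount_nonneg (ws : List ℝ) : ∀ x, 0 ≤ weightCount ws x := by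
  induction ws with
  | nil => intro x; rw [weightCount]; split_ifs <;> norm_num
  | cons w ws ih => exact fun x => Finset.sum_nonneg fun i _ => ih _

theorem weightCount_cons_eq {w : ℝ} {ws : List ℝ} (hw : 0 < w) (hws : ∀ w ∈ ws, 0 < w) {x : ℝ}
    {N : ℕ} (hN : ⌊x / w⌋₊ + 1 ≤ N) :
    weightCount (w :: ws) x = ∑ i ∈ Finset.range N, weightCount ws (x - i * w) :=
  sum_range_natFloor_eq_of_le hw (weightCount_of_neg hws) hN

theorem weightCount_monotone {ws : List ℝ} (hws : ∀ w ∈ ws, 0 < w) : Monotone (weightCount ws) := by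
  induction ws with
  | nil =>
    intro x y hxy
    simp only [weightCount]
    split_ifs with h1 h2
    · exact le_rfl
    · exact absurd (h1.trans hxy) h2
    · exact zero_le_one
    · exact le_rfl
  | cons w ws ih =>
    intro x y hxy
    have hw : 0 < w := hws w (by simp)
    have hws' : ∀ v ∈ ws, 0 < v := fun v hv => hws v (by simp [hv])
    rw [weightCount_cons_eq hw hws' (le_max_left _ (⌊y / w⌋₊ + 1)),
      weightCount_cons_eq hw hws' (le_max_right (⌊x / w⌋₊ + 1) _)]
    exact Finset.sum_le_sum fun i _ => ih hws' (by linarith)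

theorem weightArea_of_nonpos {ws : List ℝ} (hws : ∀ w ∈ ws, 0 < w) :
    ∀ x ≤ 0, weightArea ws x = 0 := by
  induction ws with
  | nil => intro x hx; simp [weightArea, hx]
  | cons w ws ih =>
    intro x hx
    have hw : 0 < w := hws w (by simp)
    refine Finset.sum_eq_zero fun i _ => ih (fun v hv => hws v (by simp [hv])) _ ?_
    have : 0 ≤ i * w := by positivity
    linarith

theorem weightCount_intervalIntegrable {ws : List ℝ} (hws : ∀ w ∈ ws, 0 < w) (S T : ℝ) :
    IntervalIntegrable (weightCount ws) MeasureTheory.volume S T :=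
  (weightCount_monotone hws).intervalIntegrable

/-- The count vanishes on negative arguments, so any negative lower limit serves. Leaving it
arbitrary lets the induction absorb the substitution x - i w, which only lowers it. -/
theorem integral_weightCount {ws : List ℝ} (hws : ∀ w ∈ ws, 0 < w) :
    ∀ {c : ℝ}, c < 0 → ∀ {T : ℝ}, ∫ x in c..T, weightCount ws x = weightArea ws T := by
  induction ws with
  | nil =>
    intro c hc T
    have hneg : ∀ {T : ℝ}, T ≤ 0 → ∫ x in c..T, weightCount [] x = 0 := by
      intro T hT
      refine intervalIntegral.integral_zero_ae ?_
      filter_upwards [MeasureTheory.compl_mem_ae_iff.2 (MeasureTheory.measure_singleton (0 : ℝ))]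
        with x hx0 hx
      refine weightCount_of_neg (by simp) x (lt_of_le_of_ne ?_ hx0)
      rcases Set.mem_uIoc.1 hx with h | h
      · exact h.2.trans hT
      · exact h.2.trans hc.le
    rcases le_or_gt T 0 with hT | hT
    · rw [hneg hT, weightArea_of_nonpos (by simp) T hT]
    · rw [← intervalIntegral.integral_add_adjacent_intervals (b := 0)
        (weightCount_intervalIntegrable (by simp) _ _)
        (weightCount_intervalIntegrable (by simp) _ _), hneg le_rfl]
      have : ∫ x in (0 : ℝ)..T, weightCount [] x = ∫ x in (0 : ℝ)..T, (1 : ℝ) := by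
        refine intervalIntegral.integral_congr fun x hx => ?_
        rw [Set.uIcc_of_le hT.le] at hx
        simp [weightCount, hx.1]
      rw [this]
      simp [weightArea, hT.le]
  | cons w ws ih =>
    intro c hc T
    have hw : 0 < w := hws w (by simp)
    have hws' : ∀ v ∈ ws, 0 < v := fun v hv => hws v (by simp [hv])
    set N := max (⌊c / w⌋₊ + 1) (⌊T / w⌋₊ + 1) with hN
    have h1 : ∫ x in c..T, weightCount (w :: ws) x =
        ∫ x in c..T, ∑ i ∈ Finset.range N, weightCount ws (x - i * w) := by
      refine intervalIntegral.integral_congr fun x hx => weightCount_cons_eq hw hws' ?_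
      have hx : x ≤ max c T := hx.2
      rcases le_max_iff.1 hx with h | h
      · refine le_trans ?_ (le_max_left _ _)
        gcongr
      · refine le_trans ?_ (le_max_right _ _)
        gcongr
    have hint : ∀ i ∈ Finset.range N, IntervalIntegrable
        (fun x => weightCount ws (x - i * w)) MeasureTheory.volume c T := fun i _ =>
      Monotone.intervalIntegrable fun x y hxy =>
        weightCount_monotone hws' (sub_le_sub_right hxy (i * w))
    rw [h1, intervalIntegral.integral_finsetSum hint]
    have h2 : weightArea (w :: ws) T = ∑ i ∈ Finset.range N, weightArea ws (T - i * w) :=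
      sum_range_natFloor_eq_of_le hw (fun x hx => weightArea_of_nonpos hws' x hx.le)
        (le_max_right _ _)
    rw [h2]
    refine Finset.sum_congr rfl fun i _ => ?_
    rw [intervalIntegral.integral_comp_sub_right (fun x => weightCount ws x)]
    refine ih hws' ?_
    have : 0 ≤ i * w := by positivity
    linarith

/-- Summing over O(1 + x) multiples of w raises the order of an error by one. The factor `d` makes
the hypothesis mean that E vanishes when d = 0, where the exponent `d - 1` is truncated. -/
theorem exists_abs_sum_mul_le {w : ℝ} (hw : 0 < w) {C : ℝ} (hC : 0 ≤ C) {d : ℕ} {E : ℝ → ℝ}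
    (hE : ∀ x, 0 ≤ x → |E x| ≤ C * d * (1 + x) ^ (d - 1)) : ∀ x, 0 ≤ x →
    |∑ i ∈ Finset.range (⌊x / w⌋₊ + 1), E (x - i * w)| ≤ (1 / w + 1) * C * d * (1 + x) ^ d := by
  intro x hx
  calc _ ≤ ∑ i ∈ Finset.range (⌊x / w⌋₊ + 1), C * d * (1 + x) ^ (d - 1) := by
        refine (Finset.abs_sum_le_sum_abs _ _).trans (Finset.sum_le_sum fun i hi => ?_)
        have hi' := mul_le_of_lt_natFloor_div_add_one hw hx (Finset.mem_range.1 hi)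
        have hi'' : 0 ≤ i * w := by positivity
        refine (hE _ (by linarith)).trans ?_
        have : 0 ≤ x - i * w := by linarith
        gcongr
        linarith
    _ = ((⌊x / w⌋₊ + 1 : ℕ) : ℝ) * (C * d * (1 + x) ^ (d - 1)) := by
        rw [Finset.sum_const, Finset.card_range, nsmul_eq_mul]
    _ ≤ ((1 / w + 1) * (1 + x)) * (C * d * (1 + x) ^ (d - 1)) := by
        gcongr
        exact natFloor_div_add_one_le hw hx
    _ = (1 / w + 1) * C * (d * ((1 + x) * (1 + x) ^ (d - 1))) := by ring
    _ = _ := by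
        rcases d with _ | d
        · simp
        · rw [Nat.add_sub_cancel, ← pow_succ']
          ring

/-- The density of the lattice points counted by `weightCount ws`. -/
noncomputable def weightDensity (ws : List ℝ) : ℝ := 1 / ws.prod

theorem weightDensity_pos {ws : List ℝ} (hws : ∀ w ∈ ws, 0 < w) : 0 < weightDensity ws :=
  one_div_pos.2 (List.prod_pos hws)

theorem exists_abs_weightCount_sub_le {ws : List ℝ} (hws : ∀ w ∈ ws, 0 < w) :
    ∃ C : ℝ, 0 ≤ C ∧ ∀ x, 0 ≤ x →
      |weightCount ws x - weightDensity ws / ws.length.factorial * x ^ ws.length| ≤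
        C * ws.length * (1 + x) ^ (ws.length - 1) := by
  induction ws with
  | nil => exact ⟨0, le_rfl, fun x hx => by simp [weightCount, hx, weightDensity]⟩
  | cons w ws ih =>
    have hw : 0 < w := hws w (by simp)
    obtain ⟨C, hC, h⟩ := ih fun v hv => hws v (by simp [hv])
    obtain ⟨D, hD, h'⟩ := exists_abs_powerSum_sub_le' hw ws.length
    set d := ws.length with hd
    set α := weightDensity ws / d.factorial with hα
    have h'' := exists_abs_sum_mul_le hw hC h
    refine ⟨(1 / w + 1) * C * d + |α| * D, by positivity, fun x hx => ?_⟩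
    have hlen : (w :: ws).length = d + 1 := rfl
    have hα' : weightDensity (w :: ws) / (d + 1).factorial = α / ((d + 1) * w) := by
      rw [hα, weightDensity, weightDensity, List.prod_cons, Nat.factorial_succ]
      push_cast
      rw [div_div, div_div, div_div]
      congr 1
      ring
    rw [hlen, hα', Nat.add_sub_cancel]
    have heq : weightCount (w :: ws) x - α / ((d + 1) * w) * x ^ (d + 1) =
        ∑ i ∈ Finset.range (⌊x / w⌋₊ + 1), (weightCount ws (x - i * w) - α * (x - i * w) ^ d) +
        α * (∑ i ∈ Finset.range (⌊x / w⌋₊ + 1), (x - i * w) ^ d - x ^ (d + 1) / ((d + 1) * w)) := by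
      rw [Finset.sum_sub_distrib, ← Finset.mul_sum, weightCount]
      ring
    rw [heq]
    have hpos : 0 ≤ (1 + x) ^ d := by positivity
    calc _ ≤ (1 / w + 1) * C * d * (1 + x) ^ d + |α| * (D * (1 + x) ^ d) := by
          refine (abs_add_le _ _).trans (add_le_add (h'' x hx) ?_)
          rw [abs_mul]
          gcongr
          exact h' x hx
      _ = ((1 / w + 1) * C * d + |α| * D) * (1 + x) ^ d := by ring
      _ ≤ ((1 / w + 1) * C * d + |α| * D) * (1 + x) ^ d * (d + 1) := by
          refine le_mul_of_one_le_right (by positivity) ?_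
          linarith [(Nat.cast_nonneg d : (0 : ℝ) ≤ d)]
      _ = _ := by push_cast; ring

/-- The count itself jumps and has only a first-order expansion in general; integration smooths it
enough for a second term. This is why the second coefficient is defined by an average. -/
theorem exists_abs_weightArea_sub_le {ws : List ℝ} (hws : ∀ w ∈ ws, 0 < w) :
    ∃ β C : ℝ, 0 ≤ C ∧ ∀ x, 0 ≤ x →
      |weightArea ws x - (weightDensity ws / (ws.length + 1).factorial * x ^ (ws.length + 1) +
        β * x ^ ws.length)| ≤ C * ws.length * (1 + x) ^ (ws.length - 1) := by
  induction ws with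
  | nil => exact ⟨0, 0, le_rfl, fun x hx => by simp [weightArea, hx, weightDensity]⟩
  | cons w ws ih =>
    have hw : 0 < w := hws w (by simp)
    obtain ⟨β, C, hC, h⟩ := ih fun v hv => hws v (by simp [hv])
    obtain ⟨D, hD, h'⟩ := exists_abs_powerSum_sub_le hw (ws.length + 1)
    obtain ⟨D', hD', h₂⟩ := exists_abs_powerSum_sub_le' hw ws.length
    set d := ws.length with hd
    set α := weightDensity ws / (d + 1).factorial with hα
    have h'' := exists_abs_sum_mul_le hw hC h
    -- The term α / 2 is the Euler-Maclaurin end correction for the leading monomial; the other is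
    -- the main term of the sum of the previous second-order monomials.
    refine ⟨α / 2 + β / ((d + 1) * w), (1 / w + 1) * C * d + |α| * D + |β| * D', by positivity,
      fun x hx => ?_⟩
    have hlen : (w :: ws).length = d + 1 := rfl
    have hα' : weightDensity (w :: ws) / (d + 1 + 1).factorial = α / ((d + 2) * w) := by
      rw [hα, weightDensity, weightDensity, List.prod_cons, Nat.factorial_succ (d + 1)]
      push_cast
      rw [div_div, div_div, div_div]
      congr 1
      ring
    rw [hlen, hα', Nat.add_sub_cancel]
    have heq : weightArea (w :: ws) x - (α / ((d + 2) * w) * x ^ (d + 1 + 1) +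
          (α / 2 + β / ((d + 1) * w)) * x ^ (d + 1)) =
        ∑ i ∈ Finset.range (⌊x / w⌋₊ + 1), (weightArea ws (x - i * w) -
          (α * (x - i * w) ^ (d + 1) + β * (x - i * w) ^ d)) +
        α * (∑ i ∈ Finset.range (⌊x / w⌋₊ + 1), (x - i * w) ^ (d + 1) -
          (x ^ (d + 1 + 1) / (((d + 1 : ℕ) + 1) * w) + x ^ (d + 1) / 2)) +
        β * (∑ i ∈ Finset.range (⌊x / w⌋₊ + 1), (x - i * w) ^ d - x ^ (d + 1) / ((d + 1) * w)) := by
      rw [Finset.sum_sub_distrib, Finset.sum_add_distrib, ← Finset.mul_sum, ← Finset.mul_sum,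
        weightArea]
      push_cast
      rw [show (d : ℝ) + 1 + 1 = d + 2 by ring]
      ring
    rw [heq]
    have hpos : 0 ≤ (1 + x) ^ d := by positivity
    calc _ ≤ (1 / w + 1) * C * d * (1 + x) ^ d + |α| * (D * (1 + x) ^ d) +
          |β| * (D' * (1 + x) ^ d) := by
          refine (abs_add_le _ _).trans (add_le_add ((abs_add_le _ _).trans
            (add_le_add (h'' x hx) ?_)) ?_)
          · rw [abs_mul]
            gcongr
            exact h' x hx
          · rw [abs_mul]
            gcongr
            exact h₂ x hx
      _ = ((1 / w + 1) * C * d + |α| * D + |β| * D') * (1 + x) ^ d := by ring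
      _ ≤ ((1 / w + 1) * C * d + |α| * D + |β| * D') * (1 + x) ^ d * (d + 1) := by
          refine le_mul_of_one_le_right (by positivity) ?_
          linarith [(Nat.cast_nonneg d : (0 : ℝ) ≤ d)]
      _ = _ := by push_cast; ring

end WeightCount

/-! ### Calculus of Riemann-Roch coefficients of functions -/

section Asymptotic

/-- `a` and `b` are Riemann-Roch coefficients of the locally integrable function `h`. -/
structure HasRiemannRoch (n : ℕ) (h : ℝ → ℝ) (a b : ℝ) : Prop where
  integrable : ∀ S T, IntervalIntegrable h MeasureTheory.volume S T
  leading : (fun x : ℝ => h x - a / n.factorial * x ^ n) =O[atTop] fun x : ℝ => x ^ (n - 1)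
  area : (fun T : ℝ => (∫ x in (1 : ℝ)..T, h x) -
    (a / (n + 1).factorial * T ^ (n + 1) + b / n.factorial * T ^ n)) =o[atTop] fun T : ℝ => T ^ n

theorem isBigO_sub_pow (c : ℝ) (m : ℕ) :
    (fun x : ℝ => (x - c) ^ m) =O[atTop] fun x : ℝ => x ^ m := by
  have : (fun x : ℝ => x - c) =O[atTop] fun x : ℝ => x :=
    (isBigO_refl _ _).sub (isLittleO_const_id_atTop c).isBigO
  exact this.pow m

theorem isBigO_pow_of_le {m n : ℕ} (h : m ≤ n) :
    (fun x : ℝ => x ^ m) =O[atTop] fun x : ℝ => x ^ n := by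
  refine IsBigO.of_bound 1 ?_
  filter_upwards [eventually_ge_atTop (1 : ℝ)] with x hx
  rw [one_mul, Real.norm_of_nonneg (by positivity), Real.norm_of_nonneg (by positivity)]
  exact pow_le_pow_right₀ hx h

theorem isLittleO_pow_of_lt {m n : ℕ} (h : m < n) :
    (fun x : ℝ => x ^ m) =o[atTop] fun x : ℝ => x ^ n :=
  isLittleO_pow_pow_atTop_of_lt h

theorem isLittleO_const_pow {n : ℕ} (hn : 1 ≤ n) (c : ℝ) :
    (fun _ : ℝ => c) =o[atTop] fun x : ℝ => x ^ n := by
  have := (isLittleO_pow_of_lt (show 0 < n by omega)).const_mul_left c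
  simpa using this

theorem eq_zero_of_isLittleO_pow {c : ℝ} {n : ℕ}
    (h : (fun x : ℝ => c * x ^ n) =o[atTop] fun x : ℝ => x ^ n) : c = 0 := by
  have h1 := h.tendsto_div_nhds_zero
  refine tendsto_nhds_unique (tendsto_const_nhds.congr' ?_) h1
  filter_upwards [eventually_gt_atTop (0 : ℝ)] with x hx
  field_simp

/-- First order Taylor expansion of a shifted power. -/
theorem isBigO_sub_pow_sub_pow (c : ℝ) (m : ℕ) :
    (fun x : ℝ => (x - c) ^ m - x ^ m) =O[atTop] fun x : ℝ => x ^ (m - 1) := by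
  induction m with
  | zero => simpa using isBoundedUnder_const
  | succ m ih =>
    rcases m with _ | m
    · simpa using isBoundedUnder_const
    have h1 : (fun x : ℝ => x * ((x - c) ^ (m + 1) - x ^ (m + 1))) =O[atTop]
        fun x : ℝ => x ^ (m + 1) := by
      have := (isBigO_refl (fun x : ℝ => x) atTop).mul ih
      simpa [← pow_succ'] using this
    have h2 := (isBigO_sub_pow c (m + 1)).const_mul_left c
    refine (h1.sub h2).congr_left fun x => ?_
    ring

/-- Second order Taylor expansion of a shifted power. -/
theorem isLittleO_sub_pow_sub_pow (c : ℝ) (m : ℕ) :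
    (fun x : ℝ => (x - c) ^ (m + 1) - (x ^ (m + 1) - (m + 1) * c * x ^ m)) =o[atTop]
      fun x : ℝ => x ^ m := by
  induction m with
  | zero => simp
  | succ m ih =>
    have h1 : (fun x : ℝ => x * ((x - c) ^ (m + 1) - (x ^ (m + 1) - (m + 1) * c * x ^ m))) =o[atTop]
        fun x : ℝ => x ^ (m + 1) := by
      have := (isBigO_refl (fun x : ℝ => x) atTop).mul_isLittleO ih
      simpa [← pow_succ'] using this
    have h2 : (fun x : ℝ => c * ((x - c) ^ (m + 1) - x ^ (m + 1))) =o[atTop]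
        fun x : ℝ => x ^ (m + 1) :=
      ((isBigO_sub_pow_sub_pow c (m + 1)).trans_isLittleO
        (isLittleO_pow_of_lt (by omega))).const_mul_left c
    refine (h1.sub h2).congr_left fun x => ?_
    push_cast
    ring

namespace HasRiemannRoch

variable {n : ℕ} {h h' : ℝ → ℝ} {a b a' b' : ℝ}

theorem add (H : HasRiemannRoch n h a b) (H' : HasRiemannRoch n h' a' b') :
    HasRiemannRoch n (fun x => h x + h' x) (a + a') (b + b') where
  integrable S T := (H.integrable S T).add (H'.integrable S T)
  leading := (H.leading.add H'.leading).congr_left fun x => by ring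
  area := (H.area.add H'.area).congr_left fun T => by
    rw [intervalIntegral.integral_add (H.integrable _ _) (H'.integrable _ _)]
    ring

theorem sub (H : HasRiemannRoch n h a b) (H' : HasRiemannRoch n h' a' b') :
    HasRiemannRoch n (fun x => h x - h' x) (a - a') (b - b') where
  integrable S T := (H.integrable S T).sub (H'.integrable S T)
  leading := (H.leading.sub H'.leading).congr_left fun x => by ring
  area := (H.area.sub H'.area).congr_left fun T => by
    rw [intervalIntegral.integral_sub (H.integrable _ _) (H'.integrable _ _)]
    ring

theorem zero (n : ℕ) : HasRiemannRoch n (fun _ => 0) 0 0 where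
  integrable S T := intervalIntegrable_const
  leading := by simpa using isBigO_zero _ _
  area := by simp

theorem list_sum {ι : Type*} {l : List ι} {f : ι → ℝ → ℝ} {α β : ι → ℝ}
    (H : ∀ i ∈ l, HasRiemannRoch n (f i) (α i) (β i)) :
    HasRiemannRoch n (fun x => (l.map fun i => f i x).sum) (l.map α).sum (l.map β).sum := by
  induction l with
  | nil => simpa using zero n
  | cons i l ih =>
    simpa using (H i (by simp)).add (ih fun j hj => H j (by simp [hj]))

theorem unique (hn : 1 ≤ n) (H : HasRiemannRoch n h a b) (H' : HasRiemannRoch n h a' b') :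
    a = a' ∧ b = b' := by
  have ha : a = a' := by
    have h1 := (H'.leading.sub H.leading).trans_isLittleO
      (isLittleO_pow_of_lt (show n - 1 < n by omega))
    have h2 : (a - a') / n.factorial = 0 :=
      eq_zero_of_isLittleO_pow (n := n) (h1.congr_left fun x => by ring)
    rw [div_eq_zero_iff] at h2
    rcases h2 with h2 | h2
    · linarith
    · exact absurd h2 (by positivity)
  subst ha
  refine ⟨rfl, ?_⟩
  have h2 : (b - b') / n.factorial = 0 :=
    eq_zero_of_isLittleO_pow (n := n) ((H'.area.sub H.area).congr_left fun x => by ring)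
  rw [div_eq_zero_iff] at h2
  rcases h2 with h2 | h2
  · linarith
  · exact absurd h2 (by positivity)

/-- The second-order shift of T^(n + 1) is -(n + 1) c T^n, which multiplied by a / (n + 1)! becomes
-c a / n! T^n; all other changes are of lower order. -/
theorem comp_sub_right (hn : 1 ≤ n) (H : HasRiemannRoch n h a b) (c : ℝ) :
    HasRiemannRoch n (fun x => h (x - c)) a (b - c * a) where
  integrable S T := by
    have := (H.integrable (S - c) (T - c)).comp_sub_right c
    simpa using this
  leading := by
    have ht : Tendsto (fun x : ℝ => x - c) atTop atTop := tendsto_atTop_add_const_right _ _ tendsto_id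
    have h1 := (H.leading.comp_tendsto ht).trans (isBigO_sub_pow c (n - 1))
    have h2 := (isBigO_sub_pow_sub_pow c n).const_mul_left (a / n.factorial)
    refine (h1.add h2).congr_left fun x => ?_
    simp only [Function.comp]
    ring
  area := by
    have ht : Tendsto (fun x : ℝ => x - c) atTop atTop := tendsto_atTop_add_const_right _ _ tendsto_id
    have h1 := (H.area.comp_tendsto ht).trans_isBigO (isBigO_sub_pow c n)
    have h2 := (isLittleO_sub_pow_sub_pow c n).const_mul_left (a / (n + 1).factorial)
    have h3 : (fun x : ℝ => b / n.factorial * ((x - c) ^ n - x ^ n)) =o[atTop]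
        fun x : ℝ => x ^ n :=
      ((isBigO_sub_pow_sub_pow c n).trans_isLittleO
        (isLittleO_pow_of_lt (by omega))).const_mul_left _
    have h4 := isLittleO_const_pow hn (∫ x in (1 - c)..1, h x)
    refine (((h1.add h2).add h3).add h4).congr_left fun T => ?_
    have h5 : ∫ x in (1 : ℝ)..T, h (x - c) =
        (∫ x in (1 - c)..1, h x) + ∫ x in (1 : ℝ)..(T - c), h x := by
      rw [intervalIntegral.integral_comp_sub_right,
        intervalIntegral.integral_add_adjacent_intervals (H.integrable _ _) (H.integrable _ _)]
    rw [h5]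
    simp only [Function.comp]
    have h6 : a / n.factorial = a / (n + 1).factorial * (n + 1) := by
      rw [Nat.factorial_succ]
      push_cast
      field_simp
    rw [sub_div, mul_div_assoc, h6]
    ring

end HasRiemannRoch

theorem isBigO_one_add_pow (m : ℕ) :
    (fun x : ℝ => (1 + x) ^ m) =O[atTop] fun x : ℝ => x ^ m := by
  simpa [add_comm] using isBigO_sub_pow (-1) m

/-- The coefficients of `weightCount ws` in degree `n ≥ length ws`. -/
theorem exists_hasRiemannRoch_weightCount {ws : List ℝ} (hws : ∀ w ∈ ws, 0 < w) {n : ℕ}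
    (hn : 1 ≤ n) (hlen : ws.length ≤ n) : ∃ b, HasRiemannRoch n (weightCount ws)
      (if ws.length = n then weightDensity ws else 0) b ∧
      (ws.length < n → b = if ws.length = n - 1 then weightDensity ws else 0) := by
  obtain ⟨C, hC, hcount⟩ := exists_abs_weightCount_sub_le hws
  obtain ⟨β, D, hD, harea⟩ := exists_abs_weightArea_sub_le hws
  set d := ws.length with hd
  have hcount' : (fun x => weightCount ws x - weightDensity ws / d.factorial * x ^ d) =O[atTop]
      fun x : ℝ => x ^ (d - 1) := by
    refine IsBigO.trans (IsBigO.of_bound (C * d) ?_) (isBigO_one_add_pow (d - 1))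
    filter_upwards [eventually_ge_atTop (0 : ℝ)] with x hx
    rw [Real.norm_eq_abs, Real.norm_of_nonneg (by positivity : 0 ≤ (1 + x) ^ (d - 1))]
    exact hcount x hx
  have harea' : (fun x => weightArea ws x - (weightDensity ws / (d + 1).factorial * x ^ (d + 1) +
      β * x ^ d)) =o[atTop] fun x : ℝ => x ^ d := by
    have h1 : (fun x => weightArea ws x - (weightDensity ws / (d + 1).factorial * x ^ (d + 1) +
        β * x ^ d)) =O[atTop] fun x : ℝ => d * x ^ (d - 1) := by
      have h2 : (fun x => weightArea ws x - (weightDensity ws / (d + 1).factorial * x ^ (d + 1) +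
          β * x ^ d)) =O[atTop] fun x : ℝ => d * (1 + x) ^ (d - 1) := by
        refine IsBigO.of_bound D ?_
        filter_upwards [eventually_ge_atTop (0 : ℝ)] with x hx
        rw [Real.norm_eq_abs,
          Real.norm_of_nonneg (by positivity : 0 ≤ (d : ℝ) * (1 + x) ^ (d - 1)), ← mul_assoc]
        exact harea x hx
      exact h2.trans ((isBigO_refl _ _).mul (isBigO_one_add_pow (d - 1)))
    refine h1.trans_isLittleO ?_
    -- At d = 0 the power x^(d - 1) = 1 is not negligible against x^d = 1, but the factor d makes
    -- the bound zero.
    rcases Nat.eq_zero_or_pos d with h0 | h0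
    · simp [h0]
    · exact (isLittleO_pow_of_lt (by omega)).const_mul_left _
  have hint : ∀ T, ∫ x in (1 : ℝ)..T, weightCount ws x =
      weightArea ws T - ∫ x in (-1 : ℝ)..1, weightCount ws x := by
    intro T
    rw [← integral_weightCount hws (show (-1 : ℝ) < 0 by norm_num),
      ← intervalIntegral.integral_add_adjacent_intervals
        (weightCount_intervalIntegrable hws (-1) 1) (weightCount_intervalIntegrable hws 1 T)]
    ring
  have hconst := isLittleO_const_pow hn (∫ x in (-1 : ℝ)..1, weightCount ws x)
  have hfact : (0 : ℝ) < n.factorial := by positivity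
  rcases hlen.eq_or_lt with heq | hlt
  · refine ⟨β * n.factorial, ⟨weightCount_intervalIntegrable hws, ?_, ?_⟩, fun h => ?_⟩
    · rw [if_pos heq, ← heq]
      exact hcount'
    · rw [if_pos heq]
      rw [heq] at harea'
      refine (harea'.sub hconst).congr_left fun T => ?_
      rw [hint, mul_div_cancel_right₀ _ hfact.ne']
      ring
    · omega
  -- With fewer than n weights the area grows like T^(d + 1), so it reaches the order T^n only for d
  -- = n - 1, and then its leading coefficient is b / n!. No uncontrolled second-order term enters.
  · refine ⟨if d = n - 1 then weightDensity ws else 0,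
      ⟨weightCount_intervalIntegrable hws, ?_, ?_⟩, fun h => rfl⟩
    · rw [if_neg hlt.ne]
      have h1 := hcount'.trans (isBigO_pow_of_le (show d - 1 ≤ n - 1 by omega))
      have h2 := (isBigO_pow_of_le (show d ≤ n - 1 by omega)).const_mul_left
        (weightDensity ws / d.factorial)
      exact (h1.add h2).congr_left fun x => by ring
    · rw [if_neg hlt.ne]
      have h1 := harea'.trans_isBigO (isBigO_pow_of_le hlt.le)
      have h2 := (isLittleO_pow_of_lt hlt).const_mul_left β
      split_ifs with hdn
      · have hdn' : d + 1 = n := by omega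
        refine ((h1.add h2).sub hconst).congr_left fun T => ?_
        rw [hint, hdn']
        ring
      · have h3 := (isLittleO_pow_of_lt (show d + 1 < n by omega)).const_mul_left
          (weightDensity ws / (d + 1).factorial)
        refine (((h1.add h2).add h3).sub hconst).congr_left fun T => ?_
        rw [hint]
        ring

end Asymptotic

/-! ### Finite sums of translated counting functions -/

section WeightSum

/-- `h` is a finite sum of translates of functions `weightCount ws`, with `ws` a sublist of `W`. -/
def IsWeightSum (W : List ℝ) (h : ℝ → ℝ) : Prop :=
  ∃ l : List (ℝ × List ℝ), (∀ p ∈ l, p.2.Sublist W) ∧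
    ∀ x, h x = (l.map fun p => weightCount p.2 (x - p.1)).sum

/-- The monoid generated by the densities of the sublists of `W` of length `d`. -/
def densityMonoid (W : List ℝ) (d : ℕ) : AddSubmonoid ℝ :=
  AddSubmonoid.closure (weightDensity '' {ws | ws.Sublist W ∧ ws.length = d})

variable {W : List ℝ} {h h' : ℝ → ℝ}

theorem IsWeightSum.zero (W : List ℝ) : IsWeightSum W fun _ => 0 :=
  ⟨[], by simp, by simp⟩

theorem IsWeightSum.add (H : IsWeightSum W h) (H' : IsWeightSum W h') :
    IsWeightSum W fun x => h x + h' x := by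
  obtain ⟨l, hl, hx⟩ := H
  obtain ⟨l', hl', hx'⟩ := H'
  refine ⟨l ++ l', fun p hp => ?_, fun x => by simp [hx, hx']⟩
  rcases List.mem_append.1 hp with hp | hp
  exacts [hl p hp, hl' p hp]

theorem IsWeightSum.sum {ι : Type*} (s : Finset ι) {f : ι → ℝ → ℝ}
    (H : ∀ i ∈ s, IsWeightSum W (f i)) : IsWeightSum W fun x => ∑ i ∈ s, f i x := by
  classical
  induction s using Finset.induction_on with
  | empty => simpa using IsWeightSum.zero W
  | insert i s hi ih =>
    simp only [Finset.sum_insert hi]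
    exact (H i (by simp)).add (ih fun j hj => H j (by simp [hj]))

theorem IsWeightSum.mono {W' : List ℝ} (H : IsWeightSum W h) (hW : W.Sublist W') :
    IsWeightSum W' h := by
  obtain ⟨l, hl, hx⟩ := H
  exact ⟨l, fun p hp => (hl p hp).trans hW, hx⟩

theorem isWeightSum_indicator (W : List ℝ) (c : ℝ) :
    IsWeightSum W fun x => if c ≤ x then 1 else 0 :=
  ⟨[(c, [])], by simp, by simp [weightCount]⟩

theorem List.sum_map_finsetSum {ι κ : Type*} (l : List ι) (s : Finset κ) (f : ι → κ → ℝ) :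
    (l.map fun i => ∑ j ∈ s, f i j).sum = ∑ j ∈ s, (l.map fun i => f i j).sum := by
  induction l with
  | nil => simp
  | cons i l ih => simp [ih, Finset.sum_add_distrib]

/-- Summing a weight sum over all multiples of a new weight `w` gives a weight sum. -/
theorem IsWeightSum.exists_sum_range_eq (H : IsWeightSum W h) (hW : ∀ v ∈ W, 0 < v) {w : ℝ}
    (hw : 0 < w) : ∃ g, IsWeightSum (w :: W) g ∧
      ∀ x, ∀ᶠ N in atTop, g x = ∑ i ∈ Finset.range N, h (x - i * w) := by
  obtain ⟨l, hl, hx⟩ := H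
  refine ⟨fun x => (l.map fun p => weightCount (w :: p.2) (x - p.1)).sum,
    ⟨l.map fun p => (p.1, w :: p.2), ?_, fun x => by simp [Function.comp_def]⟩, fun x => ?_⟩
  · intro p hp
    obtain ⟨q, hq, rfl⟩ := List.mem_map.1 hp
    exact (hl q hq).cons_cons w
  · have : ∀ p ∈ l, ∀ᶠ N in atTop, weightCount (w :: p.2) (x - p.1) =
        ∑ i ∈ Finset.range N, weightCount p.2 (x - i * w - p.1) := by
      intro p hp
      filter_upwards [eventually_ge_atTop (⌊(x - p.1) / w⌋₊ + 1)] with N hN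
      rw [weightCount_cons_eq hw (fun v hv => hW v ((hl p hp).subset hv)) hN]
      refine Finset.sum_congr rfl fun i _ => ?_
      congr 1
      ring
    have h2 : ∀ᶠ N in atTop, ∀ p ∈ l, weightCount (w :: p.2) (x - p.1) =
        ∑ i ∈ Finset.range N, weightCount p.2 (x - i * w - p.1) := by
      have h3 := (List.finite_toSet l).eventually_all (l := atTop) (p := fun p N =>
        weightCount (w :: p.2) (x - p.1) =
          ∑ i ∈ Finset.range N, weightCount p.2 (x - i * w - p.1))
      exact h3.2 this
    filter_upwards [h2] with N hN
    simp only [hx]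
    rw [← List.sum_map_finsetSum]
    congr 1
    exact List.map_congr_left hN

theorem densityMonoid_nonneg (hW : ∀ v ∈ W, 0 < v) {d : ℕ} {t : ℝ} (ht : t ∈ densityMonoid W d) :
    0 ≤ t := by
  induction ht using AddSubmonoid.closure_induction with
  | mem t ht =>
    obtain ⟨ws, ⟨hws, -⟩, rfl⟩ := ht
    exact (weightDensity_pos fun v hv => hW v (hws.subset hv)).le
  | zero => exact le_rfl
  | add s t _ _ hs ht => exact add_nonneg hs ht

/-- The discreteness behind the whole argument: a list has finitely many sublists, and finitely many
nonnegative reals generate a partially well-ordered monoid. -/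
theorem isPWO_densityMonoid (hW : ∀ v ∈ W, 0 < v) (d : ℕ) :
    (densityMonoid W d : Set ℝ).IsPWO := by
  refine Set.IsPWO.addSubmonoid_closure ?_ (Set.Finite.isPWO (Set.Finite.image _ ?_))
  · rintro _ ⟨ws, ⟨hws, -⟩, rfl⟩
    exact (weightDensity_pos fun v hv => hW v (hws.subset hv)).le
  · refine (List.finite_toSet W.sublists).subset fun ws hws => ?_
    exact List.mem_sublists.2 hws.1

/-- A count grows exactly like the power given by its number of weights, its density being positive.
-/
theorem length_le_of_isBigO {ws : List ℝ} (hws : ∀ w ∈ ws, 0 < w) {n : ℕ} (c : ℝ)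
    (h : (fun x => weightCount ws (x - c)) =O[atTop] fun x : ℝ => x ^ n) : ws.length ≤ n := by
  by_contra! hlt
  obtain ⟨b, H, -⟩ := exists_hasRiemannRoch_weightCount hws (by omega : 1 ≤ ws.length) le_rfl
  rw [if_pos rfl] at H
  have ht : Tendsto (fun x : ℝ => x - (-c)) atTop atTop := tendsto_atTop_add_const_right _ _ tendsto_id
  have h1 := (h.comp_tendsto ht).trans (isBigO_sub_pow (-c) n)
  have h2 := h1.trans_isLittleO (isLittleO_pow_of_lt hlt)
  have h3 := H.leading.trans_isLittleO (isLittleO_pow_of_lt (show ws.length - 1 < ws.length by omega))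
  have h4 : weightDensity ws / ws.length.factorial = 0 :=
    eq_zero_of_isLittleO_pow (n := ws.length) ((h2.sub h3).congr_left fun x => by
      simp [Function.comp])
  have h5 : 0 < weightDensity ws / ws.length.factorial :=
    div_pos (weightDensity_pos hws) (by positivity)
  exact h5.ne' h4

/-- A weight sum of growth at most `n` has Riemann-Roch coefficients. -/
theorem IsWeightSum.exists_hasRiemannRoch (H : IsWeightSum W h) (hW : ∀ v ∈ W, 0 < v) {n : ℕ}
    (hn : 1 ≤ n) (hO : h =O[atTop] fun x : ℝ => x ^ n) :
    ∃ a b, HasRiemannRoch n h a b ∧ a ∈ densityMonoid W n ∧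
      (a = 0 → b ∈ densityMonoid W (n - 1)) := by
  obtain ⟨l, hl, hx⟩ := H
  have hpos : ∀ p ∈ l, ∀ v ∈ p.2, 0 < v := fun p hp v hv => hW v ((hl p hp).subset hv)
  -- The summands are nonnegative, so none cancels and each is bounded by h.
  have hlen : ∀ p ∈ l, p.2.length ≤ n := by
    intro p hp
    refine length_le_of_isBigO (hpos p hp) p.1 (IsBigO.trans (IsBigO.of_bound 1 ?_) hO)
    refine .of_forall fun x => ?_
    rw [one_mul, Real.norm_of_nonneg (weightCount_nonneg _ _), hx]
    refine le_trans ?_ (le_abs_self _)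
    exact List.single_le_sum (by
      rintro _ ht
      obtain ⟨q, -, rfl⟩ := List.mem_map.1 ht
      exact weightCount_nonneg _ _) _
      (List.mem_map_of_mem (f := fun p => weightCount p.2 (x - p.1)) hp)
  have hex : ∀ p : ℝ × List ℝ, ∃ b, p ∈ l → HasRiemannRoch n (weightCount p.2)
      (if p.2.length = n then weightDensity p.2 else 0) b ∧
      (p.2.length < n → b = if p.2.length = n - 1 then weightDensity p.2 else 0) := by
    intro p
    by_cases hp : p ∈ l
    · obtain ⟨b, hb⟩ := exists_hasRiemannRoch_weightCount (hpos p hp) hn (hlen p hp)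
      exact ⟨b, fun _ => hb⟩
    · exact ⟨0, fun h => absurd h hp⟩
  choose β hβ using hex
  set α : ℝ × List ℝ → ℝ := fun p => if p.2.length = n then weightDensity p.2 else 0 with hα
  have hα0 : ∀ p ∈ l, 0 ≤ α p := by
    intro p hp
    simp only [hα]
    split_ifs
    · exact (weightDensity_pos (hpos p hp)).le
    · exact le_rfl
  refine ⟨(l.map α).sum, (l.map fun p => β p - p.1 * α p).sum, ?_, ?_, ?_⟩
  · have := HasRiemannRoch.list_sum (l := l) (f := fun p x => weightCount p.2 (x - p.1)) (α := α)
      (β := fun p => β p - p.1 * α p) (n := n)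
      fun p hp => (hβ p hp).1.comp_sub_right hn p.1
    rwa [show h = _ from funext hx]
  · refine AddSubmonoid.list_sum_mem _ fun t ht => ?_
    obtain ⟨p, hp, rfl⟩ := List.mem_map.1 ht
    simp only [hα]
    split_ifs with hd
    · exact AddSubmonoid.subset_closure ⟨_, ⟨hl p hp, hd⟩, rfl⟩
    · exact zero_mem _
  · intro h0
    refine AddSubmonoid.list_sum_mem _ fun t ht => ?_
    obtain ⟨p, hp, rfl⟩ := List.mem_map.1 ht
    -- Nonnegative leading coefficients with sum zero all vanish. This removes the terms -p.1 * α p,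
    -- in which the arbitrary real translation occurs, and leaves only densities.
    have hαp : α p = 0 := by
      refine le_antisymm ?_ (hα0 p hp)
      rw [← h0]
      exact List.single_le_sum (by
        rintro _ ht
        obtain ⟨q, hq, rfl⟩ := List.mem_map.1 ht
        exact hα0 q hq) _
        (List.mem_map_of_mem (f := α) hp)
    have hlt : p.2.length < n := by
      refine lt_of_le_of_ne (hlen p hp) fun heq => ?_
      simp only [hα, if_pos heq] at hαp
      exact (weightDensity_pos (hpos p hp)).ne' hαp
    rw [hαp, (hβ p hp).2 hlt, mul_zero, sub_zero]
    split_ifs with hd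
    · exact AddSubmonoid.subset_closure ⟨_, ⟨hl p hp, hd⟩, rfl⟩
    · exact zero_mem _

end WeightSum

/-! ### Truncated dimensions of homogeneous subspaces -/

section Truncation

variable {k M : Type*} [Field k] [AddCommGroup M] [Module k M]
  (ℳ : ℝ → Submodule k M)

/-- The subspace `M_{≤ x}` of a graded vector space. -/
def gradedLE (x : ℝ) : Submodule k M := ⨆ t : Set.Iic x, ℳ t

/-- The dimension of `U ∩ M_{≤ x}`. -/
noncomputable def hilbertFun (U : Submodule k M) (x : ℝ) : ℝ :=
  Module.finrank k (U ⊓ gradedLE ℳ x : Submodule k M)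

variable {ℳ}

theorem le_gradedLE {t x : ℝ} (h : t ≤ x) : ℳ t ≤ gradedLE ℳ x :=
  le_iSup (fun t : Set.Iic x => ℳ t) ⟨t, h⟩

theorem gradedLE_mono {x y : ℝ} (h : x ≤ y) : gradedLE ℳ x ≤ gradedLE ℳ y :=
  iSup_le fun t => le_gradedLE (t.2.trans h)

theorem gradedLE_eq_bot {c : ℝ} (hc : ∀ t < c, ℳ t = ⊥) {x : ℝ} (hx : x < c) :
    gradedLE ℳ x = ⊥ :=
  iSup_eq_bot.2 fun t => hc t (t.2.trans_lt hx)

theorem hilbertFun_eq_zero {c : ℝ} (hc : ∀ t < c, ℳ t = ⊥) (U : Submodule k M) {x : ℝ}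
    (hx : x < c) : hilbertFun ℳ U x = 0 := by
  rw [hilbertFun, gradedLE_eq_bot hc hx, inf_bot_eq, finrank_bot, Nat.cast_zero]

theorem hilbertFun_top (x : ℝ) : hilbertFun ℳ ⊤ x = dimLE ℳ x := by
  rw [hilbertFun, top_inf_eq]
  rfl

theorem hilbertFun_bot (x : ℝ) : hilbertFun ℳ ⊥ x = 0 := by
  rw [hilbertFun, bot_inf_eq, finrank_bot, Nat.cast_zero]

theorem hilbertFun_nonneg (U : Submodule k M) (x : ℝ) : 0 ≤ hilbertFun ℳ U x :=
  Nat.cast_nonneg _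

theorem hilbertFun_le_of_le (hfin : ∀ x, FiniteDimensional k (gradedLE ℳ x)) {U V : Submodule k M}
    (h : U ≤ V) (x : ℝ) : hilbertFun ℳ U x ≤ hilbertFun ℳ V x := by
  have := hfin x
  have : FiniteDimensional k (V ⊓ gradedLE ℳ x : Submodule k M) :=
    Submodule.finiteDimensional_of_le inf_le_right
  exact Nat.cast_le.2 (Submodule.finrank_mono (inf_le_inf_right _ h))

variable (ℳ) [DirectSum.Decomposition ℳ]

open scoped Classical in
/-- The projection of a graded vector space `M` onto `M_{≤ x}`. -/
noncomputable def truncation (x : ℝ) : M →ₗ[k] M :=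
  DirectSum.toModule k ℝ M (fun t => if t ≤ x then (ℳ t).subtype else 0) ∘ₗ
    (DirectSum.decomposeLinearEquiv ℳ).toLinearMap

variable {ℳ}

theorem truncation_of_mem {t x : ℝ} {m : M} (hm : m ∈ ℳ t) :
    truncation ℳ x m = if t ≤ x then m else 0 := by
  classical
  have : DirectSum.decomposeLinearEquiv ℳ m = DirectSum.lof k ℝ (fun t => ℳ t) t ⟨m, hm⟩ :=
    DirectSum.decompose_of_mem ℳ hm
  simp only [truncation, LinearMap.comp_apply, LinearEquiv.coe_coe, this, DirectSum.toModule_lof]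
  split_ifs <;> simp

theorem truncation_mem_gradedLE (x : ℝ) (m : M) : truncation ℳ x m ∈ gradedLE ℳ x := by
  induction m using DirectSum.Decomposition.inductionOn ℳ with
  | zero => simp
  | @homogeneous t m =>
    rw [truncation_of_mem m.2]
    split_ifs with h
    · exact le_gradedLE h m.2
    · exact zero_mem _
  | add a b ha hb => rw [map_add]; exact add_mem ha hb

theorem truncation_eq_self {x : ℝ} {m : M} (hm : m ∈ gradedLE ℳ x) : truncation ℳ x m = m := by
  have : gradedLE ℳ x ≤ LinearMap.eqLocus (truncation ℳ x) LinearMap.id := by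
    refine iSup_le fun t m hm => ?_
    have ht : (t : ℝ) ≤ x := t.2
    simp [truncation_of_mem hm, ht]
  exact this hm

theorem truncation_mem {S : Type*} [Semiring S] [Module S M] {U : Submodule S M}
    (hU : U.IsHomogeneous ℳ) (x : ℝ) {m : M} (hm : m ∈ U) : truncation ℳ x m ∈ U := by
  classical
  rw [← DirectSum.sum_support_decompose ℳ m, map_sum]
  refine sum_mem fun t _ => ?_
  rw [truncation_of_mem (DirectSum.decompose ℳ m t).2]
  split_ifs
  · exact hU t hm
  · exact zero_mem _

/-- Presenting U ∩ M_{≤ x} as the image of a linear projection makes it commute with sums of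
homogeneous subspaces, although intersection does not distribute over sums in general. -/
theorem map_truncation {U : Submodule k M} (hU : U.IsHomogeneous ℳ) (x : ℝ) :
    U.map (truncation ℳ x) = U ⊓ gradedLE ℳ x := by
  refine le_antisymm ?_ fun m hm => ⟨m, hm.1, truncation_eq_self hm.2⟩
  rintro _ ⟨m, hm, rfl⟩
  exact ⟨truncation_mem hU x hm, truncation_mem_gradedLE x m⟩

section Homogeneous

variable {S : Type*} [Ring S] [Module S M] {U V : Submodule S M}

theorem Submodule.isHomogeneous_sup (hU : U.IsHomogeneous ℳ) (hV : V.IsHomogeneous ℳ) :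
    (U ⊔ V).IsHomogeneous ℳ := by
  intro t m hm
  obtain ⟨u, hu, v, hv, rfl⟩ := Submodule.mem_sup.1 hm
  rw [DirectSum.decompose_add, DirectSum.add_apply]
  exact Submodule.add_mem_sup (hU t hu) (hV t hv)

theorem Submodule.isHomogeneous_inf (hU : U.IsHomogeneous ℳ) (hV : V.IsHomogeneous ℳ) :
    (U ⊓ V).IsHomogeneous ℳ :=
  fun t _ hm => ⟨hU t hm.1, hV t hm.2⟩

theorem Submodule.isHomogeneous_bot : (⊥ : Submodule S M).IsHomogeneous ℳ := by
  intro t m hm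
  rw [(Submodule.mem_bot S).1 hm]
  simp

theorem Submodule.isHomogeneous_top : (⊤ : Submodule S M).IsHomogeneous ℳ :=
  fun _ _ _ => Submodule.mem_top

end Homogeneous

theorem sup_inf_gradedLE {U V : Submodule k M} (hU : U.IsHomogeneous ℳ) (hV : V.IsHomogeneous ℳ)
    (x : ℝ) : (U ⊔ V) ⊓ gradedLE ℳ x = U ⊓ gradedLE ℳ x ⊔ V ⊓ gradedLE ℳ x := by
  rw [← map_truncation (Submodule.isHomogeneous_sup hU hV), ← map_truncation hU,
    ← map_truncation hV, Submodule.map_sup]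

theorem hilbertFun_sup_add_inf (hfin : ∀ x, FiniteDimensional k (gradedLE ℳ x))
    {U V : Submodule k M} (hU : U.IsHomogeneous ℳ) (hV : V.IsHomogeneous ℳ) (x : ℝ) :
    hilbertFun ℳ (U ⊔ V) x + hilbertFun ℳ (U ⊓ V) x = hilbertFun ℳ U x + hilbertFun ℳ V x := by
  have := hfin x
  have h1 : FiniteDimensional k (U ⊓ gradedLE ℳ x : Submodule k M) :=
    Submodule.finiteDimensional_of_le inf_le_right
  have h2 : FiniteDimensional k (V ⊓ gradedLE ℳ x : Submodule k M) :=
    Submodule.finiteDimensional_of_le inf_le_right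
  have h3 := Submodule.finrank_sup_add_finrank_inf_eq (U ⊓ gradedLE ℳ x) (V ⊓ gradedLE ℳ x)
  rw [← sup_inf_gradedLE hU hV, ← inf_inf_distrib_right] at h3
  simp only [hilbertFun]
  exact_mod_cast h3

/-- The isomorphism of (C + g U)/C with U/(U ∩ g⁻¹ C), read on dimensions. Rank-nullity is applied
to U and to U ∩ g⁻¹ C, which meet the kernel of g in the same subspace. -/
theorem finrank_sup_map_add_finrank_inf_comap {V : Type*} [AddCommGroup V] [Module k V]
    (g : V →ₗ[k] M) (U : Submodule k V) (C : Submodule k M) [FiniteDimensional k U]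
    [FiniteDimensional k C] :
    Module.finrank k (C ⊔ U.map g : Submodule k M) +
      Module.finrank k (U ⊓ C.comap g : Submodule k V) =
    Module.finrank k C + Module.finrank k U := by
  have key : ∀ (A : Submodule k V) [FiniteDimensional k A],
      Module.finrank k (A.map g) + Module.finrank k (A ⊓ LinearMap.ker g : Submodule k V) =
        Module.finrank k A := by
    intro A _
    rw [← LinearMap.finrank_range_add_finrank_ker (g.domRestrict A), LinearMap.range_domRestrict,
      LinearMap.ker_domRestrict]
    congr 1
    rw [← Submodule.finrank_map_subtype_eq A, Submodule.map_comap_subtype]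
  have h1 := Submodule.finrank_sup_add_finrank_inf_eq C (U.map g)
  have h2 := key U
  have : FiniteDimensional k (U ⊓ C.comap g : Submodule k V) :=
    Submodule.finiteDimensional_of_le inf_le_left
  have h3 := key (U ⊓ C.comap g)
  have h5 : (U ⊓ C.comap g).map g = C ⊓ U.map g := by
    ext m
    constructor
    · rintro ⟨u, hu, rfl⟩
      exact ⟨hu.2, u, hu.1, rfl⟩
    · rintro ⟨hm, u, hu, rfl⟩
      exact ⟨u, ⟨hu, hm⟩, rfl⟩
  rw [h5] at h3
  have h4 : U ⊓ C.comap g ⊓ LinearMap.ker g = U ⊓ LinearMap.ker g := by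
    rw [inf_assoc, inf_eq_right.2 (LinearMap.ker_le_comap g)]
  rw [h4] at h3
  omega

section Shift

variable {V : Type*} [AddCommGroup V] [Module k V] {𝒱 : ℝ → Submodule k V}
  [DirectSum.Decomposition 𝒱] {g : V →ₗ[k] M} {w : ℝ}
  (hg : ∀ t, ∀ v ∈ 𝒱 t, g v ∈ ℳ (t + w))

include hg

theorem decompose_map_shift (v : V) (t : ℝ) :
    (DirectSum.decompose ℳ (g v) (t + w) : M) = g (DirectSum.decompose 𝒱 v t) := by
  induction v using DirectSum.Decomposition.inductionOn 𝒱 with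
  | zero => simp
  | @homogeneous s v =>
    rw [DirectSum.decompose_of_mem ℳ (hg s v v.2), DirectSum.decompose_coe]
    by_cases h : s = t
    · subst h
      rw [DirectSum.of_eq_same, DirectSum.of_eq_same]
    · rw [DirectSum.of_eq_of_ne _ _ _ (fun h' => h (by linarith)),
        DirectSum.of_eq_of_ne _ _ _ (Ne.symm h)]
      simp
  | add a b ha hb => simp [DirectSum.decompose_add, ha, hb]

theorem truncation_map_shift (v : V) (x : ℝ) :
    truncation ℳ (x + w) (g v) = g (truncation 𝒱 x v) := by
  induction v using DirectSum.Decomposition.inductionOn 𝒱 with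
  | zero => simp
  | @homogeneous s v =>
    rw [truncation_of_mem (hg s v v.2), truncation_of_mem v.2]
    simp only [add_le_add_iff_right]
    split_ifs <;> simp
  | add a b ha hb => simp [ha, hb]

theorem isHomogeneous_map_shift {U : Submodule k V} (hU : U.IsHomogeneous 𝒱) :
    (U.map g).IsHomogeneous ℳ := by
  rintro t _ ⟨u, hu, rfl⟩
  have := decompose_map_shift hg u (t - w)
  rw [sub_add_cancel] at this
  rw [this]
  exact ⟨_, hU _ hu, rfl⟩

theorem isHomogeneous_comap_shift {C : Submodule k M} (hC : C.IsHomogeneous ℳ) :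
    (C.comap g).IsHomogeneous 𝒱 := by
  intro t v hv
  change g _ ∈ C
  rw [← decompose_map_shift hg]
  exact hC _ hv

/-- The Hilbert function of the image of a homogeneous map in a quotient. -/
theorem hilbertFun_sup_map_shift (hfin : ∀ x, FiniteDimensional k (gradedLE ℳ x))
    (hfin' : ∀ x, FiniteDimensional k (gradedLE 𝒱 x)) {U : Submodule k V}
    (hU : U.IsHomogeneous 𝒱) {C : Submodule k M} (hC : C.IsHomogeneous ℳ) (x : ℝ) :
    hilbertFun ℳ (C ⊔ U.map g) x - hilbertFun ℳ C x =
      hilbertFun 𝒱 U (x - w) - hilbertFun 𝒱 (U ⊓ C.comap g) (x - w) := by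
  have := hfin x
  have := hfin' (x - w)
  have h1 : FiniteDimensional k (C ⊓ gradedLE ℳ x : Submodule k M) :=
    Submodule.finiteDimensional_of_le inf_le_right
  have h2 : FiniteDimensional k (U ⊓ gradedLE 𝒱 (x - w) : Submodule k V) :=
    Submodule.finiteDimensional_of_le inf_le_right
  have h3 := finrank_sup_map_add_finrank_inf_comap g (U ⊓ gradedLE 𝒱 (x - w)) (C ⊓ gradedLE ℳ x)
  have hmap : (U ⊓ gradedLE 𝒱 (x - w)).map g = U.map g ⊓ gradedLE ℳ x := by
    rw [← map_truncation hU, ← map_truncation (isHomogeneous_map_shift hg hU),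
      ← Submodule.map_comp, ← Submodule.map_comp]
    congr 1
    ext v
    have := truncation_map_shift hg v (x - w)
    rw [sub_add_cancel] at this
    exact this.symm
  -- On elements of degree at most x - w, landing in degree at most x is automatic.
  have hcomap : U ⊓ gradedLE 𝒱 (x - w) ⊓ (C ⊓ gradedLE ℳ x).comap g =
      U ⊓ C.comap g ⊓ gradedLE 𝒱 (x - w) := by
    have hle : gradedLE 𝒱 (x - w) ≤ (gradedLE ℳ x).comap g := by
      refine iSup_le fun t v hv => ?_
      have ht : (t : ℝ) ≤ x - w := t.2
      exact le_gradedLE (by linarith) (hg _ _ hv)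
    rw [Submodule.comap_inf]
    refine le_antisymm ?_ ?_
    · exact fun v hv => ⟨⟨hv.1.1, hv.2.1⟩, hv.1.2⟩
    · exact fun v hv => ⟨⟨hv.1.1, hv.2⟩, hv.1.2, hle hv.2⟩
  rw [hmap, hcomap, ← sup_inf_gradedLE hC (isHomogeneous_map_shift hg hU)] at h3
  have h4 : (Module.finrank k ((C ⊔ U.map g) ⊓ gradedLE ℳ x : Submodule k M) : ℝ) +
      Module.finrank k (U ⊓ C.comap g ⊓ gradedLE 𝒱 (x - w) : Submodule k V) =
      Module.finrank k (C ⊓ gradedLE ℳ x : Submodule k M) +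
      Module.finrank k (U ⊓ gradedLE 𝒱 (x - w) : Submodule k V) := by
    exact_mod_cast h3
  simp only [hilbertFun]
  linarith

end Shift

end Truncation

/-! ### Hilbert functions of graded subquotients -/

section GradedModule

variable {k R M : Type*} [Field k] [CommRing R] [Algebra k R]
  [AddCommGroup M] [Module R M] [Module k M] [IsScalarTower k R M]

/-- The Hilbert function `x ↦ dim N_{≤ x}` of a graded submodule. -/
noncomputable def moduleHilbertFun (ℳ : ℝ → Submodule k M) (N : Submodule R M) (x : ℝ) : ℝ :=
  hilbertFun ℳ (N.restrictScalars k) x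

theorem Submodule.restrictScalars_sup_eq (U V : Submodule R M) :
    (U ⊔ V).restrictScalars k = U.restrictScalars k ⊔ V.restrictScalars k := by
  ext m
  simp [Submodule.mem_sup]

variable {ℳ : ℝ → Submodule k M}

theorem lsmul_mem_shift {𝒜 : ℝ → Submodule k R} [SetLike.GradedSMul 𝒜 ℳ] {f : R} {w : ℝ}
    (hf : f ∈ 𝒜 w) (t : ℝ) (m : M) (hm : m ∈ ℳ t) :
    ((LinearMap.lsmul R M f).restrictScalars k) m ∈ ℳ (t + w) := by
  have := SetLike.GradedSMul.smul_mem hf hm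
  rwa [vadd_eq_add, add_comm] at this

variable [DirectSum.Decomposition ℳ]

/-- A finite-dimensional extension of graded vector spaces has a step function as Hilbert
function. -/
theorem isWeightSum_hilbertFun_sup_span (hfin : ∀ x, FiniteDimensional k (gradedLE ℳ x))
    {U : Submodule k M} (hU : U.IsHomogeneous ℳ) (s : Finset M)
    (hs : ∀ m ∈ s, ∃ t, m ∈ ℳ t) : (U ⊔ Submodule.span k s).IsHomogeneous ℳ ∧
    IsWeightSum [] fun x => hilbertFun ℳ (U ⊔ Submodule.span k s) x - hilbertFun ℳ U x := by
  classical
  induction s using Finset.induction_on with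
  | empty => simpa using ⟨hU, IsWeightSum.zero []⟩
  | insert m s hms ih =>
    obtain ⟨hV, hVsum⟩ := ih fun m hm => hs m (by simp [hm])
    set V := U ⊔ Submodule.span k (s : Set M) with hVdef
    obtain ⟨t, hmt⟩ := hs m (by simp)
    have heq : U ⊔ Submodule.span k ((insert m s : Finset M) : Set M) =
        V ⊔ Submodule.span k {m} := by
      rw [Finset.coe_insert, Submodule.span_insert, hVdef, sup_assoc,
        sup_comm (Submodule.span k {m})]
    rw [heq]
    by_cases hmV : m ∈ V
    · rw [sup_eq_left.2 (by simpa using hmV)]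
      exact ⟨hV, hVsum⟩
    · have hL : (Submodule.span k {m}).IsHomogeneous ℳ := by
        intro i v hv
        obtain ⟨c, rfl⟩ := Submodule.mem_span_singleton.1 hv
        by_cases hi : t = i
        · subst hi
          rw [DirectSum.decompose_of_mem_same ℳ ((ℳ t).smul_mem c hmt)]
          exact hv
        · rw [DirectSum.decompose_of_mem_ne ℳ ((ℳ t).smul_mem c hmt) hi]
          exact zero_mem _
      have hm0 : m ≠ 0 := fun h => hmV (h ▸ zero_mem _)
      refine ⟨Submodule.isHomogeneous_sup hV hL, ?_⟩
      have hinf : V ⊓ Submodule.span k {m} = ⊥ := by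
        rw [inf_comm]
        refine (Submodule.disjoint_span_singleton' hm0).2 hmV |>.symm.eq_bot
      have hspan : ∀ x, hilbertFun ℳ (Submodule.span k {m}) x = if t ≤ x then 1 else 0 := by
        intro x
        rw [hilbertFun, ← map_truncation hL, Submodule.map_span, Set.image_singleton,
          truncation_of_mem hmt]
        by_cases h : t ≤ x
        · rw [if_pos h, if_pos h, finrank_span_singleton hm0, Nat.cast_one]
        · rw [if_neg h, if_neg h, Submodule.span_zero_singleton, finrank_bot, Nat.cast_zero]
      have hsum := hVsum.add (isWeightSum_indicator [] t)
      convert hsum using 2 with x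
      have h1 := hilbertFun_sup_add_inf hfin hV hL x
      rw [hinf, hilbertFun_bot, hspan] at h1
      linarith

omit [Module k M] [IsScalarTower k R M] in
/-- Elements of `A[f]`-spans, split along the powers of `f`. -/
theorem exists_add_smul_of_mem_span_adjoin_insert (X : Set R) (f : R) (s : Set M) {q : M}
    (hq : q ∈ Submodule.span (Algebra.adjoin k (insert f X)) s) :
    ∃ q₀ ∈ Submodule.span (Algebra.adjoin k X) s, ∃ q₁ ∈ Submodule.span R s,
      q = q₀ + f • q₁ := by
  have key : ∀ a ∈ Algebra.adjoin k (insert f X), ∃ a₀ ∈ Algebra.adjoin k X, ∃ a₁ : R,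
      a = a₀ + f * a₁ := by
    intro a ha
    induction ha using Algebra.adjoin_induction with
    | mem a ha =>
      rcases ha with rfl | ha
      · exact ⟨0, zero_mem _, 1, by simp⟩
      · exact ⟨a, Algebra.subset_adjoin ha, 0, by simp⟩
    | algebraMap r => exact ⟨_, Subalgebra.algebraMap_mem _ r, 0, by simp⟩
    | add a b _ _ ha hb =>
      obtain ⟨a₀, ha₀, a₁, rfl⟩ := ha
      obtain ⟨b₀, hb₀, b₁, rfl⟩ := hb
      exact ⟨_, add_mem ha₀ hb₀, a₁ + b₁, by ring⟩
    | mul a b _ _ ha hb =>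
      obtain ⟨a₀, ha₀, a₁, rfl⟩ := ha
      obtain ⟨b₀, hb₀, b₁, rfl⟩ := hb
      exact ⟨_, mul_mem ha₀ hb₀, a₁ * (b₀ + f * b₁) + a₀ * b₁, by ring⟩
  induction hq using Submodule.span_induction with
  | mem m hm => exact ⟨m, Submodule.subset_span hm, 0, zero_mem _, by simp⟩
  | zero => exact ⟨0, zero_mem _, 0, zero_mem _, by simp⟩
  | add x y _ _ hx hy =>
    obtain ⟨x₀, hx₀, x₁, hx₁, rfl⟩ := hx
    obtain ⟨y₀, hy₀, y₁, hy₁, rfl⟩ := hy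
    exact ⟨_, add_mem hx₀ hy₀, _, add_mem hx₁ hy₁, by rw [smul_add]; abel⟩
  | smul a x _ hx =>
    obtain ⟨x₀, hx₀, x₁, hx₁, rfl⟩ := hx
    obtain ⟨a₀, ha₀, a₁, ha⟩ := key a a.2
    have hx₀' : x₀ ∈ Submodule.span R s := Submodule.span_subset_span _ R s hx₀
    refine ⟨_, Submodule.smul_mem _ (⟨a₀, ha₀⟩ : Algebra.adjoin k X) hx₀,
      a₁ • (x₀ + f • x₁) + a₀ • x₁, ?_, ?_⟩
    · exact add_mem (Submodule.smul_mem _ _ (add_mem hx₀' (Submodule.smul_mem _ _ hx₁)))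
        (Submodule.smul_mem _ _ hx₁)
    · change (a : R) • _ = a₀ • x₀ + _
      rw [ha]
      simp only [add_smul, smul_add, mul_smul, smul_comm a₀ f]
      abel

omit [Module k M] [IsScalarTower k R M] in
theorem smul_mem_span_image (X : Set R) (g : R) (s : Set M) {q : M}
    (hq : q ∈ Submodule.span (Algebra.adjoin k X) s) :
    g • q ∈ Submodule.span (Algebra.adjoin k X) ((fun m => g • m) '' s) := by
  induction hq using Submodule.span_induction with
  | mem m hm => exact Submodule.subset_span ⟨m, hm, rfl⟩
  | zero => simp
  | add x y _ _ hx hy => rw [smul_add]; exact add_mem hx hy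
  | smul a x _ hx =>
    have : g • a • x = a • g • x := smul_comm g (a : R) x
    rw [this]
    exact Submodule.smul_mem _ _ hx

variable (𝒜 : ℝ → Submodule k R) [GradedAlgebra 𝒜] [SetLike.GradedSMul 𝒜 ℳ]

/-- The graded pieces of a finitely generated graded module over a graded algebra are counted by
finitely many free modules over polynomial rings. -/
theorem isWeightSum_moduleHilbertFun [IsNoetherian R M]
    (hfin : ∀ x, FiniteDimensional k (gradedLE ℳ x)) {c : ℝ} (hc : ∀ t < c, ℳ t = ⊥)
    (gens : List (R × ℝ)) : (∀ p ∈ gens, p.1 ∈ 𝒜 p.2 ∧ 0 < p.2) → ∀ {N P : Submodule R M},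
    N ≤ P → N.IsHomogeneous ℳ → P.IsHomogeneous ℳ →
    (∃ s : Finset M, (s : Set M) ⊆ P ∧ ∀ p ∈ P,
      ∃ q ∈ Submodule.span (Algebra.adjoin k {f | ∃ p ∈ gens, p.1 = f}) (s : Set M), p - q ∈ N) →
    IsWeightSum (gens.map Prod.snd)
      fun x => moduleHilbertFun ℳ P x - moduleHilbertFun ℳ N x := by
  classical
  induction gens with
  | nil =>
    intro _ N P hNP hN hP ⟨s, hsP, hs⟩
    have hs' : ∀ p ∈ P, ∃ q ∈ Submodule.span k (s : Set M), p - q ∈ N := by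
      intro p hp
      obtain ⟨q, hq, hpq⟩ := hs p hp
      refine ⟨q, ?_, hpq⟩
      clear hpq
      induction hq using Submodule.span_induction with
      | mem m hm => exact Submodule.subset_span hm
      | zero => exact zero_mem _
      | add x y _ _ hx hy => exact add_mem hx hy
      | smul a x _ hx =>
        obtain ⟨a, ha⟩ := a
        simp only [List.not_mem_nil, false_and, exists_false, Set.ofPred_false,
          Algebra.adjoin_empty] at ha
        obtain ⟨b, rfl⟩ := Algebra.mem_bot.1 ha
        have : (algebraMap k R b) • x = b • x := algebraMap_smul R b x
        change (algebraMap k R b) • x ∈ _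
        rw [this]
        exact Submodule.smul_mem _ _ hx
    set u : Finset M := s.biUnion fun m =>
      (DirectSum.decompose ℳ m).support.image fun t => (DirectSum.decompose ℳ m t : M) with hu
    have hu1 : ∀ m ∈ u, ∃ t, m ∈ ℳ t := by
      intro m hm
      simp only [hu, Finset.mem_biUnion, Finset.mem_image] at hm
      obtain ⟨m', -, t, -, rfl⟩ := hm
      exact ⟨t, (DirectSum.decompose ℳ m' t).2⟩
    have hu2 : (u : Set M) ⊆ P := by
      intro m hm
      simp only [hu, Finset.mem_coe, Finset.mem_biUnion, Finset.mem_image] at hm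
      obtain ⟨m', hm', t, -, rfl⟩ := hm
      exact hP t (hsP hm')
    have hu3 : Submodule.span k (s : Set M) ≤ Submodule.span k (u : Set M) := by
      refine Submodule.span_le.2 fun m hm => ?_
      rw [← DirectSum.sum_support_decompose ℳ m]
      refine sum_mem fun t ht => Submodule.subset_span ?_
      simp only [hu, Finset.mem_coe, Finset.mem_biUnion, Finset.mem_image]
      exact ⟨m, hm, t, ht, rfl⟩
    have heq : P.restrictScalars k = N.restrictScalars k ⊔ Submodule.span k (u : Set M) := by
      refine le_antisymm ?_ (sup_le hNP (Submodule.span_le.2 hu2))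
      intro p hp
      obtain ⟨q, hq, hpq⟩ := hs' p hp
      exact Submodule.mem_sup.2 ⟨p - q, hpq, q, hu3 hq, sub_add_cancel p q⟩
    have := (isWeightSum_hilbertFun_sup_span hfin (U := N.restrictScalars k) hN u hu1).2
    rw [← heq] at this
    exact this
  | cons fw gens ih =>
    obtain ⟨f, w⟩ := fw
    intro hgens N P hNP hN hP ⟨s, hsP, hs⟩
    obtain ⟨hf, hw⟩ := hgens (f, w) (by simp)
    have hgens' : ∀ p ∈ gens, p.1 ∈ 𝒜 p.2 ∧ 0 < p.2 := fun p hp => hgens p (by simp [hp])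
    have hset : {g | ∃ p ∈ (f, w) :: gens, p.1 = g} = insert f {g | ∃ p ∈ gens, p.1 = g} := by
      ext g
      simp [eq_comm]
    rw [hset] at hs
    have hfi : ∀ i : ℕ, f ^ i ∈ 𝒜 (i * w) := by
      intro i
      have := SetLike.pow_mem_graded i hf
      rwa [nsmul_eq_mul] at this
    -- The modules N + f^i P descend from P towards N, and f annihilates each successive quotient.
    set Q : ℕ → Submodule R M := fun i => N ⊔ P.map (LinearMap.lsmul R M (f ^ i)) with hQ
    have hQh : ∀ i, (Q i).IsHomogeneous ℳ := fun i => Submodule.isHomogeneous_sup hN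
      (isHomogeneous_map_shift (lsmul_mem_shift (hfi i)) (U := P.restrictScalars k) hP)
    have hQsucc : ∀ i, Q (i + 1) ≤ Q i := by
      intro i
      refine sup_le_sup_left ?_ _
      rintro _ ⟨p, hp, rfl⟩
      refine ⟨f • p, P.smul_mem _ hp, ?_⟩
      change f ^ i • f • p = f ^ (i + 1) • p
      rw [pow_succ, mul_smul]
    have hQ0 : Q 0 = P := by
      have : P.map (LinearMap.lsmul R M (f ^ 0)) = P := by
        ext m
        simp
      rw [hQ]
      simp only [this]
      exact sup_eq_right.2 hNP
    -- Multiplication by f^i identifies P / K i, shifted by i w, with Q i / Q (i + 1). The K i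
    -- increase, so they become constant, and from then on the quotients differ only by shifts.
    set K : ℕ → Submodule R M := fun i => P ⊓ (Q (i + 1)).comap (LinearMap.lsmul R M (f ^ i))
      with hK
    have hKmono : Monotone K := by
      refine monotone_nat_of_le_succ fun i => ?_
      rintro m ⟨hmP, hm⟩
      refine ⟨hmP, ?_⟩
      change f ^ (i + 1) • m ∈ Q (i + 2)
      have hm : f ^ i • m ∈ Q (i + 1) := hm
      obtain ⟨a, ha, _, ⟨b, hb, rfl⟩, hab⟩ := Submodule.mem_sup.1 hm
      rw [pow_succ', mul_smul, ← hab, smul_add]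
      refine Submodule.add_mem_sup (N.smul_mem _ ha) ⟨b, hb, ?_⟩
      simp [pow_succ' f (i + 1), mul_smul]
    have hdiff : ∀ i x, moduleHilbertFun ℳ (Q i) x - moduleHilbertFun ℳ (Q (i + 1)) x =
        moduleHilbertFun ℳ P (x - i * w) - moduleHilbertFun ℳ (K i) (x - i * w) := by
      intro i x
      have h1 := hilbertFun_sup_map_shift (lsmul_mem_shift (ℳ := ℳ) (hfi i)) hfin hfin
        (U := P.restrictScalars k) hP (C := (Q (i + 1)).restrictScalars k) (hQh (i + 1)) x
      have h2 : (Q i).restrictScalars k = (Q (i + 1)).restrictScalars k ⊔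
          (P.restrictScalars k).map ((LinearMap.lsmul R M (f ^ i)).restrictScalars k) := by
        refine le_antisymm ?_ (sup_le (hQsucc i) ?_)
        · intro m hm
          obtain ⟨a, ha, _, ⟨b, hb, rfl⟩, rfl⟩ := Submodule.mem_sup.1
            (show m ∈ N ⊔ P.map (LinearMap.lsmul R M (f ^ i)) from hm)
          exact Submodule.add_mem_sup (show a ∈ Q (i + 1) from Submodule.mem_sup_left ha)
            ⟨b, hb, rfl⟩
        · rintro _ ⟨b, hb, rfl⟩
          exact show f ^ i • b ∈ N ⊔ P.map (LinearMap.lsmul R M (f ^ i)) from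
            Submodule.mem_sup_right ⟨b, hb, rfl⟩
      rw [← h2] at h1
      exact h1
    -- Modulo Q (i + 1) the multiples of f^(i + 1) disappear, so the f^i-multiples of the generators
    -- suffice over the algebra generated without f, and the induction applies.
    have hstep : ∀ i, IsWeightSum (gens.map Prod.snd)
        fun x => moduleHilbertFun ℳ (Q i) x - moduleHilbertFun ℳ (Q (i + 1)) x := by
      intro i
      refine ih hgens' (hQsucc i) (hQh (i + 1)) (hQh i)
        ⟨s.image fun m => f ^ i • m, ?_, fun p hp => ?_⟩
      · rintro _ hm'
        obtain ⟨m, hm, rfl⟩ := Finset.mem_image.1 (Finset.mem_coe.1 hm')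
        exact Submodule.mem_sup_right ⟨m, hsP hm, rfl⟩
      · obtain ⟨a, ha, _, ⟨b, hb, rfl⟩, rfl⟩ := Submodule.mem_sup.1 hp
        obtain ⟨q, hq, hbq⟩ := hs b hb
        obtain ⟨q₀, hq₀, q₁, hq₁, rfl⟩ := exists_add_smul_of_mem_span_adjoin_insert _ _ _ hq
        refine ⟨f ^ i • q₀, ?_, ?_⟩
        · rw [Finset.coe_image]
          exact smul_mem_span_image _ _ _ hq₀
        · have hq₁P : q₁ ∈ P := Submodule.span_le.2 hsP hq₁
          have : a + f ^ i • b - f ^ i • q₀ =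
              (a + f ^ i • (b - (q₀ + f • q₁))) + f ^ (i + 1) • q₁ := by
            rw [smul_sub, smul_add, pow_succ, mul_smul]
            abel
          change a + f ^ i • b - f ^ i • q₀ ∈ _
          rw [this]
          exact Submodule.add_mem_sup (N.add_mem ha (N.smul_mem _ hbq)) ⟨q₁, hq₁P, rfl⟩
    obtain ⟨J, hJ⟩ := monotone_stabilizes_iff_noetherian.2 ‹IsNoetherian R M› ⟨K, hKmono⟩
    have hJ' : ∀ j, K (J + j) = K J := fun j => (hJ (J + j) (Nat.le_add_right _ _)).symm
    have hWpos : ∀ v ∈ gens.map Prod.snd, 0 < v := by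
      intro v hv
      obtain ⟨p, hp, rfl⟩ := List.mem_map.1 hv
      exact (hgens' p hp).2
    obtain ⟨g, hg, hgx⟩ := (hstep J).exists_sum_range_eq hWpos hw
    have hsum := (IsWeightSum.sum (Finset.range J) fun i _ => hstep i).mono
      (List.sublist_cons_self w _)
    refine (show IsWeightSum (w :: gens.map Prod.snd) _ from ?_)
    convert hsum.add hg using 2 with x
    -- For fixed x the telescoping sum is finite: once the shift exceeds x - c, the image of P under
    -- the power of f begins above degree x, so Q and N have the same dimension up to x.
    have hlarge : ∀ᶠ n : ℕ in atTop, x - (J + n : ℕ) * w < c := by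
      have h1 : Tendsto (fun n : ℕ => ((J + n : ℕ) : ℝ) * w) atTop atTop :=
        (tendsto_natCast_atTop_atTop.comp (tendsto_add_atTop_nat J |>.congr
          fun n => add_comm n J)).atTop_mul_const hw
      filter_upwards [h1.eventually_gt_atTop (x - c)] with n hn
      linarith
    obtain ⟨n, hn1, hn2⟩ := (hlarge.and (hgx x)).exists
    have hend : moduleHilbertFun ℳ (Q (J + n)) x = moduleHilbertFun ℳ N x := by
      have h1 := hilbertFun_sup_map_shift (lsmul_mem_shift (ℳ := ℳ) (hfi (J + n))) hfin hfin
        (U := P.restrictScalars k) hP (C := N.restrictScalars k) hN x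
      rw [hilbertFun_eq_zero hc _ hn1, hilbertFun_eq_zero hc _ hn1, sub_zero] at h1
      have h2 : (Q (J + n)).restrictScalars k = N.restrictScalars k ⊔
          (P.restrictScalars k).map ((LinearMap.lsmul R M (f ^ (J + n))).restrictScalars k) :=
        Submodule.restrictScalars_sup_eq _ _
      rw [← h2] at h1
      exact sub_eq_zero.1 h1
    have htel := Finset.sum_range_sub' (fun i => moduleHilbertFun ℳ (Q i) x) (J + n)
    rw [hQ0, hend, Finset.sum_range_add] at htel
    rw [← htel, hn2]
    congr 1
    refine Finset.sum_congr rfl fun j _ => ?_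
    have h1 := hdiff (J + j) x
    have h2 := hdiff J (x - j * w)
    rw [hJ'] at h1
    rw [show J + j + 1 = J + j + 1 from rfl] at h1
    rw [h1, h2]
    congr 2 <;> push_cast <;> ring

end GradedModule

/-! ### Krull dimension and Noether normalization -/

section NoetherNormalization

/-- Incomparability contracts strict chains of primes to strict chains; lying over and going up lift
chains of the same length. -/
theorem ringKrullDim_eq_of_isIntegral_of_injective (A B : Type*) [CommRing A] [CommRing B]
    [Algebra A B] [Algebra.IsIntegral A B] (hinj : Function.Injective (algebraMap A B)) :
    ringKrullDim B = ringKrullDim A := by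
  refine le_antisymm (Order.krullDim_le_of_strictMono
    (fun P : PrimeSpectrum B => PrimeSpectrum.comap (algebraMap A B) P) ?_) ?_
  · intro P Q hPQ
    exact Ideal.IsIntegral.comap_lt_comap (R := A) hPQ
  · refine iSup_le fun l => ?_
    obtain ⟨Q, -, hQ, hQl⟩ := Ideal.exists_ideal_over_prime_of_isIntegral (S := B)
      (RelSeries.head l).asIdeal (⊥ : Ideal B) (by
        intro x hx
        have hx0 : x = 0 := hinj (by simpa using hx)
        rw [hx0]
        exact zero_mem _)
    have : Q.LiesOver (RelSeries.head l).asIdeal := ⟨hQl.symm⟩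
    obtain ⟨l', hl', -, -⟩ := Ideal.exists_ltSeries_of_hasGoingUp l Q
    rw [← hl']
    exact Order.LTSeries.length_le_krullDim l'

/-- The images of the variables need not be homogeneous. Hence growth is measured below by exponents
in these elements and compared with the grading only up to constant factors. -/
theorem exists_finite_injective_mvPolynomial_of_ringKrullDim_eq {k R : Type*} [Field k] [CommRing R]
    [IsDomain R] [Algebra k R] [Algebra.FiniteType k R] {n : ℕ} (hn : ringKrullDim R = n) :
    ∃ φ : MvPolynomial (Fin n) k →ₐ[k] R, Function.Injective φ ∧ φ.Finite := by
  obtain ⟨s, φ, hinj, hfin⟩ := exists_finite_inj_algHom_of_fg k R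
  let := φ.toRingHom.toAlgebra
  have : Module.Finite (MvPolynomial (Fin s) k) R := hfin
  have h1 := ringKrullDim_eq_of_isIntegral_of_injective (MvPolynomial (Fin s) k) R hinj
  rw [MvPolynomial.ringKrullDim_of_isNoetherianRing, ringKrullDim_eq_zero_of_field, hn,
    Nat.card_fin, zero_add] at h1
  have : s = n := by exact_mod_cast h1.symm
  subst this
  exact ⟨φ, hinj, hfin⟩

end NoetherNormalization

/-! ### Spans of monomials with bounded exponents -/

section BoxSpan

variable {k R M : Type*} [Field k] [CommRing R] [Algebra k R]
  [AddCommGroup M] [Module R M] [Module k M] [IsScalarTower k R M] {n : ℕ}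

/-- The span of the elements `y ^ a • g` with `g ∈ G` and all exponents at most `j`. -/
def boxSpan (k : Type*) [Field k] [Module k M] (y : Fin n → R) (G : Finset M) (j : ℕ) :
    Submodule k M :=
  Submodule.span k ((fun p : (Fin n → ℕ) × M => (∏ i, y i ^ p.1 i) • p.2) ''
    ((Fintype.piFinset fun _ => Finset.range (j + 1)) ×ˢ G : Finset ((Fin n → ℕ) × M)))

omit [Algebra k R] [IsScalarTower k R M] in
theorem finrank_boxSpan_le (y : Fin n → R) (G : Finset M) (j : ℕ) :
    Module.finrank k (boxSpan k y G j) ≤ (j + 1) ^ n * G.card := by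
  classical
  rw [boxSpan, ← Finset.coe_image]
  refine (finrank_span_finset_le_card _).trans (Finset.card_image_le.trans ?_)
  rw [Finset.card_product, Fintype.card_piFinset]
  simp

omit [Algebra k R] [IsScalarTower k R M] in
theorem finiteDimensional_boxSpan (y : Fin n → R) (G : Finset M) (j : ℕ) :
    FiniteDimensional k (boxSpan k y G j) :=
  FiniteDimensional.span_of_finite k (Finset.finite_toSet _ |>.image _)

omit [Algebra k R] [IsScalarTower k R M] in
theorem mem_boxSpan (y : Fin n → R) {G : Finset M} {j : ℕ} {a : Fin n → ℕ} (ha : ∀ i, a i ≤ j)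
    {g : M} (hg : g ∈ G) : (∏ i, y i ^ a i) • g ∈ boxSpan k y G j :=
  Submodule.subset_span ⟨(a, g), by simpa [Nat.lt_succ_iff] using ⟨ha, hg⟩, rfl⟩

omit [Algebra k R] [IsScalarTower k R M] in
theorem boxSpan_mono (y : Fin n → R) (G : Finset M) : Monotone (boxSpan k y G) := by
  intro i j hij
  refine Submodule.span_mono (Set.image_mono fun p hp => ?_)
  simp only [Finset.coe_product, Set.mem_prod, Finset.mem_coe, Fintype.mem_piFinset,
    Finset.mem_range] at hp ⊢
  exact ⟨fun t => by have := hp.1 t; omega, hp.2⟩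

theorem prod_pow_smul_mem_boxSpan (y : Fin n → R) {G : Finset M} {i j : ℕ} {a : Fin n → ℕ}
    (ha : ∀ t, a t ≤ i) {m : M} (hm : m ∈ boxSpan k y G j) :
    (∏ t, y t ^ a t) • m ∈ boxSpan k y G (i + j) := by
  induction hm using Submodule.span_induction with
  | mem m hm =>
    obtain ⟨⟨b, g⟩, hb, rfl⟩ := hm
    simp only [Finset.coe_product, Set.mem_prod, Finset.mem_coe, Fintype.mem_piFinset,
      Finset.mem_range, Nat.lt_succ_iff] at hb
    have := mem_boxSpan (k := k) y (j := i + j) (a := a + b)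
      (fun t => add_le_add (ha t) (hb.1 t)) hb.2
    simpa [pow_add, Finset.prod_mul_distrib, mul_smul] using this
  | zero => simp
  | add x z _ _ hx hz => rw [smul_add]; exact add_mem hx hz
  | smul c x _ hx =>
    rw [smul_comm]
    exact Submodule.smul_mem _ _ hx

/-- Multiplication by f commutes with the monomials, so its effect on the generators alone bounds
the enlargement of every box by the same constant e. -/
theorem smul_mem_boxSpan (y : Fin n → R) {G : Finset M} {e j : ℕ} {f : R}
    (hf : ∀ g ∈ G, f • g ∈ boxSpan k y G e) {m : M} (hm : m ∈ boxSpan k y G j) :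
    f • m ∈ boxSpan k y G (j + e) := by
  induction hm using Submodule.span_induction with
  | mem m hm =>
    obtain ⟨⟨b, g⟩, hb, rfl⟩ := hm
    simp only [Finset.coe_product, Set.mem_prod, Finset.mem_coe, Fintype.mem_piFinset,
      Finset.mem_range, Nat.lt_succ_iff] at hb
    dsimp only
    rw [smul_comm]
    exact prod_pow_smul_mem_boxSpan y hb.1 (hf g hb.2)
  | zero => simp
  | add x z _ _ hx hz => rw [smul_add]; exact add_mem hx hz
  | smul c x _ hx =>
    rw [smul_comm]
    exact Submodule.smul_mem _ _ hx

theorem exists_forall_mem_boxSpan [Module.Finite R M] {φ : MvPolynomial (Fin n) k →ₐ[k] R}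
    (hφ : φ.Finite) :
    ∃ G : Finset M, ∀ m, ∃ j, m ∈ boxSpan k (fun i => φ (MvPolynomial.X i)) G j := by
  let := φ.toRingHom.toAlgebra
  have : Module.Finite (MvPolynomial (Fin n) k) R := hφ
  let : Module (MvPolynomial (Fin n) k) M := Module.compHom M φ.toRingHom
  have : IsScalarTower (MvPolynomial (Fin n) k) R M := ⟨fun p r m => mul_smul (φ p) r m⟩
  have : Module.Finite (MvPolynomial (Fin n) k) M := Module.Finite.trans R M
  obtain ⟨G, hG⟩ := Module.Finite.fg_top (R := MvPolynomial (Fin n) k) (M := M)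
  refine ⟨G, fun m => ?_⟩
  have hm : m ∈ Submodule.span (MvPolynomial (Fin n) k) (G : Set M) := hG ▸ Submodule.mem_top
  set y : Fin n → R := fun i => φ (MvPolynomial.X i) with hy
  have hadd : ∀ {x z : M}, (∃ j, x ∈ boxSpan k y G j) → (∃ j, z ∈ boxSpan k y G j) →
      ∃ j, x + z ∈ boxSpan k y G j := by
    rintro x z ⟨i, hi⟩ ⟨j, hj⟩
    exact ⟨max i j, add_mem (boxSpan_mono y G (le_max_left i j) hi)
      (boxSpan_mono y G (le_max_right i j) hj)⟩
  induction hm using Submodule.span_induction with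
  | mem m hm => exact ⟨0, by simpa using mem_boxSpan (k := k) y (j := 0) (a := 0) (by simp) hm⟩
  | zero => exact ⟨0, zero_mem _⟩
  | add x z _ _ hx hz => exact hadd hx hz
  | smul p x _ hx =>
    change ∃ j, φ p • x ∈ boxSpan k y G j
    induction p using MvPolynomial.induction_on with
    | C c =>
      obtain ⟨j, hj⟩ := hx
      refine ⟨j, ?_⟩
      rw [← MvPolynomial.algebraMap_eq, AlgHom.commutes, algebraMap_smul]
      exact Submodule.smul_mem _ _ hj
    | add p q hp hq => rw [map_add, add_smul]; exact hadd hp hq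
    | mul_X p i hp =>
      obtain ⟨j, hj⟩ := hp
      refine ⟨1 + j, ?_⟩
      rw [map_mul, mul_comm, mul_smul]
      have h1 : ∀ t, (Pi.single i 1 : Fin n → ℕ) t ≤ 1 := by
        intro t
        by_cases h : t = i
        · subst h; simp
        · simp [h]
      have h2 := prod_pow_smul_mem_boxSpan y h1 hj
      have h3 : ∏ t, y t ^ (Pi.single i 1 : Fin n → ℕ) t = φ (MvPolynomial.X i) := by
        rw [Finset.prod_eq_single i]
        · simp [hy]
        · intro t _ ht
          simp [ht]
        · simp
      rwa [h3] at h2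

end BoxSpan

/-! ### Upper and lower growth bounds -/

section Growth

variable {k R M : Type*} [Field k] [CommRing R] [Algebra k R]
  [AddCommGroup M] [Module R M] [Module k M] [IsScalarTower k R M]
  (𝒜 : ℝ → Submodule k R) [GradedAlgebra 𝒜]
  (ℳ : ℝ → Submodule k M) [DirectSum.Decomposition ℳ] [SetLike.GradedSMul 𝒜 ℳ]

/-- The homogeneous components of any finite generating set will do. Those of degree zero are
scalars and can be dropped, which makes all the weights positive. -/
theorem exists_homogeneous_algebra_generators [Algebra.FiniteType k R]
    (hneg : ∀ t : ℝ, t < 0 → 𝒜 t = ⊥) (hzero : 𝒜 0 = 1) :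
    ∃ gens : List (R × ℝ), (∀ p ∈ gens, p.1 ∈ 𝒜 p.2 ∧ 0 < p.2) ∧
      Algebra.adjoin k {f | ∃ p ∈ gens, p.1 = f} = ⊤ := by
  classical
  obtain ⟨F, hF⟩ := Algebra.FiniteType.out (R := k) (A := R)
  refine ⟨(F.biUnion fun r => ((DirectSum.decompose 𝒜 r).support.filter (0 < ·)).image
    fun t => ((DirectSum.decompose 𝒜 r t : R), t)).toList, ?_, ?_⟩
  · intro p hp
    simp only [Finset.mem_toList, Finset.mem_biUnion, Finset.mem_image, Finset.mem_filter] at hp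
    obtain ⟨r, -, t, ⟨-, ht⟩, rfl⟩ := hp
    exact ⟨(DirectSum.decompose 𝒜 r t).2, ht⟩
  · rw [← top_le_iff, ← hF, Algebra.adjoin_le_iff]
    intro r hr
    rw [← DirectSum.sum_support_decompose 𝒜 r]
    refine sum_mem fun t ht => ?_
    rcases lt_trichotomy t 0 with h | h | h
    · rw [(Submodule.mem_bot k).1 ((hneg t h).le (DirectSum.decompose 𝒜 r t).2)]
      exact zero_mem _
    · subst h
      obtain ⟨c, hc⟩ := Submodule.mem_one.1 (hzero.le (DirectSum.decompose 𝒜 r 0).2)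
      rw [← hc]
      exact Subalgebra.algebraMap_mem _ _
    · refine Algebra.subset_adjoin ⟨((DirectSum.decompose 𝒜 r t : R), t), ?_, rfl⟩
      simp only [Finset.mem_toList, Finset.mem_biUnion, Finset.mem_image, Finset.mem_filter]
      exact ⟨r, hr, t, ⟨ht, h⟩, rfl⟩

omit [Algebra k R] [IsScalarTower k R M] in
theorem exists_homogeneous_module_generators [Module.Finite R M] :
    ∃ S : Finset (M × ℝ), (∀ p ∈ S, p.1 ∈ ℳ p.2) ∧
      Submodule.span R {m | ∃ p ∈ S, p.1 = m} = ⊤ := by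
  classical
  obtain ⟨F, hF⟩ := Module.Finite.fg_top (R := R) (M := M)
  refine ⟨F.biUnion fun r => (DirectSum.decompose ℳ r).support.image
    fun t => ((DirectSum.decompose ℳ r t : M), t), ?_, ?_⟩
  · intro p hp
    simp only [Finset.mem_biUnion, Finset.mem_image] at hp
    obtain ⟨r, -, t, -, rfl⟩ := hp
    exact (DirectSum.decompose ℳ r t).2
  · rw [← top_le_iff, ← hF, Submodule.span_le]
    intro r hr
    rw [← DirectSum.sum_support_decompose ℳ r]
    refine sum_mem fun t ht => Submodule.subset_span ⟨((DirectSum.decompose ℳ r t : M), t), ?_, rfl⟩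
    simp only [Finset.mem_biUnion, Finset.mem_image]
    exact ⟨r, hr, t, ht, rfl⟩

/-- A subspace stable under algebra generators is a submodule. -/
theorem span_eq_top_of_smul_mem {A : Set R} (hA : Algebra.adjoin k A = ⊤) {S : Set M}
    (hS : Submodule.span R S = ⊤) {X : Set M} (hSX : S ⊆ X)
    (hX : ∀ f ∈ A, ∀ m ∈ X, f • m ∈ X) : Submodule.span k X = ⊤ := by
  have key : ∀ r : R, ∀ m ∈ Submodule.span k X, r • m ∈ Submodule.span k X := by
    intro r
    have hr : r ∈ Algebra.adjoin k A := hA ▸ Algebra.mem_top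
    induction hr using Algebra.adjoin_induction with
    | mem f hf =>
      intro m hm
      induction hm using Submodule.span_induction with
      | mem m hm => exact Submodule.subset_span (hX f hf m hm)
      | zero => simp
      | add x z _ _ hx hz => rw [smul_add]; exact add_mem hx hz
      | smul c x _ hx =>
        rw [smul_comm]
        exact Submodule.smul_mem _ _ hx
    | algebraMap c =>
      intro m hm
      rw [algebraMap_smul]
      exact Submodule.smul_mem _ _ hm
    | add a b _ _ ha hb =>
      intro m hm
      rw [add_smul]
      exact add_mem (ha m hm) (hb m hm)
    | mul a b _ _ ha hb =>
      intro m hm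
      rw [mul_smul]
      exact ha _ (hb m hm)
  rw [eq_top_iff]
  intro m _
  have hm : m ∈ Submodule.span R S := hS ▸ Submodule.mem_top
  induction hm using Submodule.span_induction with
  | mem m hm => exact Submodule.subset_span (hSX hm)
  | zero => exact zero_mem _
  | add x z _ _ hx hz => exact add_mem (hx trivial) (hz trivial)
  | smul r x _ hx => exact key r x (hx trivial)

omit [GradedAlgebra 𝒜] in
/-- The graded pieces of a finitely generated module lie in boxes of linear size. -/
theorem exists_gradedLE_le_boxSpan [Module.Finite R M] {gens : List (R × ℝ)}
    (hgens : ∀ p ∈ gens, p.1 ∈ 𝒜 p.2 ∧ 0 < p.2)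
    (htop : Algebra.adjoin k {f | ∃ p ∈ gens, p.1 = f} = ⊤) {n : ℕ}
    {φ : MvPolynomial (Fin n) k →ₐ[k] R} (hφ : φ.Finite) :
    ∃ (y : Fin n → R) (G : Finset M) (c δ : ℝ) (e e' : ℕ), 0 < δ ∧ (∀ t < c, ℳ t = ⊥) ∧
      ∀ x, gradedLE ℳ x ≤ boxSpan k y G (e' + ⌊(x - c) / δ⌋₊ * e) := by
  obtain ⟨S, hS, hStop⟩ := exists_homogeneous_module_generators (R := R) ℳ
  obtain ⟨G, hG⟩ := exists_forall_mem_boxSpan (M := M) hφ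
  set y : Fin n → R := fun i => φ (MvPolynomial.X i)
  have hG' : ∀ m, ∀ᶠ j in atTop, m ∈ boxSpan k y G j := by
    intro m
    obtain ⟨j, hj⟩ := hG m
    filter_upwards [eventually_ge_atTop j] with i hi using boxSpan_mono y G hi hj
  obtain ⟨e', he'⟩ : ∃ e', ∀ p ∈ S, p.1 ∈ boxSpan k y G e' :=
    ((eventually_all_finset S).2 fun p _ => hG' p.1).exists
  obtain ⟨e, he⟩ : ∃ e, ∀ p ∈ {p | p ∈ gens}, ∀ g ∈ G, p.1 • g ∈ boxSpan k y G e :=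
    (((List.finite_toSet gens).eventually_all).2 fun p _ =>
      (eventually_all_finset G).2 fun g _ => hG' (p.1 • g)).exists
  obtain ⟨c, hc⟩ : ∃ c : ℝ, ∀ p ∈ S, c ≤ p.2 :=
    ((eventually_all_finset S).2 fun p _ => eventually_le_atBot p.2).exists
  obtain ⟨δ, hδ0, hδ⟩ : ∃ δ : ℝ, 0 < δ ∧ ∀ p ∈ {p | p ∈ gens}, δ < p.2 := by
    have h1 : ∀ᶠ δ : ℝ in 𝓝[>] 0, ∀ p ∈ {p | p ∈ gens}, δ < p.2 :=
      ((List.finite_toSet gens).eventually_all).2 fun p hp =>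
        (eventually_lt_nhds (hgens p hp).2).filter_mono nhdsWithin_le_nhds
    exact (eventually_mem_nhdsWithin.and h1).exists
  -- Here j counts multiplications by algebra generators applied to a module generator. Each
  -- enlarges the box by at most e and raises the degree by at least δ, so degree at most x forces j
  -- ≤ (x - c) / δ.
  set X : Set M := {m | ∃ (t : ℝ) (j : ℕ), m ∈ ℳ t ∧ m ∈ boxSpan k y G (e' + j * e) ∧
    c + j * δ ≤ t} with hX
  have hXtop : Submodule.span k X = ⊤ := by
    refine span_eq_top_of_smul_mem htop hStop ?_ ?_
    · rintro _ ⟨p, hp, rfl⟩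
      exact ⟨p.2, 0, hS p hp, by simpa using he' p hp, by simpa using hc p hp⟩
    · rintro _ ⟨p, hp, rfl⟩ m ⟨t, j, hmt, hmj, hjt⟩
      refine ⟨t + p.2, j + 1, lsmul_mem_shift (hgens p hp).1 t m hmt, ?_, ?_⟩
      · have := smul_mem_boxSpan y (he p hp) hmj
        rwa [show e' + j * e + e = e' + (j + 1) * e by ring] at this
      · have := hδ p hp
        push_cast
        linarith
  have hgr : ∀ x, gradedLE ℳ x = Submodule.span k (truncation ℳ x '' X) := by
    intro x
    rw [← Submodule.map_span, hXtop, map_truncation Submodule.isHomogeneous_top, top_inf_eq]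
  refine ⟨y, G, c, δ, e, e', hδ0, ?_, fun x => ?_⟩
  · intro t ht
    refine le_bot_iff.1 ((le_gradedLE le_rfl).trans ?_)
    rw [hgr, Submodule.span_le]
    rintro _ ⟨m, ⟨s, j, hms, -, hj⟩, rfl⟩
    rw [truncation_of_mem hms, if_neg]
    · exact zero_mem _
    · have : 0 ≤ j * δ := by positivity
      linarith
  · rw [hgr, Submodule.span_le]
    rintro _ ⟨m, ⟨s, j, hms, hmj, hj⟩, rfl⟩
    rw [truncation_of_mem hms]
    split_ifs with hsx
    · refine boxSpan_mono y G ?_ hmj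
      gcongr
      refine Nat.le_floor ?_
      rw [le_div_iff₀ hδ0]
      linarith
    · exact zero_mem _

omit [GradedAlgebra 𝒜] in
/-- Basic finiteness properties of finitely generated graded modules. -/
theorem exists_growth [Module.Finite R M] {gens : List (R × ℝ)}
    (hgens : ∀ p ∈ gens, p.1 ∈ 𝒜 p.2 ∧ 0 < p.2)
    (htop : Algebra.adjoin k {f | ∃ p ∈ gens, p.1 = f} = ⊤) {n : ℕ}
    {φ : MvPolynomial (Fin n) k →ₐ[k] R} (hφ : φ.Finite) :
    (∃ c, ∀ t < c, ℳ t = ⊥) ∧ (∀ x, FiniteDimensional k (gradedLE ℳ x)) ∧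
      hilbertFun ℳ ⊤ =O[atTop] fun x : ℝ => x ^ n := by
  obtain ⟨y, G, c, δ, e, e', hδ, hc, h⟩ := exists_gradedLE_le_boxSpan 𝒜 ℳ hgens htop hφ
  have hfd := finiteDimensional_boxSpan (k := k) y G
  refine ⟨⟨c, hc⟩, fun x => Submodule.finiteDimensional_of_le (h x), ?_⟩
  have hb : (fun x : ℝ => ((e' + 1 + e * (1 + |c|) / δ) * x) ^ n * G.card) =O[atTop]
      fun x : ℝ => x ^ n := by
    refine ((isBigO_refl (fun x : ℝ => x ^ n) atTop).const_mul_left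
      ((e' + 1 + e * (1 + |c|) / δ) ^ n * G.card)).congr_left fun x => ?_
    rw [mul_pow]
    ring
  refine IsBigO.trans (IsBigO.of_bound 1 ?_) hb
  filter_upwards [eventually_ge_atTop (1 : ℝ), eventually_ge_atTop c] with x hx1 hxc
  have hj : ((e' + ⌊(x - c) / δ⌋₊ * e + 1 : ℕ) : ℝ) ≤ (e' + 1 + e * (1 + |c|) / δ) * x := by
    have h1 := Nat.floor_le (div_nonneg (sub_nonneg.2 hxc) hδ.le)
    have h2 : (x - c) / δ ≤ (1 + |c|) / δ * x := by
      rw [div_mul_eq_mul_div]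
      gcongr
      have := neg_le_abs c
      nlinarith [abs_nonneg c]
    have h3 : (⌊(x - c) / δ⌋₊ : ℝ) * e ≤ (1 + |c|) / δ * x * e := by
      gcongr
      exact h1.trans h2
    have h4 : ((e' : ℝ) + 1) * 1 ≤ (e' + 1) * x := by gcongr
    push_cast
    calc (e' : ℝ) + ⌊(x - c) / δ⌋₊ * e + 1 ≤ (e' + 1) * x + (1 + |c|) / δ * x * e := by linarith
      _ = _ := by ring
  rw [one_mul, Real.norm_of_nonneg (hilbertFun_nonneg _ _), Real.norm_of_nonneg (by positivity),
    hilbertFun, top_inf_eq]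
  have h1 := (Submodule.finrank_mono (h x)).trans (finrank_boxSpan_le y G _)
  refine (Nat.cast_le.2 h1).trans ?_
  rw [Nat.cast_mul, Nat.cast_pow]
  gcongr

theorem mul_mem_gradedLE {x y : ℝ} {a b : R} (ha : a ∈ gradedLE 𝒜 x) (hb : b ∈ gradedLE 𝒜 y) :
    a * b ∈ gradedLE 𝒜 (x + y) := by
  have h1 : ∀ s ≤ x, ∀ r ∈ 𝒜 s, gradedLE 𝒜 y ≤
      (gradedLE 𝒜 (x + y)).comap (LinearMap.mulLeft k r) := by
    intro s hs r hr
    refine iSup_le fun t b hb => ?_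
    have ht : (t : ℝ) ≤ y := t.2
    exact le_gradedLE (add_le_add hs ht) (SetLike.mul_mem_graded hr hb)
  have h2 : gradedLE 𝒜 x ≤ (gradedLE 𝒜 (x + y)).comap (LinearMap.mulRight k b) :=
    iSup_le fun s a ha => h1 s s.2 a ha hb
  exact h2 ha

theorem prod_pow_mem_gradedLE (hzero : 𝒜 0 = 1) {n : ℕ} {y : Fin n → R} {d : ℝ} (hd : 0 ≤ d)
    (hy : ∀ i, y i ∈ gradedLE 𝒜 d) {j : ℕ} (a : Fin n → ℕ) (ha : ∀ i, a i ≤ j) (s : Finset (Fin n)) :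
    ∏ i ∈ s, y i ^ a i ∈ gradedLE 𝒜 (s.card * (j * d)) := by
  classical
  have hone : (1 : R) ∈ gradedLE 𝒜 0 := by
    refine le_gradedLE le_rfl ?_
    rw [hzero]
    exact Submodule.mem_one.2 ⟨1, map_one _⟩
  have hpow : ∀ i, ∀ m : ℕ, y i ^ m ∈ gradedLE 𝒜 (m * d) := by
    intro i m
    induction m with
    | zero => simpa using hone
    | succ m ih =>
      rw [pow_succ, show ((m + 1 : ℕ) : ℝ) * d = m * d + d by push_cast; ring]
      exact mul_mem_gradedLE 𝒜 ih (hy i)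
  induction s using Finset.induction_on with
  | empty => simpa using hone
  | insert i s hi ih =>
    rw [Finset.prod_insert hi, Finset.card_insert_of_notMem hi,
      show ((s.card + 1 : ℕ) : ℝ) * (j * d) = j * d + s.card * (j * d) by push_cast; ring]
    refine mul_mem_gradedLE 𝒜 (gradedLE_mono ?_ (hpow i (a i))) ih
    have : (a i : ℝ) ≤ j := Nat.cast_le.2 (ha i)
    gcongr

/-- The Hilbert function of `R` grows at least like `x ^ n`. -/
theorem exists_pow_le_hilbertFun (hzero : 𝒜 0 = 1) {n : ℕ}
    {φ : MvPolynomial (Fin n) k →ₐ[k] R} (hφ : Function.Injective φ)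
    (hfin : ∀ x, FiniteDimensional k (gradedLE 𝒜 x)) :
    ∃ C : ℝ, 0 < C ∧ ∀ x, 0 ≤ x → (C * x) ^ n ≤ hilbertFun 𝒜 ⊤ x := by
  classical
  set y : Fin n → R := fun i => φ (MvPolynomial.X i) with hy
  have hex : ∀ r : R, ∀ᶠ d in atTop, r ∈ gradedLE 𝒜 d := by
    intro r
    rw [← DirectSum.sum_support_decompose 𝒜 r]
    have := (eventually_all_finset (l := (atTop : Filter ℝ))
      (p := fun t d => (DirectSum.decompose 𝒜 r t : R) ∈ gradedLE 𝒜 d)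
      (DirectSum.decompose 𝒜 r).support).2 fun t _ => by
        filter_upwards [eventually_ge_atTop t] with d hd
        exact le_gradedLE hd (DirectSum.decompose 𝒜 r t).2
    filter_upwards [this] with d hd using sum_mem hd
  obtain ⟨d, hd, hyd⟩ : ∃ d : ℝ, 0 < d ∧ ∀ i, y i ∈ gradedLE 𝒜 d :=
    ((eventually_gt_atTop 0).and (eventually_all.2 fun i => hex (y i))).exists
  -- Exponents up to j in n variables give (j + 1)^n independent monomials of degree at most n j d ≤
  -- x, and j + 1 exceeds x / ((n + 1) d). Using n + 1 instead of n keeps the denominator positive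
  -- when n = 0.
  refine ⟨1 / ((n + 1) * d), by positivity, fun x hx => ?_⟩
  set j := ⌊x / ((n + 1) * d)⌋₊ with hj
  have hjx : (n : ℝ) * (j * d) ≤ x := by
    have h1 := Nat.floor_le (show 0 ≤ x / ((n + 1) * d) by positivity)
    rw [← hj, le_div_iff₀ (by positivity)] at h1
    have : 0 ≤ (j : ℝ) * d := by positivity
    nlinarith
  have := hfin x
  let v : (Fin n → Fin (j + 1)) → gradedLE 𝒜 x := fun a =>
    ⟨∏ i, y i ^ (a i : ℕ), gradedLE_mono hjx (by
      simpa using prod_pow_mem_gradedLE 𝒜 hzero hd.le hyd (j := j) (fun i => (a i : ℕ))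
        (fun i => Nat.lt_succ_iff.1 (a i).2) Finset.univ)⟩
  have hv : LinearIndependent k v := by
    refine LinearIndependent.of_comp (gradedLE 𝒜 x).subtype ?_
    have h1 := (MvPolynomial.basisMonomials (Fin n) k).linearIndependent.map' φ.toLinearMap
      (LinearMap.ker_eq_bot.2 hφ)
    have h2 := h1.comp (fun a : Fin n → Fin (j + 1) =>
      Finsupp.equivFunOnFinite.symm fun i => (a i : ℕ)) (by
        intro a b hab
        funext i
        have := DFunLike.congr_fun hab i
        exact Fin.ext (by simpa using this))
    have h3 : ⇑(gradedLE 𝒜 x).subtype ∘ v = (⇑φ.toLinearMap ∘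
        ⇑(MvPolynomial.basisMonomials (Fin n) k)) ∘ fun a : Fin n → Fin (j + 1) =>
          Finsupp.equivFunOnFinite.symm fun i => (a i : ℕ) := by
      funext a
      simp [v, hy, MvPolynomial.monomial_eq, Finsupp.prod_fintype]
    rw [h3]
    exact h2
  have hcard := hv.fintype_card_le_finrank
  rw [Fintype.card_fun, Fintype.card_fin, Fintype.card_fin] at hcard
  rw [hilbertFun, top_inf_eq]
  refine le_trans ?_ (Nat.cast_le.2 hcard)
  rw [Nat.cast_pow]
  refine pow_le_pow_left₀ (by positivity) ?_ n
  have := (Nat.lt_floor_add_one (x / ((n + 1) * d))).le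
  rw [one_div_mul_eq_div]
  push_cast
  exact this

end Growth

/-! ### Coefficients of graded submodules -/

section Coefficients

variable {k R M : Type*} [Field k] [CommRing R] [Algebra k R]
  [AddCommGroup M] [Module R M] [Module k M] [IsScalarTower k R M]

/-- The Hilbert functions of graded subquotients have Riemann-Roch coefficients, positive
combinations of densities. -/
structure HasHilbertExpansion (R : Type*) [CommRing R] [Algebra k R] [Module R M]
    [IsScalarTower k R M] (W : List ℝ) (n : ℕ) (ℳ : ℝ → Submodule k M)
    [DirectSum.Decomposition ℳ] : Prop where
  weight_pos : ∀ v ∈ W, 0 < v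
  one_le : 1 ≤ n
  noetherian : IsNoetherian R M
  finiteDimensional : ∀ x, FiniteDimensional k (gradedLE ℳ x)
  expansion : ∀ {N P : Submodule R M}, N ≤ P → N.IsHomogeneous ℳ → P.IsHomogeneous ℳ →
    ∃ a b, HasRiemannRoch n (fun x => moduleHilbertFun ℳ P x - moduleHilbertFun ℳ N x) a b ∧
      a ∈ densityMonoid W n ∧ (a = 0 → b ∈ densityMonoid W (n - 1))

theorem hasHilbertExpansion [Module.Finite R M]
    {𝒜 : ℝ → Submodule k R} {ℳ : ℝ → Submodule k M} [DirectSum.Decomposition ℳ]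
    [SetLike.GradedSMul 𝒜 ℳ] [GradedAlgebra 𝒜] {gens : List (R × ℝ)}
    (hgens : ∀ p ∈ gens, p.1 ∈ 𝒜 p.2 ∧ 0 < p.2)
    (htop : Algebra.adjoin k {f | ∃ p ∈ gens, p.1 = f} = ⊤) {n : ℕ} (hn : 1 ≤ n)
    {φ : MvPolynomial (Fin n) k →ₐ[k] R} (hφ : φ.Finite) :
    HasHilbertExpansion R (gens.map Prod.snd) n ℳ := by
  obtain ⟨⟨c, hc⟩, hfin, hO⟩ := exists_growth 𝒜 ℳ hgens htop hφ
  have : Algebra.FiniteType k R := by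
    have hf : {f | ∃ p ∈ gens, p.1 = f}.Finite := by
      refine ((List.finite_toSet gens).image Prod.fst).subset ?_
      rintro _ ⟨p, hp, rfl⟩
      exact ⟨p, hp, rfl⟩
    exact ⟨⟨hf.toFinset, by rw [hf.coe_toFinset, htop]⟩⟩
  have : IsNoetherianRing R := Algebra.FiniteType.isNoetherianRing k R
  have hM : IsNoetherian R M := isNoetherian_of_isNoetherianRing_of_finite R M
  have hW : ∀ v ∈ gens.map Prod.snd, 0 < v := by
    intro v hv
    obtain ⟨p, hp, rfl⟩ := List.mem_map.1 hv
    exact (hgens p hp).2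
  refine ⟨hW, hn, hM, hfin, fun {N P} hNP hN hP => ?_⟩
  obtain ⟨s, hs⟩ := hM.noetherian P
  have hsum : IsWeightSum (gens.map Prod.snd)
      fun x => moduleHilbertFun ℳ P x - moduleHilbertFun ℳ N x := by
    refine isWeightSum_moduleHilbertFun 𝒜 hfin hc gens hgens hNP hN hP
      ⟨s, hs ▸ Submodule.subset_span, fun p hp => ⟨p, ?_, by simp⟩⟩
    rw [htop]
    rw [← hs] at hp
    induction hp using Submodule.span_induction with
    | mem m hm => exact Submodule.subset_span hm
    | zero => exact zero_mem _
    | add x y _ _ hx hy => exact add_mem hx hy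
    | smul a x _ hx => exact Submodule.smul_mem _ (⟨a, trivial⟩ : (⊤ : Subalgebra k R)) hx
  refine hsum.exists_hasRiemannRoch hW hn (IsBigO.trans (IsBigO.of_bound 1 ?_) hO)
  refine .of_forall fun x => ?_
  have hle : moduleHilbertFun ℳ N x ≤ moduleHilbertFun ℳ P x :=
    hilbertFun_le_of_le hfin (U := N.restrictScalars k) hNP x
  rw [one_mul, Real.norm_of_nonneg (sub_nonneg.2 hle), Real.norm_of_nonneg (hilbertFun_nonneg _ _)]
  exact (sub_le_self _ (hilbertFun_nonneg _ _)).trans (hilbertFun_le_of_le hfin le_top x)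

variable (n : ℕ) (ℳ : ℝ → Submodule k M)

/-- The Riemann-Roch coefficients of a graded submodule. -/
noncomputable def submoduleCoeff (N : Submodule R M) : ℝ × ℝ :=
  Classical.epsilon fun c : ℝ × ℝ => HasRiemannRoch n (moduleHilbertFun ℳ N) c.1 c.2

/-- The coefficient `a_n` of a graded submodule. -/
noncomputable def leadCoeff (N : Submodule R M) : ℝ := (submoduleCoeff n ℳ N).1

/-- The coefficient `a_{n-1}` of a graded submodule. -/
noncomputable def subCoeff (N : Submodule R M) : ℝ := (submoduleCoeff n ℳ N).2

variable {n ℳ} {W : List ℝ}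

theorem moduleHilbertFun_bot (x : ℝ) : moduleHilbertFun ℳ (⊥ : Submodule R M) x = 0 :=
  hilbertFun_bot x

variable [DirectSum.Decomposition ℳ]

namespace HasHilbertExpansion

variable (H : HasHilbertExpansion R W n ℳ) {N P Q : Submodule R M}

include H

theorem hasRiemannRoch (hN : N.IsHomogeneous ℳ) :
    HasRiemannRoch n (moduleHilbertFun ℳ N) (leadCoeff n ℳ N) (subCoeff n ℳ N) := by
  obtain ⟨a, b, h, -, -⟩ := H.expansion bot_le Submodule.isHomogeneous_bot hN
  simp only [moduleHilbertFun_bot, sub_zero] at h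
  exact Classical.epsilon_spec
    (p := fun c : ℝ × ℝ => HasRiemannRoch n (moduleHilbertFun ℳ N) c.1 c.2) ⟨(a, b), h⟩

theorem coeff_eq (hN : N.IsHomogeneous ℳ) {a b : ℝ}
    (h : HasRiemannRoch n (moduleHilbertFun ℳ N) a b) :
    leadCoeff n ℳ N = a ∧ subCoeff n ℳ N = b :=
  (H.hasRiemannRoch hN).unique H.one_le h

/-- The differences are the coefficients of P/N, whose Hilbert function is itself a weight sum.
Monotonicity of a, and of b at equal a, follows from nonnegativity of the densities. -/
theorem coeff_sub_mem (hNP : N ≤ P) (hN : N.IsHomogeneous ℳ) (hP : P.IsHomogeneous ℳ) :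
    leadCoeff n ℳ P - leadCoeff n ℳ N ∈ densityMonoid W n ∧
      (leadCoeff n ℳ N = leadCoeff n ℳ P →
        subCoeff n ℳ P - subCoeff n ℳ N ∈ densityMonoid W (n - 1)) := by
  obtain ⟨a, b, h, ha, hb⟩ := H.expansion hNP hN hP
  obtain ⟨rfl, rfl⟩ := h.unique H.one_le ((H.hasRiemannRoch hP).sub (H.hasRiemannRoch hN))
  exact ⟨ha, fun h => hb (sub_eq_zero.2 h.symm)⟩

theorem leadCoeff_mono (hNP : N ≤ P) (hN : N.IsHomogeneous ℳ) (hP : P.IsHomogeneous ℳ) :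
    leadCoeff n ℳ N ≤ leadCoeff n ℳ P :=
  sub_nonneg.1 (densityMonoid_nonneg H.weight_pos (H.coeff_sub_mem hNP hN hP).1)

theorem subCoeff_mono (hNP : N ≤ P) (hN : N.IsHomogeneous ℳ) (hP : P.IsHomogeneous ℳ)
    (heq : leadCoeff n ℳ N = leadCoeff n ℳ P) : subCoeff n ℳ N ≤ subCoeff n ℳ P :=
  sub_nonneg.1 (densityMonoid_nonneg H.weight_pos ((H.coeff_sub_mem hNP hN hP).2 heq))

theorem coeff_sup_add_inf (hN : N.IsHomogeneous ℳ) (hP : P.IsHomogeneous ℳ) :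
    leadCoeff n ℳ (N ⊔ P) + leadCoeff n ℳ (N ⊓ P) = leadCoeff n ℳ N + leadCoeff n ℳ P ∧
      subCoeff n ℳ (N ⊔ P) + subCoeff n ℳ (N ⊓ P) = subCoeff n ℳ N + subCoeff n ℳ P := by
  have h1 := (H.hasRiemannRoch (Submodule.isHomogeneous_sup hN hP)).add
    (H.hasRiemannRoch (Submodule.isHomogeneous_inf hN hP))
  have h2 := (H.hasRiemannRoch hN).add (H.hasRiemannRoch hP)
  refine h1.unique H.one_le ?_
  convert h2 using 2 with x
  have h3 := hilbertFun_sup_add_inf H.finiteDimensional (U := N.restrictScalars k)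
    (V := P.restrictScalars k) hN hP x
  rw [← Submodule.restrictScalars_sup_eq] at h3
  exact h3

theorem coeff_bot : leadCoeff n ℳ (⊥ : Submodule R M) = 0 ∧
    subCoeff n ℳ (⊥ : Submodule R M) = 0 := by
  refine H.coeff_eq Submodule.isHomogeneous_bot ?_
  have : moduleHilbertFun ℳ (⊥ : Submodule R M) = fun _ => 0 :=
    funext fun x => moduleHilbertFun_bot x
  rw [this]
  exact HasRiemannRoch.zero n

end HasHilbertExpansion

section Cyclic

variable {𝒜 : ℝ → Submodule k R} [GradedAlgebra 𝒜] [SetLike.GradedSMul 𝒜 ℳ]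

omit [DirectSum.Decomposition ℳ] [GradedAlgebra 𝒜] in
theorem toSpanSingleton_mem_shift {m : M} {t : ℝ} (hm : m ∈ ℳ t) (s : ℝ) (r : R) (hr : r ∈ 𝒜 s) :
    ((LinearMap.toSpanSingleton R M m).restrictScalars k) r ∈ ℳ (s + t) := by
  have := SetLike.GradedSMul.smul_mem hr hm
  rwa [vadd_eq_add] at this

theorem isHomogeneous_span_singleton (𝒜 : ℝ → Submodule k R) [GradedAlgebra 𝒜]
    [SetLike.GradedSMul 𝒜 ℳ] {m : M} {t : ℝ} (hm : m ∈ ℳ t) :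
    (Submodule.span R {m}).IsHomogeneous ℳ := by
  have := isHomogeneous_map_shift (toSpanSingleton_mem_shift (𝒜 := 𝒜) hm)
    (U := (⊤ : Submodule k R)) Submodule.isHomogeneous_top
  intro i x hx
  obtain ⟨r, rfl⟩ := Submodule.mem_span_singleton.1 hx
  obtain ⟨r', -, hr'⟩ := this i (m := r • m) ⟨r, trivial, rfl⟩
  rw [← hr']
  exact Submodule.smul_mem _ _ (Submodule.mem_span_singleton_self m)

theorem isHomogeneous_colon {N : Submodule R M} (hN : N.IsHomogeneous ℳ) {m : M} {t : ℝ}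
    (hm : m ∈ ℳ t) : (N.comap (LinearMap.toSpanSingleton R M m)).IsHomogeneous 𝒜 :=
  isHomogeneous_comap_shift (toSpanSingleton_mem_shift (𝒜 := 𝒜) hm)
    (C := N.restrictScalars k) hN

namespace HasHilbertExpansion

variable (H : HasHilbertExpansion R W n ℳ) (HR : HasHilbertExpansion R W n 𝒜)
  {N P Q : Submodule R M}

include H HR

/-- The added part (N + R m)/N is R/(N : m) shifted by the degree of m, and a shift does not affect
the leading coefficient. -/
theorem leadCoeff_sup_span (hN : N.IsHomogeneous ℳ) {m : M} {t : ℝ} (hm : m ∈ ℳ t) :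
    leadCoeff n ℳ (N ⊔ Submodule.span R {m}) = leadCoeff n ℳ N + (leadCoeff n 𝒜 (⊤ : Ideal R) -
      leadCoeff n 𝒜 (N.comap (LinearMap.toSpanSingleton R M m))) := by
  have hJ : (N.comap (LinearMap.toSpanSingleton R M m)).IsHomogeneous 𝒜 :=
    isHomogeneous_colon hN hm
  have h1 := ((HR.hasRiemannRoch Submodule.isHomogeneous_top).sub
    (HR.hasRiemannRoch hJ)).comp_sub_right HR.one_le t
  refine (H.coeff_eq (Submodule.isHomogeneous_sup hN (isHomogeneous_span_singleton 𝒜 hm))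
    (Eq.subst (motive := fun h => HasRiemannRoch n h _ _) (funext fun x => ?_)
      ((H.hasRiemannRoch hN).add h1))).1
  have h2 := hilbertFun_sup_map_shift (toSpanSingleton_mem_shift (𝒜 := 𝒜) hm)
    H.finiteDimensional HR.finiteDimensional (U := (⊤ : Submodule k R))
    Submodule.isHomogeneous_top (C := N.restrictScalars k) hN x
  have h3 : (N ⊔ Submodule.span R {m}).restrictScalars k = N.restrictScalars k ⊔
      (⊤ : Submodule k R).map ((LinearMap.toSpanSingleton R M m).restrictScalars k) := by
    rw [Submodule.restrictScalars_sup_eq]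
    congr 1
    ext v
    simp [Submodule.mem_span_singleton]
  rw [← h3, top_inf_eq] at h2
  simp only [moduleHilbertFun]
  rw [sub_eq_iff_eq_add] at h2
  rw [h2, add_comm]
  rfl

theorem leadCoeff_sup_span_of_injective (hN : N.IsHomogeneous ℳ) {m : M} {t : ℝ} (hm : m ∈ ℳ t)
    (hJ : ∀ r : R, r • m ∈ N → r = 0) :
    leadCoeff n ℳ (N ⊔ Submodule.span R {m}) = leadCoeff n ℳ N + leadCoeff n 𝒜 (⊤ : Ideal R) := by
  have : N.comap (LinearMap.toSpanSingleton R M m) = ⊥ :=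
    (Submodule.eq_bot_iff _).2 fun r hr => hJ r hr
  rw [H.leadCoeff_sup_span HR hN hm, this, HR.coeff_bot.1, sub_zero]

omit H in
-- A nonzero homogeneous ideal contains a nonzero homogeneous element, hence, R being a domain, a
-- shifted copy of R.
theorem leadCoeff_ideal [IsDomain R] {J : Ideal R} (hJ : J.IsHomogeneous 𝒜) (hJ0 : J ≠ ⊥) :
    leadCoeff n 𝒜 J = leadCoeff n 𝒜 (⊤ : Ideal R) := by
  obtain ⟨r, hr, hr0⟩ := Submodule.exists_mem_ne_zero_of_ne_bot hJ0
  obtain ⟨t, ht⟩ : ∃ t, (DirectSum.decompose 𝒜 r t : R) ≠ 0 := by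
    classical
    by_contra! h
    refine hr0 ?_
    rw [← DirectSum.sum_support_decompose 𝒜 r]
    exact Finset.sum_eq_zero fun t _ => h t
  have hrt : (DirectSum.decompose 𝒜 r t : R) ∈ J := hJ t hr
  have h1 := HR.leadCoeff_sup_span_of_injective HR (N := (⊥ : Ideal R))
    Submodule.isHomogeneous_bot (DirectSum.decompose 𝒜 r t).2 (fun s hs => by
      simpa [ht] using hs)
  rw [HR.coeff_bot.1, zero_add, bot_sup_eq] at h1
  refine le_antisymm (HR.leadCoeff_mono le_top hJ Submodule.isHomogeneous_top) ?_
  rw [← h1]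
  exact HR.leadCoeff_mono ((Submodule.span_singleton_le_iff_mem _ _).2 hrt)
    (isHomogeneous_span_singleton 𝒜 (DirectSum.decompose 𝒜 r t).2) hJ

theorem leadCoeff_sup_span_of_torsion [IsDomain R] (hN : N.IsHomogeneous ℳ) {m : M} {t : ℝ}
    (hm : m ∈ ℳ t) {r : R} (hr : r ≠ 0) (hrm : r • m ∈ N) :
    leadCoeff n ℳ (N ⊔ Submodule.span R {m}) = leadCoeff n ℳ N := by
  have hJ : N.comap (LinearMap.toSpanSingleton R M m) ≠ ⊥ := by
    refine (Submodule.ne_bot_iff _).2 ⟨r, ?_, hr⟩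
    exact hrm
  rw [H.leadCoeff_sup_span HR hN hm, HR.leadCoeff_ideal (isHomogeneous_colon hN hm) hJ]
  ring

end HasHilbertExpansion

end Cyclic

end Coefficients

/-! ### Torsion, rank and the chain condition on degrees -/

section Torsion

variable {k R M : Type*} [Field k] [CommRing R] [Algebra k R]
  [AddCommGroup M] [Module R M] [Module k M] [IsScalarTower k R M]
  {ℳ : ℝ → Submodule k M} [DirectSum.Decomposition ℳ]
  {𝒜 : ℝ → Submodule k R} [GradedAlgebra 𝒜] [SetLike.GradedSMul 𝒜 ℳ]

omit [IsScalarTower k R M] in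
/-- The component of `r • m` in the sum of the top degrees of `r` and `m`. -/
theorem decompose_smul_top_degree {r : R} {m : M} {s t : ℝ}
    (hr : r ∈ gradedLE 𝒜 s) (hm : m ∈ gradedLE ℳ t) :
    (DirectSum.decompose ℳ (r • m) (s + t) : M) =
      (DirectSum.decompose 𝒜 r s : R) • (DirectSum.decompose ℳ m t : M) := by
  classical
  have key : ∀ {i j : ℝ} {a : R} {b : M}, i ≤ s → j ≤ t → a ∈ 𝒜 i → b ∈ ℳ j →
      (DirectSum.decompose ℳ (a • b) (s + t) : M) =
        (DirectSum.decompose 𝒜 a s : R) • (DirectSum.decompose ℳ b t : M) := by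
    intro i j a b hi hj ha hb
    have hab : a • b ∈ ℳ (i + j) := by
      have := SetLike.GradedSMul.smul_mem ha hb
      rwa [vadd_eq_add] at this
    by_cases his : i = s
    · subst his
      rw [DirectSum.decompose_of_mem_same 𝒜 ha]
      by_cases hjt : j = t
      · subst hjt
        rw [DirectSum.decompose_of_mem_same ℳ hab, DirectSum.decompose_of_mem_same ℳ hb]
      · rw [DirectSum.decompose_of_mem_ne ℳ hab (fun h => hjt (by linarith)),
          DirectSum.decompose_of_mem_ne ℳ hb hjt, smul_zero]
    · rw [DirectSum.decompose_of_mem_ne ℳ hab, DirectSum.decompose_of_mem_ne 𝒜 ha his, zero_smul]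
      have := lt_of_le_of_ne hi his
      intro h
      linarith
  have key2 : ∀ {i : ℝ} {a : R}, i ≤ s → a ∈ 𝒜 i →
      (DirectSum.decompose ℳ (a • m) (s + t) : M) =
        (DirectSum.decompose 𝒜 a s : R) • (DirectSum.decompose ℳ m t : M) := by
    intro i a hi ha
    refine Submodule.iSup_induction (fun j : Set.Iic t => ℳ j) (motive := fun m =>
      (DirectSum.decompose ℳ (a • m) (s + t) : M) =
        (DirectSum.decompose 𝒜 a s : R) • (DirectSum.decompose ℳ m t : M)) hm ?_ ?_ ?_
    · exact fun j b hb => key hi j.2 ha hb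
    · simp
    · intro b c hb hc
      simp [smul_add, DirectSum.decompose_add, hb, hc]
  refine Submodule.iSup_induction (fun j : Set.Iic s => 𝒜 j) (motive := fun a =>
    (DirectSum.decompose ℳ (a • m) (s + t) : M) =
      (DirectSum.decompose 𝒜 a s : R) • (DirectSum.decompose ℳ m t : M)) hr ?_ ?_ ?_
  · exact fun j b hb => key2 j.2 hb
  · simp
  · intro b c hb hc
    simp [add_smul, DirectSum.decompose_add, hb, hc]

omit [SetLike.GradedSMul 𝒜 ℳ] [GradedAlgebra 𝒜] [IsScalarTower k R M] [Algebra k R] [CommRing R]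
  [Module R M] in
theorem exists_top_degree {m : M} (hm : m ≠ 0) :
    ∃ t, m ∈ gradedLE ℳ t ∧ (DirectSum.decompose ℳ m t : M) ≠ 0 := by
  classical
  have hne : (DirectSum.decompose ℳ m).support.Nonempty := by
    rw [Finset.nonempty_iff_ne_empty]
    intro h
    refine hm ?_
    rw [← DirectSum.sum_support_decompose ℳ m, h, Finset.sum_empty]
  refine ⟨(DirectSum.decompose ℳ m).support.max' hne, ?_, ?_⟩
  · have h1 : ∑ i ∈ (DirectSum.decompose ℳ m).support, (DirectSum.decompose ℳ m i : M) ∈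
        gradedLE ℳ ((DirectSum.decompose ℳ m).support.max' hne) :=
      sum_mem fun t ht => le_gradedLE (Finset.le_max' _ t ht) (DirectSum.decompose ℳ m t).2
    rwa [DirectSum.sum_support_decompose ℳ m] at h1
  · have := (DirectSum.decompose ℳ m).support.max'_mem hne
    rw [DFinsupp.mem_support_iff] at this
    simpa using this

omit [IsScalarTower k R M] in
/-- A graded quotient without homogeneous torsion is torsion-free. -/
theorem mem_of_smul_mem_of_homogeneous {N P : Submodule R M} (hN : N.IsHomogeneous ℳ)
    (hP : P.IsHomogeneous ℳ) (h : ∀ (s t : ℝ) (r : R) (m : M), r ∈ 𝒜 s → m ∈ ℳ t → m ∈ P →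
      r ≠ 0 → r • m ∈ N → m ∈ N) {r : R} (hr : r ≠ 0) {m : M} (hm : m ∈ P) (hrm : r • m ∈ N) :
    m ∈ N := by
  classical
  obtain ⟨s, hrs, hrs0⟩ := exists_top_degree (ℳ := 𝒜) hr
  -- The top components of r and m multiply to a component of r • m, so the top component of m lies
  -- in N by hypothesis; subtracting it leaves fewer components.
  induction hc : (DirectSum.decompose ℳ m).support.card using Nat.strong_induction_on
    generalizing m with
  | _ c ih =>
  by_cases hm0 : m = 0
  · rw [hm0]
    exact zero_mem _
  obtain ⟨t, hmt, hmt0⟩ := exists_top_degree (ℳ := ℳ) hm0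
  set m' : M := (DirectSum.decompose ℳ m t : M) with hm'
  have hm't : m' ∈ ℳ t := (DirectSum.decompose ℳ m t).2
  have hm'P : m' ∈ P := hP t hm
  have hm'N : m' ∈ N := by
    refine h s t _ m' (DirectSum.decompose 𝒜 r s).2 hm't hm'P hrs0 ?_
    rw [hm', ← decompose_smul_top_degree hrs hmt]
    exact hN _ hrm
  have hdec : ∀ i, (DirectSum.decompose ℳ (m - m') i : M) =
      if i = t then 0 else (DirectSum.decompose ℳ m i : M) := by
    intro i
    rw [DirectSum.decompose_sub, DirectSum.sub_apply]
    split_ifs with hi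
    · subst hi
      rw [AddSubgroupClass.coe_sub, DirectSum.decompose_of_mem_same ℳ hm't, hm', sub_self]
    · rw [AddSubgroupClass.coe_sub, DirectSum.decompose_of_mem_ne ℳ hm't (Ne.symm hi), sub_zero]
  have hcard : (DirectSum.decompose ℳ (m - m')).support.card < c := by
    rw [← hc]
    refine Finset.card_lt_card (Finset.ssubset_iff_of_subset ?_ |>.2 ⟨t, ?_, ?_⟩)
    · intro i hi
      rw [DFinsupp.mem_support_iff] at hi ⊢
      intro h0
      refine hi (Subtype.ext ?_)
      rw [hdec, h0]
      simp
    · rw [DFinsupp.mem_support_iff]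
      exact fun h0 => hmt0 (by rw [hm', h0]; rfl)
    · rw [DFinsupp.mem_support_iff, not_not]
      refine Subtype.ext ?_
      rw [hdec, if_pos rfl]
      rfl
  have := ih _ hcard (P.sub_mem hm hm'P) (by
    rw [smul_sub]
    exact N.sub_mem hrm (N.smul_mem _ hm'N)) rfl
  rw [← sub_add_cancel m m']
  exact N.add_mem this hm'N

omit [SetLike.GradedSMul 𝒜 ℳ] [GradedAlgebra 𝒜] [IsScalarTower k R M] [Algebra k R] in
theorem exists_homogeneous_mem_notMem {N Q : Submodule R M} (hQ : Q.IsHomogeneous ℳ)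
    (hQN : ¬ Q ≤ N) : ∃ t, ∃ m ∈ ℳ t, m ∈ Q ∧ m ∉ N := by
  classical
  by_contra! h
  refine hQN fun m hm => ?_
  rw [← DirectSum.sum_support_decompose ℳ m]
  exact sum_mem fun t _ => h t _ (DirectSum.decompose ℳ m t).2 (hQ t hm)

omit [SetLike.GradedSMul 𝒜 ℳ] [GradedAlgebra 𝒜] [IsScalarTower k R M] [Algebra k R] in
theorem exists_homogeneous_span_eq {N : Submodule R M} (hN : N.IsHomogeneous ℳ) (hfg : N.FG) :
    ∃ S : Finset M, (∀ m ∈ S, ∃ t, m ∈ ℳ t) ∧ Submodule.span R (S : Set M) = N := by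
  classical
  obtain ⟨F, hF⟩ := hfg
  refine ⟨F.biUnion fun m => (DirectSum.decompose ℳ m).support.image
    fun t => (DirectSum.decompose ℳ m t : M), ?_, le_antisymm ?_ ?_⟩
  · intro m hm
    simp only [Finset.mem_biUnion, Finset.mem_image] at hm
    obtain ⟨m', -, t, -, rfl⟩ := hm
    exact ⟨t, (DirectSum.decompose ℳ m' t).2⟩
  · rw [Submodule.span_le]
    intro m hm
    simp only [Finset.mem_coe, Finset.mem_biUnion, Finset.mem_image] at hm
    obtain ⟨m', hm', t, -, rfl⟩ := hm
    exact hN t (hF ▸ Submodule.subset_span hm')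
  · rw [← hF, Submodule.span_le]
    intro m hm
    rw [← DirectSum.sum_support_decompose ℳ m]
    refine sum_mem fun t ht => Submodule.subset_span ?_
    simp only [Finset.mem_coe, Finset.mem_biUnion, Finset.mem_image]
    exact ⟨m, hm, t, ht, rfl⟩

namespace HasHilbertExpansion

variable {n : ℕ} {W : List ℝ} (H : HasHilbertExpansion R W n ℳ) (HR : HasHilbertExpansion R W n 𝒜)
  {N P Q : Submodule R M}

include H HR

/-- A nonzero torsion-free graded quotient contains a homogeneous free cyclic module, which
contributes a(R) > 0. -/
theorem leadCoeff_lt (hpos : 0 < leadCoeff n 𝒜 (⊤ : Ideal R)) (hN : N.IsHomogeneous ℳ)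
    (hQ : Q.IsHomogeneous ℳ) (hNQ : N < Q)
    (htf : ∀ r : R, r ≠ 0 → ∀ m ∈ Q, r • m ∈ N → m ∈ N) : leadCoeff n ℳ N < leadCoeff n ℳ Q := by
  obtain ⟨t, m, hmt, hmQ, hmN⟩ := exists_homogeneous_mem_notMem hQ hNQ.not_ge
  have h1 := H.leadCoeff_sup_span_of_injective HR hN hmt (fun r hr => by
    by_contra hr0
    exact hmN (htf r hr0 m hmQ hr))
  have h2 := H.leadCoeff_mono (sup_le hNQ.le ((Submodule.span_singleton_le_iff_mem m Q).2 hmQ))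
    (Submodule.isHomogeneous_sup hN (isHomogeneous_span_singleton 𝒜 hmt)) hQ
  linarith

/-- Converse of `leadCoeff_lt`: a homogeneous torsion element of P/N would generate a larger
submodule with the same leading coefficient. -/
theorem mem_of_smul_mem [IsDomain R] (hN : N.IsHomogeneous ℳ) (hP : P.IsHomogeneous ℳ)
    (hNP : N ≤ P)
    (hlt : ∀ Q : Submodule R M, Q.IsHomogeneous ℳ → N < Q → Q ≤ P →
      leadCoeff n ℳ N < leadCoeff n ℳ Q) {r : R} (hr : r ≠ 0) {m : M} (hm : m ∈ P)
    (hrm : r • m ∈ N) : m ∈ N := by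
  refine mem_of_smul_mem_of_homogeneous (𝒜 := 𝒜) hN hP ?_ hr hm hrm
  intro s t r m _ hmt hmP hr hrm
  have h1 := H.leadCoeff_sup_span_of_torsion HR hN hmt hr hrm
  by_contra hmN
  refine (hlt (N ⊔ Submodule.span R {m})
    (Submodule.isHomogeneous_sup hN (isHomogeneous_span_singleton 𝒜 hmt)) ?_
    (sup_le hNP ((Submodule.span_singleton_le_iff_mem m P).2 hmP))).ne' h1
  refine lt_of_le_of_ne le_sup_left fun h => hmN ?_
  rw [h]
  exact Submodule.mem_sup_right (Submodule.mem_span_singleton_self m)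

/-- The quotient (N + R m)/N is either a shifted copy of R, in which every nonzero graded submodule
has the full leading coefficient, or torsion, in which the leading coefficient does not move at all.
-/
theorem leadCoeff_eq_of_cyclic [IsDomain R] (hN : N.IsHomogeneous ℳ) {m : M} {t : ℝ} (hm : m ∈ ℳ t)
    (hQ : Q.IsHomogeneous ℳ) (hNQ : N < Q) (hQm : Q ≤ N ⊔ Submodule.span R {m}) :
    leadCoeff n ℳ Q = leadCoeff n ℳ (N ⊔ Submodule.span R {m}) := by
  have hP := Submodule.isHomogeneous_sup hN (isHomogeneous_span_singleton 𝒜 hm)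
  refine le_antisymm (H.leadCoeff_mono hQm hQ hP) ?_
  by_cases hJ : ∀ r : R, r • m ∈ N → r = 0
  · obtain ⟨s, q, hqs, hqQ, hqN⟩ := exists_homogeneous_mem_notMem hQ hNQ.not_ge
    have hJq : ∀ r : R, r • q ∈ N → r = 0 := by
      intro r hr
      obtain ⟨p, hp, _, hx, rfl⟩ := Submodule.mem_sup.1 (hQm hqQ)
      obtain ⟨u, rfl⟩ := Submodule.mem_span_singleton.1 hx
      rw [smul_add, smul_smul] at hr
      have h1 := hJ _ ((N.add_mem_iff_right (N.smul_mem r hp)).1 hr)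
      rcases mul_eq_zero.1 h1 with h | h
      · exact h
      · rw [h, zero_smul, add_zero] at hqN
        exact absurd hp hqN
    rw [H.leadCoeff_sup_span_of_injective HR hN hm hJ,
      ← H.leadCoeff_sup_span_of_injective HR hN hqs hJq]
    exact H.leadCoeff_mono (sup_le hNQ.le ((Submodule.span_singleton_le_iff_mem q Q).2 hqQ))
      (Submodule.isHomogeneous_sup hN (isHomogeneous_span_singleton 𝒜 hqs)) hQ
  · push Not at hJ
    obtain ⟨r, hrm, hr⟩ := hJ
    rw [H.leadCoeff_sup_span_of_torsion HR hN hm hr hrm]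
    exact H.leadCoeff_mono hNQ.le hN hQ

open scoped Pointwise in
/-- The coefficients `a_{n-1}` of graded submodules satisfy the ascending chain condition. -/
theorem isPWO_neg_subCoeff [IsDomain R] :
    {x : ℝ | ∃ Q : Submodule R M, Q.IsHomogeneous ℳ ∧ x = -subCoeff n ℳ Q}.IsPWO := by
  classical
  have key : ∀ S : Finset M, (∀ m ∈ S, ∃ t, m ∈ ℳ t) →
      (Submodule.span R (S : Set M)).IsHomogeneous ℳ ∧
      {x : ℝ | ∃ Q : Submodule R M, Q.IsHomogeneous ℳ ∧ Q ≤ Submodule.span R (S : Set M) ∧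
        x = -subCoeff n ℳ Q}.IsPWO := by
    intro S
    induction S using Finset.induction_on with
    | empty =>
      intro _
      rw [Finset.coe_empty, Submodule.span_empty]
      refine ⟨Submodule.isHomogeneous_bot, (Set.finite_singleton 0).isPWO.mono ?_⟩
      rintro x ⟨Q, hQ, hQ0, rfl⟩
      rw [le_bot_iff.1 hQ0, H.coeff_bot.2]
      simp
    | insert m S _ ih =>
      intro hS
      obtain ⟨hN, hpwo⟩ := ih fun m' hm' => hS m' (by simp [hm'])
      obtain ⟨t, hmt⟩ := hS m (by simp)
      rw [Finset.coe_insert, Submodule.span_insert, sup_comm]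
      set N := Submodule.span R (S : Set M) with hNdef
      set P := N ⊔ Submodule.span R {m} with hPdef
      have hP : P.IsHomogeneous ℳ :=
        Submodule.isHomogeneous_sup hN (isHomogeneous_span_singleton 𝒜 hmt)
      refine ⟨hP, ?_⟩
      have h1 : Set.IsPWO (((densityMonoid W (n - 1) : Set ℝ) +
          {subCoeff n ℳ N - subCoeff n ℳ P}) ∪ {0} : Set ℝ) :=
        ((isPWO_densityMonoid H.weight_pos _).add (Set.isPWO_singleton _)).union
          (Set.isPWO_singleton _)
      refine (hpwo.add h1).mono ?_
      rintro x ⟨Q, hQ, hQP, rfl⟩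
      -- By modularity -b(Q) = -b(Q ∩ N) + (b(N) - b(Q + N)). The first term is covered by
      -- induction. The second is zero if Q + N = N; otherwise Q + N and P have equal `a`, so b(P) -
      -- b(Q + N) lies in the density monoid and only the constant b(N) - b(P) is added.
      refine Set.mem_add.2 ⟨-subCoeff n ℳ (Q ⊓ N), ⟨_, Submodule.isHomogeneous_inf hQ hN,
        inf_le_right, rfl⟩, subCoeff n ℳ N - subCoeff n ℳ (Q ⊔ N), ?_, ?_⟩
      · have hQN := Submodule.isHomogeneous_sup hQ hN
        have hle : Q ⊔ N ≤ P := sup_le hQP le_sup_left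
        rcases (le_sup_right : N ≤ Q ⊔ N).eq_or_lt with h | h
        · right
          rw [← h, sub_self]
          rfl
        · left
          have h2 := H.leadCoeff_eq_of_cyclic HR hN hmt hQN h hle
          refine Set.mem_add.2 ⟨_, (H.coeff_sub_mem hle hQN hP).2 h2, _, rfl, ?_⟩
          ring
      · have := (H.coeff_sup_add_inf hQ hN).2
        linarith
  obtain ⟨S, hS, hStop⟩ := exists_homogeneous_span_eq (ℳ := ℳ) (N := (⊤ : Submodule R M))
    Submodule.isHomogeneous_top (H.noetherian.noetherian _)
  have h1 := (key S hS).2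
  rw [hStop] at h1
  refine h1.mono ?_
  rintro x ⟨Q, hQ, rfl⟩
  exact ⟨Q, hQ, le_top, rfl⟩

/-- Adjoining a homogeneous generator changes both sides alike: by a(R) and rank one if it is free
over what precedes, and not at all if it is torsion. Torsion-freeness of M gives every nonzero
cyclic submodule rank one. -/
theorem leadCoeff_eq_finrank_mul [IsDomain R] [Module.IsTorsionFree R M] (hN : N.IsHomogeneous ℳ) :
    leadCoeff n ℳ N = Module.finrank R N * leadCoeff n 𝒜 (⊤ : Ideal R) := by
  classical
  have hnoeth := H.noetherian
  have hspan : ∀ m : M, m ≠ 0 → Module.finrank R (Submodule.span R {m}) = 1 := by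
    intro m hm
    rw [← (LinearEquiv.toSpanNonzeroSingleton R M m hm).finrank_eq, Module.finrank_self]
  have hrank : ∀ s t : Submodule R M, Module.finrank R (s ⊔ t : Submodule R M) +
      Module.finrank R (s ⊓ t : Submodule R M) = Module.finrank R s + Module.finrank R t := by
    intro s t
    have h1 := Submodule.rank_sup_add_rank_inf_eq s t
    rw [← Module.finrank_eq_rank, ← Module.finrank_eq_rank, ← Module.finrank_eq_rank,
      ← Module.finrank_eq_rank] at h1
    exact_mod_cast h1
  have key : ∀ S : Finset M, (∀ m ∈ S, ∃ t, m ∈ ℳ t) →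
      (Submodule.span R (S : Set M)).IsHomogeneous ℳ ∧
      leadCoeff n ℳ (Submodule.span R (S : Set M)) =
        Module.finrank R (Submodule.span R (S : Set M)) * leadCoeff n 𝒜 (⊤ : Ideal R) := by
    intro S
    induction S using Finset.induction_on with
    | empty =>
      intro _
      rw [Finset.coe_empty, Submodule.span_empty, H.coeff_bot.1]
      exact ⟨Submodule.isHomogeneous_bot, by simp⟩
    | insert m S _ ih =>
      intro hS
      obtain ⟨hN, hlead⟩ := ih fun m' hm' => hS m' (by simp [hm'])
      obtain ⟨t, hmt⟩ := hS m (by simp)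
      rw [Finset.coe_insert, Submodule.span_insert, sup_comm]
      set N := Submodule.span R (S : Set M) with hNdef
      refine ⟨Submodule.isHomogeneous_sup hN (isHomogeneous_span_singleton 𝒜 hmt), ?_⟩
      have h1 := hrank N (Submodule.span R {m})
      by_cases hJ : ∀ r : R, r • m ∈ N → r = 0
      · have hm0 : m ≠ 0 := by
          rintro rfl
          exact one_ne_zero (hJ 1 (by simp))
        have hinf : N ⊓ Submodule.span R {m} = ⊥ := by
          refine (Submodule.eq_bot_iff _).2 fun x hx => ?_
          obtain ⟨r, rfl⟩ := Submodule.mem_span_singleton.1 hx.2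
          rw [hJ r hx.1, zero_smul]
        rw [hinf, finrank_bot, add_zero, hspan m hm0] at h1
        rw [H.leadCoeff_sup_span_of_injective HR hN hmt hJ, hlead, h1]
        push_cast
        ring
      · push Not at hJ
        obtain ⟨r, hrm, hr⟩ := hJ
        rw [H.leadCoeff_sup_span_of_torsion HR hN hmt hr hrm, hlead]
        congr 2
        by_cases hm0 : m = 0
        · rw [hm0, Submodule.span_zero_singleton, sup_bot_eq]
        · have h2 : Module.finrank R (N ⊓ Submodule.span R {m} : Submodule R M) = 1 := by
            refine le_antisymm ?_ ?_
            · rw [← hspan m hm0]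
              exact Submodule.finrank_mono inf_le_right
            · rw [← hspan (r • m) (smul_ne_zero hr hm0)]
              refine Submodule.finrank_mono ((Submodule.span_singleton_le_iff_mem _ _).2
                ⟨hrm, Submodule.smul_mem _ _ (Submodule.mem_span_singleton_self m)⟩)
          rw [h2, hspan m hm0] at h1
          omega
  obtain ⟨S, hS, hSN⟩ := exists_homogeneous_span_eq hN (hnoeth.noetherian N)
  have := (key S hS).2
  rwa [hSN] at this

omit H in
-- If a(R) vanished, the Hilbert function of R would be O(x^(n - 1)), contradicting the lower bound
-- from algebraically independent elements.
theorem leadCoeff_top_pos (hzero : 𝒜 0 = 1) {φ : MvPolynomial (Fin n) k →ₐ[k] R}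
    (hφ : Function.Injective φ) : 0 < leadCoeff n 𝒜 (⊤ : Ideal R) := by
  have h0 : 0 ≤ leadCoeff n 𝒜 (⊤ : Ideal R) := by
    have := HR.leadCoeff_mono (bot_le (a := (⊤ : Ideal R))) Submodule.isHomogeneous_bot
      Submodule.isHomogeneous_top
    rwa [HR.coeff_bot.1] at this
  refine lt_of_le_of_ne h0 fun heq => ?_
  obtain ⟨C, hC, h⟩ := exists_pow_le_hilbertFun 𝒜 hzero hφ HR.finiteDimensional
  have h1 := (HR.hasRiemannRoch (N := (⊤ : Ideal R)) Submodule.isHomogeneous_top).leading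
  simp only [← heq, zero_div, zero_mul, sub_zero] at h1
  have h2 : (fun x : ℝ => C ^ n * x ^ n) =O[atTop] moduleHilbertFun 𝒜 (⊤ : Ideal R) := by
    refine IsBigO.of_bound 1 ?_
    filter_upwards [eventually_ge_atTop (0 : ℝ)] with x hx
    rw [one_mul, ← mul_pow, Real.norm_of_nonneg (by positivity)]
    exact (h x hx).trans (Real.le_norm_self _)
  have hn := HR.one_le
  have h3 := eq_zero_of_isLittleO_pow
    ((h2.trans h1).trans_isLittleO (isLittleO_pow_of_lt (show n - 1 < n by omega)))
  exact (pow_pos hC n).ne' h3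

end HasHilbertExpansion

end Torsion

/-! ### Cesàro averages against integrated expansions -/

section Transfer

variable {k M : Type*} [Field k] [AddCommGroup M] [Module k M] {n : ℕ} {ℳ : ℝ → Submodule k M}
  {a b : ℝ}

/-- Integrating the two monomials from 1 to T gives the area polynomial up to a constant, negligible
against T^n because n ≥ 1. -/
theorem isRiemannRoch_iff_hasRiemannRoch (hn : 1 ≤ n)
    (hint : ∀ S T, IntervalIntegrable (dimLE ℳ) MeasureTheory.volume S T) :
    IsRiemannRoch n ℳ a b ↔ HasRiemannRoch n (dimLE ℳ) a b := by
  have hpow : ∀ (c : ℝ) (m : ℕ) (S T : ℝ),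
      IntervalIntegrable (fun x : ℝ => c * x ^ m) MeasureTheory.volume S T := fun c m S T =>
    (by fun_prop : Continuous fun x : ℝ => c * x ^ m).intervalIntegrable S T
  have hfact : ∀ (c : ℝ) (m : ℕ), c / m.factorial / (m + 1) = c / (m + 1).factorial := by
    intro c m
    rw [Nat.factorial_succ]
    push_cast
    field_simp
  have harea : ∀ T, ∫ x in (1 : ℝ)..T, (dimLE ℳ x - a / n.factorial * x ^ n -
      b / (n - 1).factorial * x ^ (n - 1)) = ((∫ x in (1 : ℝ)..T, dimLE ℳ x) -
      (a / (n + 1).factorial * T ^ (n + 1) + b / n.factorial * T ^ n)) +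
      (a / (n + 1).factorial + b / n.factorial) := by
    intro T
    obtain ⟨m, rfl⟩ : ∃ m, n = m + 1 := ⟨n - 1, by omega⟩
    rw [Nat.add_sub_cancel, intervalIntegral.integral_sub ((hint _ _).sub (hpow _ _ _ _))
      (hpow _ _ _ _), intervalIntegral.integral_sub (hint _ _) (hpow _ _ _ _),
      intervalIntegral.integral_const_mul, intervalIntegral.integral_const_mul, integral_pow,
      integral_pow, ← hfact a (m + 1), ← hfact b m]
    push_cast
    ring
  have hconst := isLittleO_const_pow hn (a / (n + 1).factorial + b / n.factorial)
  have hces : Tendsto (fun T : ℝ => 1 / T ^ n * ∫ x in (1 : ℝ)..T, (dimLE ℳ x -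
      a / n.factorial * x ^ n - b / (n - 1).factorial * x ^ (n - 1))) atTop (𝓝 0) ↔
      (fun T : ℝ => (∫ x in (1 : ℝ)..T, dimLE ℳ x) -
        (a / (n + 1).factorial * T ^ (n + 1) + b / n.factorial * T ^ n)) =o[atTop]
        fun T : ℝ => T ^ n := by
    have h1 : (fun T : ℝ => ∫ x in (1 : ℝ)..T, (dimLE ℳ x -
        a / n.factorial * x ^ n - b / (n - 1).factorial * x ^ (n - 1))) =o[atTop]
        (fun T : ℝ => T ^ n) ↔ (fun T : ℝ => (∫ x in (1 : ℝ)..T, dimLE ℳ x) -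
        (a / (n + 1).factorial * T ^ (n + 1) + b / n.factorial * T ^ n)) =o[atTop]
        fun T : ℝ => T ^ n := by
      simp only [harea]
      exact ⟨fun h => (h.sub hconst).congr_left fun T => by ring, fun h => h.add hconst⟩
    rw [← h1, isLittleO_iff_tendsto']
    · simp only [div_eq_inv_mul, mul_one]
    · filter_upwards [eventually_gt_atTop (0 : ℝ)] with T hT h0
      exact absurd h0 (by positivity)
  exact ⟨fun h => ⟨hint, h.leading, hces.1 h.cesaro⟩, fun h => ⟨h.leading, hces.2 h.area⟩⟩

theorem HasRiemannRoch.existsUnique_isRiemannRoch (hn : 1 ≤ n)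
    (h : HasRiemannRoch n (dimLE ℳ) a b) : ∃! c : ℝ × ℝ, IsRiemannRoch n ℳ c.1 c.2 := by
  refine ⟨(a, b), (isRiemannRoch_iff_hasRiemannRoch hn h.integrable).2 h, fun c hc => ?_⟩
  have := ((isRiemannRoch_iff_hasRiemannRoch hn h.integrable).1 hc).unique hn h
  exact Prod.ext this.1 this.2

theorem HasRiemannRoch.rrCoeff_eq (hn : 1 ≤ n) (h : HasRiemannRoch n (dimLE ℳ) a b) :
    rrCoeff n ℳ = (a, b) := by
  have hex := h.existsUnique_isRiemannRoch hn
  exact hex.unique (Classical.epsilon_spec hex.exists)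
    ((isRiemannRoch_iff_hasRiemannRoch hn h.integrable).2 h)

end Transfer

/-! ### Induced gradings on subquotients -/

section Subquotient

variable {k R M : Type*} [Field k] [CommRing R] [Algebra k R]
  [AddCommGroup M] [Module R M] [Module k M] [IsScalarTower k R M]
  {ℳ : ℝ → Submodule k M} {N P Q : Submodule R M}

/-- The submodule `Q / N` of `P / N`, for `N ≤ Q ≤ P`. -/
def subquotSubmodule (N P Q : Submodule R M) : Submodule R (P ⧸ N.submoduleOf P) :=
  (Q.submoduleOf P).map (N.submoduleOf P).mkQ

theorem mkQ_mem_subquotSubmodule (hNQ : N ≤ Q) {p : P} :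
    (N.submoduleOf P).mkQ p ∈ subquotSubmodule N P Q ↔ (p : M) ∈ Q := by
  constructor
  · rintro ⟨p', hp', h⟩
    rw [Submodule.mkQ_apply, Submodule.mkQ_apply, Submodule.Quotient.eq] at h
    have h1 : (p' : M) - p ∈ N := h
    exact (Q.sub_mem_iff_right hp').1 (hNQ h1)
  · exact fun h => ⟨p, h, rfl⟩

theorem subquotSubmodule_ne_bot_iff (hNQ : N ≤ Q) (hQP : Q ≤ P) :
    subquotSubmodule N P Q ≠ ⊥ ↔ N < Q := by
  rw [Submodule.ne_bot_iff, lt_iff_le_and_ne, and_iff_right hNQ]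
  constructor
  · rintro ⟨_, ⟨p, hp, rfl⟩, hne⟩ rfl
    exact hne ((Submodule.Quotient.mk_eq_zero _).2 hp)
  · intro hne
    obtain ⟨m, hm, hmN⟩ := SetLike.exists_of_lt (lt_of_le_of_ne hNQ hne)
    refine ⟨_, ⟨⟨m, hQP hm⟩, hm, rfl⟩, fun h => hmN ?_⟩
    exact (Submodule.Quotient.mk_eq_zero (N.submoduleOf P)).1 h

theorem subquotSubmodule_inf (hNQ : N ≤ Q) (t : ℝ) :
    (subquotSubmodule N P Q).restrictScalars k ⊓ subquotGrading ℳ N P t =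
      ((Q.restrictScalars k ⊓ ℳ t).comap (P.subtype.restrictScalars k)).map
        ((N.submoduleOf P).mkQ.restrictScalars k) := by
  refine le_antisymm ?_ ?_
  · rintro _ ⟨h, p, hp, rfl⟩
    exact ⟨p, ⟨(mkQ_mem_subquotSubmodule hNQ).1 h, hp⟩, rfl⟩
  · rintro _ ⟨p, hp, rfl⟩
    exact ⟨(mkQ_mem_subquotSubmodule hNQ).2 hp.1, p, hp.2, rfl⟩

theorem map_comap_subtype_of_le {V : Submodule k M} (hV : V ≤ P.restrictScalars k) :
    (V.comap (P.subtype.restrictScalars k)).map (P.subtype.restrictScalars k) = V :=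
  Submodule.map_comap_eq_self fun m hm => ⟨⟨m, hV hm⟩, rfl⟩

/-- Preimages commute with suprema here because every V i already lies in P. -/
theorem iSup_comap_subtype {ι : Sort*} {V : ι → Submodule k M}
    (hV : ∀ i, V i ≤ P.restrictScalars k) :
    ⨆ i, (V i).comap (P.subtype.restrictScalars k) =
      (⨆ i, V i).comap (P.subtype.restrictScalars k) := by
  have hinj : Function.Injective (P.subtype.restrictScalars k) := Subtype.val_injective
  refine Submodule.map_injective_of_injective hinj ?_
  rw [Submodule.map_iSup, map_comap_subtype_of_le (iSup_le hV)]
  exact iSup_congr fun i => map_comap_subtype_of_le (hV i)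

theorem finrank_map_mkQ_comap_subtype {V : Submodule k M} [FiniteDimensional k V]
    (hV : V ≤ P.restrictScalars k) :
    Module.finrank k ((V.comap (P.subtype.restrictScalars k)).map
      ((N.submoduleOf P).mkQ.restrictScalars k)) +
      Module.finrank k (N.restrictScalars k ⊓ V : Submodule k M) = Module.finrank k V := by
  have hinj : Function.Injective (P.subtype.restrictScalars k) := Subtype.val_injective
  have hrank : ∀ W : Submodule k M, W ≤ P.restrictScalars k →
      Module.finrank k (W.comap (P.subtype.restrictScalars k)) = Module.finrank k W := by
    intro W hW
    rw [(Submodule.equivMapOfInjective _ hinj _).finrank_eq, map_comap_subtype_of_le hW]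
  have hfin : FiniteDimensional k (V.comap (P.subtype.restrictScalars k)) := by
    have : FiniteDimensional k ((V.comap (P.subtype.restrictScalars k)).map
        (P.subtype.restrictScalars k)) := by
      rwa [map_comap_subtype_of_le hV]
    exact (Submodule.equivMapOfInjective _ hinj _).symm.finiteDimensional
  have h1 := finrank_sup_map_add_finrank_inf_comap ((N.submoduleOf P).mkQ.restrictScalars k)
    (V.comap (P.subtype.restrictScalars k)) ⊥
  have h2 : V.comap (P.subtype.restrictScalars k) ⊓
      (⊥ : Submodule k _).comap ((N.submoduleOf P).mkQ.restrictScalars k) =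
      (N.restrictScalars k ⊓ V).comap (P.subtype.restrictScalars k) := by
    ext p
    change _ ∧ (N.submoduleOf P).mkQ p = 0 ↔ _ ∧ _
    rw [Submodule.mkQ_apply, Submodule.Quotient.mk_eq_zero, and_comm]
    rfl
  rw [bot_sup_eq, finrank_bot, zero_add, h2, hrank _ hV, hrank _ (inf_le_right.trans hV)] at h1
  exact h1

theorem finrank_subquotSubmodule [IsDomain R] [IsNoetherian R M] (hNQ : N ≤ Q) (hQP : Q ≤ P) :
    Module.finrank R (subquotSubmodule N P Q) + Module.finrank R N = Module.finrank R Q := by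
  have hle : N.submoduleOf P ≤ Q.submoduleOf P := Submodule.comap_mono hNQ
  have h1 := Submodule.finrank_quotient_add_finrank
    (LinearMap.ker ((N.submoduleOf P).mkQ.domRestrict (Q.submoduleOf P)))
  rw [(LinearMap.quotKerEquivRange _).finrank_eq, LinearMap.range_domRestrict,
    LinearMap.ker_domRestrict, Submodule.ker_mkQ,
    (Submodule.submoduleOfEquivOfLe hQP).finrank_eq] at h1
  have h2 := (Submodule.submoduleOfEquivOfLe hle).finrank_eq
  rw [(Submodule.submoduleOfEquivOfLe (hNQ.trans hQP)).finrank_eq] at h2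
  rw [← h1, ← h2]
  rfl

variable [DirectSum.Decomposition ℳ]

theorem iSup_inf_eq_inf_gradedLE (hQ : Q.IsHomogeneous ℳ) (x : ℝ) :
    ⨆ t : Set.Iic x, Q.restrictScalars k ⊓ ℳ t = Q.restrictScalars k ⊓ gradedLE ℳ x := by
  classical
  refine le_antisymm (iSup_le fun t => inf_le_inf_left _ (le_gradedLE t.2)) ?_
  rintro m ⟨hm, hmx⟩
  rw [← truncation_eq_self hmx, ← DirectSum.sum_support_decompose ℳ m, map_sum]
  refine sum_mem fun t _ => ?_
  rw [truncation_of_mem (DirectSum.decompose ℳ m t).2]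
  split_ifs with h
  · exact Submodule.mem_iSup_of_mem (p := fun t : Set.Iic x => Q.restrictScalars k ⊓ ℳ t) ⟨t, h⟩
      ⟨hQ t hm, (DirectSum.decompose ℳ m t).2⟩
  · exact zero_mem _

theorem isGradedSubmodule_subquotSubmodule (hQ : Q.IsHomogeneous ℳ) (hNQ : N ≤ Q) (hQP : Q ≤ P) :
    IsGradedSubmodule (subquotGrading ℳ N P) (subquotSubmodule N P Q) := by
  unfold IsGradedSubmodule
  simp only [subquotSubmodule_inf hNQ]
  rw [← Submodule.map_iSup, iSup_comap_subtype fun t => inf_le_left.trans hQP,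
    ← (isGradedSubmodule_iff_isHomogeneous ℳ Q).2 hQ]
  rfl

/-- Graded submodules of `P / N` come from graded submodules between `N` and `P`. -/
theorem exists_eq_subquotSubmodule (hN : N.IsHomogeneous ℳ) (hNP : N ≤ P)
    {N' : Submodule R (P ⧸ N.submoduleOf P)} (hN' : IsGradedSubmodule (subquotGrading ℳ N P) N') :
    ∃ Q : Submodule R M, Q.IsHomogeneous ℳ ∧ N ≤ Q ∧ Q ≤ P ∧ N' = subquotSubmodule N P Q := by
  set Q : Submodule R M := (N'.comap (N.submoduleOf P).mkQ).map P.subtype with hQdef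
  have hQP : Q ≤ P := Submodule.map_subtype_le _ _
  have hNQ : N ≤ Q := fun m hm => ⟨⟨m, hNP hm⟩, by
    have : (N.submoduleOf P).mkQ ⟨m, hNP hm⟩ = 0 := (Submodule.Quotient.mk_eq_zero _).2 hm
    change (N.submoduleOf P).mkQ ⟨m, hNP hm⟩ ∈ N'
    rw [this]
    exact zero_mem _, rfl⟩
  have hN'Q : N' = subquotSubmodule N P Q := by
    have h1 : Q.submoduleOf P = N'.comap (N.submoduleOf P).mkQ :=
      Submodule.comap_map_eq_of_injective Subtype.val_injective _
    rw [subquotSubmodule, h1, Submodule.map_comap_eq_of_surjective (Submodule.mkQ_surjective _)]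
  refine ⟨Q, (isGradedSubmodule_iff_isHomogeneous ℳ Q).1 ?_, hNQ, hQP, hN'Q⟩
  refine le_antisymm ?_ (iSup_le fun t => inf_le_left)
  intro m hm
  have hp : (N.submoduleOf P).mkQ ⟨m, hQP hm⟩ ∈ N' := by
    rw [hN'Q]
    exact (mkQ_mem_subquotSubmodule hNQ).2 hm
  have hp' : (N.submoduleOf P).mkQ ⟨m, hQP hm⟩ ∈ N'.restrictScalars k := hp
  rw [hN', hN'Q] at hp'
  simp only [subquotSubmodule_inf hNQ] at hp'
  rw [← Submodule.map_iSup, iSup_comap_subtype fun t => inf_le_left.trans hQP] at hp'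
  obtain ⟨p, hpQ, hpm⟩ := hp'
  -- The class of m is represented by some p in the sum of the pieces Q ∩ M_t. The difference lies
  -- in N, which is homogeneous and contained in Q, so m itself lies in that sum.
  have hpm' : (p : M) - m ∈ N := (Submodule.Quotient.eq (N.submoduleOf P)).1 hpm
  have hN2 : (p : M) - m ∈ ⨆ t : ℝ, Q.restrictScalars k ⊓ ℳ t := by
    have h1 : ⨆ t : ℝ, N.restrictScalars k ⊓ ℳ t ≤ ⨆ t : ℝ, Q.restrictScalars k ⊓ ℳ t :=
      iSup_mono fun t => inf_le_inf_right (ℳ t) hNQ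
    refine h1 ?_
    rw [← (isGradedSubmodule_iff_isHomogeneous ℳ N).2 hN]
    exact hpm'
  have := Submodule.sub_mem _ (show (p : M) ∈ ⨆ t : ℝ, Q.restrictScalars k ⊓ ℳ t from hpQ) hN2
  rwa [sub_sub_cancel] at this

/-- Pushing the pieces of Q/N forward to P/N identifies their sum with the image of Q ∩ M_{≤ x},
whose dimension is reduced by that of N ∩ M_{≤ x}. -/
theorem dimLE_subGrading_subquotSubmodule (hfin : ∀ x, FiniteDimensional k (gradedLE ℳ x))
    (hQ : Q.IsHomogeneous ℳ) (hNQ : N ≤ Q) (hQP : Q ≤ P) (x : ℝ) :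
    dimLE (subGrading (subquotGrading ℳ N P) (subquotSubmodule N P Q)) x =
      moduleHilbertFun ℳ Q x - moduleHilbertFun ℳ N x := by
  have := hfin x
  have hV : FiniteDimensional k (Q.restrictScalars k ⊓ gradedLE ℳ x : Submodule k M) :=
    Submodule.finiteDimensional_of_le inf_le_right
  have hinj : Function.Injective ((subquotSubmodule N P Q).subtype.restrictScalars k) :=
    Subtype.val_injective
  have h1 : (⨆ t : Set.Iic x, subGrading (subquotGrading ℳ N P) (subquotSubmodule N P Q) t).map
      ((subquotSubmodule N P Q).subtype.restrictScalars k) =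
      ((Q.restrictScalars k ⊓ gradedLE ℳ x).comap (P.subtype.restrictScalars k)).map
        ((N.submoduleOf P).mkQ.restrictScalars k) := by
    rw [← iSup_inf_eq_inf_gradedLE hQ, ← iSup_comap_subtype fun t => inf_le_left.trans hQP,
      Submodule.map_iSup, Submodule.map_iSup]
    refine iSup_congr fun t => ?_
    rw [← subquotSubmodule_inf hNQ]
    exact Submodule.map_comap_subtype ((subquotSubmodule N P Q).restrictScalars k) _
  have h2 := finrank_map_mkQ_comap_subtype (N := N)
    (V := Q.restrictScalars k ⊓ gradedLE ℳ x) (inf_le_left.trans hQP)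
  have h3 : N.restrictScalars k ⊓ (Q.restrictScalars k ⊓ gradedLE ℳ x) =
      N.restrictScalars k ⊓ gradedLE ℳ x := by
    rw [← inf_assoc]
    exact congrArg (· ⊓ gradedLE ℳ x) (inf_eq_left.2 hNQ)
  rw [h3, ← h1, ← (Submodule.equivMapOfInjective _ hinj _).finrank_eq] at h2
  rw [dimLE, eq_sub_iff_add_eq, moduleHilbertFun, moduleHilbertFun, hilbertFun, hilbertFun]
  exact_mod_cast h2

theorem dimLE_subquotGrading (hfin : ∀ x, FiniteDimensional k (gradedLE ℳ x))
    (hP : P.IsHomogeneous ℳ) (hNP : N ≤ P) (x : ℝ) :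
    dimLE (subquotGrading ℳ N P) x = moduleHilbertFun ℳ P x - moduleHilbertFun ℳ N x := by
  rw [← dimLE_subGrading_subquotSubmodule hfin hP hNP le_rfl x]
  have htop : subquotSubmodule N P P = ⊤ := by
    rw [subquotSubmodule, Submodule.submoduleOf_self, Submodule.map_top, Submodule.range_mkQ]
  have hinj : Function.Injective ((subquotSubmodule N P P).subtype.restrictScalars k) :=
    Subtype.val_injective
  have h1 : ⨆ t : Set.Iic x, subquotGrading ℳ N P t = ⨆ t : Set.Iic x,
      (subGrading (subquotGrading ℳ N P) (subquotSubmodule N P P) t).map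
        ((subquotSubmodule N P P).subtype.restrictScalars k) := by
    refine iSup_congr fun t => ?_
    refine (Submodule.map_comap_eq_self fun m _ => ⟨⟨m, ?_⟩, rfl⟩).symm
    rw [htop]
    trivial
  rw [dimLE, dimLE, (Submodule.equivMapOfInjective _ hinj _).finrank_eq, Submodule.map_iSup, h1]

end Subquotient

/-! ### From graded modules to the lattice of graded submodules -/

section Stability

variable {k R M : Type*} [Field k] [CommRing R] [Algebra k R]
  [AddCommGroup M] [Module R M] [Module k M]

/-- The graded submodules of a graded module. -/
abbrev GradedSubmodules (R : Type*) [CommRing R] [Module R M] (ℳ : ℝ → Submodule k M)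
    [DirectSum.Decomposition ℳ] : Type _ :=
  {N : Submodule R M // N.IsHomogeneous ℳ}

variable {ℳ : ℝ → Submodule k M} [DirectSum.Decomposition ℳ]

instance : Lattice (GradedSubmodules R ℳ) :=
  Subtype.lattice (fun _ _ => Submodule.isHomogeneous_sup) fun _ _ => Submodule.isHomogeneous_inf

instance : BoundedOrder (GradedSubmodules R ℳ) :=
  Subtype.boundedOrder Submodule.isHomogeneous_bot Submodule.isHomogeneous_top

variable [IsScalarTower k R M] {𝒜 : ℝ → Submodule k R} [GradedAlgebra 𝒜]
  [SetLike.GradedSMul 𝒜 ℳ] [IsDomain R]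

namespace HasHilbertExpansion

variable {n : ℕ} {W : List ℝ} (H : HasHilbertExpansion R W n ℳ) {N P Q : Submodule R M}

include H

omit [IsDomain R] in
theorem hasRiemannRoch_dimLE : HasRiemannRoch n (dimLE ℳ) (leadCoeff n ℳ (⊤ : Submodule R M))
    (subCoeff n ℳ (⊤ : Submodule R M)) :=
  Eq.subst (motive := fun h => HasRiemannRoch n h _ _) (funext hilbertFun_top)
    (H.hasRiemannRoch (N := (⊤ : Submodule R M)) Submodule.isHomogeneous_top)

omit [IsDomain R] in
theorem rrCoeff_subquotGrading (hN : N.IsHomogeneous ℳ) (hP : P.IsHomogeneous ℳ) (hNP : N ≤ P) :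
    rrCoeff n (subquotGrading ℳ N P) =
      (leadCoeff n ℳ P - leadCoeff n ℳ N, subCoeff n ℳ P - subCoeff n ℳ N) :=
  HasRiemannRoch.rrCoeff_eq H.one_le (Eq.subst (motive := fun h => HasRiemannRoch n h _ _)
    (funext fun x => (dimLE_subquotGrading H.finiteDimensional hP hNP x).symm)
    ((H.hasRiemannRoch hP).sub (H.hasRiemannRoch hN)))

omit [IsDomain R] in
theorem rrCoeff_subGrading (hN : N.IsHomogeneous ℳ) (hQ : Q.IsHomogeneous ℳ) (hNQ : N ≤ Q)
    (hQP : Q ≤ P) : rrCoeff n (subGrading (subquotGrading ℳ N P) (subquotSubmodule N P Q)) =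
      (leadCoeff n ℳ Q - leadCoeff n ℳ N, subCoeff n ℳ Q - subCoeff n ℳ N) :=
  HasRiemannRoch.rrCoeff_eq H.one_le (Eq.subst (motive := fun h => HasRiemannRoch n h _ _)
    (funext fun x => (dimLE_subGrading_subquotSubmodule H.finiteDimensional hQ hNQ hQP x).symm)
    ((H.hasRiemannRoch hQ).sub (H.hasRiemannRoch hN)))

variable (HR : HasHilbertExpansion R W n 𝒜)

include HR

/-- As rank = a / a(R), subtracting rank times b(R) from b shifts every slope by the same constant
b(R) / a(R), which affects no comparison of slopes. -/
theorem gradedSlope_subGrading [Module.IsTorsionFree R M] (hN : N.IsHomogeneous ℳ)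
    (hQ : Q.IsHomogeneous ℳ) (hNQ : N ≤ Q) (hQP : Q ≤ P) (hlt : leadCoeff n ℳ N < leadCoeff n ℳ Q) :
    gradedSlope n 𝒜 (subGrading (subquotGrading ℳ N P) (subquotSubmodule N P Q)) =
      (subCoeff n ℳ Q - subCoeff n ℳ N) / (leadCoeff n ℳ Q - leadCoeff n ℳ N) -
        subCoeff n 𝒜 (⊤ : Ideal R) / leadCoeff n 𝒜 (⊤ : Ideal R) := by
  have := H.noetherian
  have h1 := finrank_subquotSubmodule hNQ hQP
  rw [gradedSlope, gradedDegree, H.rrCoeff_subGrading hN hQ hNQ hQP,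
    HasRiemannRoch.rrCoeff_eq H.one_le HR.hasRiemannRoch_dimLE]
  rw [H.leadCoeff_eq_finrank_mul HR hN, H.leadCoeff_eq_finrank_mul HR hQ, ← h1] at hlt ⊢
  push_cast at hlt ⊢
  have h2 : (Module.finrank R (subquotSubmodule N P Q) : ℝ) * leadCoeff n 𝒜 (⊤ : Ideal R) ≠ 0 :=
    fun h => by linarith
  have h3 := left_ne_zero_of_mul h2
  have h4 := right_ne_zero_of_mul h2
  simp only [add_mul, add_sub_cancel_right]
  field_simp

theorem gradedSlope_subquotGrading [Module.IsTorsionFree R M] (hN : N.IsHomogeneous ℳ)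
    (hP : P.IsHomogeneous ℳ) (hNP : N ≤ P) (hlt : leadCoeff n ℳ N < leadCoeff n ℳ P) :
    gradedSlope n 𝒜 (subquotGrading ℳ N P) =
      (subCoeff n ℳ P - subCoeff n ℳ N) / (leadCoeff n ℳ P - leadCoeff n ℳ N) -
        subCoeff n 𝒜 (⊤ : Ideal R) / leadCoeff n 𝒜 (⊤ : Ideal R) := by
  rw [← H.gradedSlope_subGrading HR hN hP hNP le_rfl hlt, gradedSlope, gradedSlope, gradedDegree,
    gradedDegree, H.rrCoeff_subGrading hN hP hNP le_rfl, H.rrCoeff_subquotGrading hN hP hNP]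
  have htop : subquotSubmodule N P P = ⊤ := by
    rw [subquotSubmodule, Submodule.submoduleOf_self, Submodule.map_top, Submodule.range_mkQ]
  rw [htop, finrank_top]

/-- Semistability of a graded subquotient in terms of the lattice of graded submodules. -/
theorem isSemistable_iff_isStep [Module.IsTorsionFree R M]
    (hpos : 0 < leadCoeff n 𝒜 (⊤ : Ideal R)) {x y : GradedSubmodules R ℳ} (hxy : x ≤ y) :
    IsSemistable n 𝒜 (subquotGrading ℳ x.1 y.1) ↔ HarderNarasimhan.IsStep
      (fun z : GradedSubmodules R ℳ => leadCoeff n ℳ z.1) (fun z => subCoeff n ℳ z.1) x y := by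
  constructor
  · intro h
    have htf := h.torsionFree
    have hrank : ∀ z, x < z → z ≤ y → leadCoeff n ℳ x.1 < leadCoeff n ℳ z.1 := by
      intro z hxz hzy
      refine H.leadCoeff_lt HR hpos x.2 z.2 hxz fun r hr m hm hrm => ?_
      have h1 : r • (x.1.submoduleOf y.1).mkQ ⟨m, hzy hm⟩ = 0 := by
        rw [← map_smul]
        exact (Submodule.Quotient.mk_eq_zero (x.1.submoduleOf y.1)).2 hrm
      exact (Submodule.Quotient.mk_eq_zero (x.1.submoduleOf y.1)).1
        ((smul_eq_zero.1 h1).resolve_left hr)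
    have hlt : x < y := by
      refine lt_of_le_of_ne hxy fun heq => h.leading_ne_zero ?_
      rw [H.rrCoeff_subquotGrading x.2 y.2 hxy, heq]
      exact sub_self _
    refine ⟨hlt, hrank, fun z hxz hzy => ?_⟩
    have h1 := h.slope_le _ (isGradedSubmodule_subquotSubmodule z.2 hxz.le hzy)
      ((subquotSubmodule_ne_bot_iff hxz.le hzy).2 hxz)
    rw [H.gradedSlope_subGrading HR x.2 z.2 hxz.le hzy (hrank z hxz hzy),
      H.gradedSlope_subquotGrading HR x.2 y.2 hxy (hrank y hlt le_rfl)] at h1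
    exact (sub_le_sub_iff_right _).1 h1
  · intro h
    have hlt := h.rank_lt y h.lt le_rfl
    refine ⟨⟨fun r hr => ?_⟩, ?_, fun N' hN' hne => ?_⟩
    · refine isSMulRegular_iff_right_eq_zero_of_smul.2 fun q hq => ?_
      obtain ⟨⟨m, hm⟩, rfl⟩ := (x.1.submoduleOf y.1).mkQ_surjective q
      rw [← map_smul] at hq
      refine (Submodule.Quotient.mk_eq_zero (x.1.submoduleOf y.1)).2 ?_
      refine H.mem_of_smul_mem HR x.2 y.2 hxy (fun Q hQ hNQ hQP => h.rank_lt ⟨Q, hQ⟩ hNQ hQP)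
        hr.ne_zero hm ?_
      exact (Submodule.Quotient.mk_eq_zero (x.1.submoduleOf y.1)).1 hq
    · rw [H.rrCoeff_subquotGrading x.2 y.2 hxy]
      exact (sub_pos.2 hlt).ne'
    · obtain ⟨Q, hQ, hNQ, hQP, rfl⟩ := exists_eq_subquotSubmodule x.2 hxy hN'
      have hlt' : x.1 < Q := (subquotSubmodule_ne_bot_iff hNQ hQP).1 hne
      have hxQ : x < ⟨Q, hQ⟩ := hlt'
      have hQy : (⟨Q, hQ⟩ : GradedSubmodules R ℳ) ≤ y := hQP
      have hltQ : leadCoeff n ℳ x.1 < leadCoeff n ℳ Q := h.rank_lt ⟨Q, hQ⟩ hxQ hQy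
      rw [H.gradedSlope_subGrading HR x.2 hQ hNQ hQP hltQ,
        H.gradedSlope_subquotGrading HR x.2 y.2 hxy hlt]
      exact sub_le_sub_right (h.slope_le ⟨Q, hQ⟩ hxQ hQy) _

theorem isHarderNarasimhan_iff_isFiltration [Module.IsTorsionFree R M]
    (hpos : 0 < leadCoeff n 𝒜 (⊤ : Ideal R)) {l : ℕ} (F : Fin (l + 1) → GradedSubmodules R ℳ) :
    IsHarderNarasimhan n 𝒜 ℳ (fun i => (F i).1) ↔ HarderNarasimhan.IsFiltration
      (fun z : GradedSubmodules R ℳ => leadCoeff n ℳ z.1) (fun z => subCoeff n ℳ z.1) ⊥ F := by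
  have hslope : ∀ {x y : GradedSubmodules R ℳ}, HarderNarasimhan.IsStep
      (fun z : GradedSubmodules R ℳ => leadCoeff n ℳ z.1) (fun z => subCoeff n ℳ z.1) x y →
      gradedSlope n 𝒜 (subquotGrading ℳ x.1 y.1) = HarderNarasimhan.slope
        (fun z : GradedSubmodules R ℳ => leadCoeff n ℳ z.1) (fun z => subCoeff n ℳ z.1) x y -
        subCoeff n 𝒜 (⊤ : Ideal R) / leadCoeff n 𝒜 (⊤ : Ideal R) := fun h =>
    H.gradedSlope_subquotGrading HR (Subtype.prop _) (Subtype.prop _) h.lt.le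
      (h.rank_lt _ h.lt le_rfl)
  constructor
  · intro h
    have hstep : ∀ i : Fin l, HarderNarasimhan.IsStep
        (fun z : GradedSubmodules R ℳ => leadCoeff n ℳ z.1) (fun z => subCoeff n ℳ z.1)
        (F i.castSucc) (F i.succ) := fun i =>
      (H.isSemistable_iff_isStep HR hpos (h.mono (Fin.castSucc_lt_succ (i := i)).le)).1
        (h.semistable i)
    refine ⟨Subtype.ext h.bot, Subtype.ext h.top, hstep, fun i j hij => ?_⟩
    have h1 := h.slope_strictAnti hij
    simp only [hslope (hstep _)] at h1
    exact (sub_lt_sub_iff_right _).1 h1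
  · intro h
    refine ⟨fun i => (isGradedSubmodule_iff_isHomogeneous ℳ _).2 (F i).2,
      Fin.monotone_iff_le_succ.2 fun i => (h.step i).lt.le, congrArg Subtype.val h.zero,
      congrArg Subtype.val h.last, fun i =>
        (H.isSemistable_iff_isStep HR hpos (h.step i).lt.le).2 (h.step i), fun i j hij => ?_⟩
    simp only [hslope (h.step _)]
    exact (sub_lt_sub_iff_right _).2 (h.strictAnti hij)

theorem existsUnique_isHarderNarasimhan [Module.IsTorsionFree R M]
    (hpos : 0 < leadCoeff n 𝒜 (⊤ : Ideal R)) :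
    ∃! F : (l : ℕ) × (Fin (l + 1) → Submodule R M), IsHarderNarasimhan n 𝒜 ℳ F.2 := by
  have := H.noetherian
  have hwf : WellFoundedGT (GradedSubmodules R ℳ) :=
    ⟨InvImage.wf Subtype.val (wellFounded_gt (α := Submodule R M))⟩
  have hex := HarderNarasimhan.existsUnique_isFiltration
    (a := fun z : GradedSubmodules R ℳ => leadCoeff n ℳ z.1) (b := fun z => subCoeff n ℳ z.1)
    (fun x y => (H.coeff_sup_add_inf x.2 y.2).1) (fun x y => (H.coeff_sup_add_inf x.2 y.2).2)
    (fun x y hxy => H.leadCoeff_mono hxy x.2 y.2)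
    (fun x y hxy => H.subCoeff_mono hxy x.2 y.2) ?_ ?_ ⊥ ?_
  · obtain ⟨⟨l, F⟩, hF, huniq⟩ := hex
    refine ⟨⟨l, fun i => (F i).1⟩, (H.isHarderNarasimhan_iff_isFiltration HR hpos F).2 hF, ?_⟩
    rintro ⟨l', G⟩ hG
    have h1 : ∀ i, (G i).IsHomogeneous ℳ := fun i =>
      (isGradedSubmodule_iff_isHomogeneous ℳ _).1 (hG.graded i)
    have h2 := huniq ⟨l', fun i => ⟨G i, h1 i⟩⟩
      ((H.isHarderNarasimhan_iff_isFiltration HR hpos fun i => ⟨G i, h1 i⟩).1 hG)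
    exact congrArg (fun F : (l : ℕ) × (Fin (l + 1) → GradedSubmodules R ℳ) =>
      (⟨F.1, fun i => (F.2 i).1⟩ : (l : ℕ) × (Fin (l + 1) → Submodule R M))) h2
  -- The values of `a` are multiples of a(R) by ranks, and the ranks are bounded by that of M.
  · refine ((Set.finite_Iic (Module.finrank R M)).image
      fun r : ℕ => r * leadCoeff n 𝒜 (⊤ : Ideal R)).subset ?_
    rintro _ ⟨z, rfl⟩
    exact ⟨_, Submodule.finrank_le z.1, (H.leadCoeff_eq_finrank_mul HR z.2).symm⟩
  · refine (H.isPWO_neg_subCoeff HR).mono ?_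
    rintro _ ⟨z, rfl⟩
    exact ⟨z.1, z.2, rfl⟩
  -- Torsion-freeness of M is the starting condition at ⊥.
  · intro z hz
    refine H.leadCoeff_lt HR hpos Submodule.isHomogeneous_bot z.2 hz fun r hr m _ hrm => ?_
    exact (smul_eq_zero.1 hrm).resolve_left hr

end HasHilbertExpansion

end Stability

theorem mainTheorem4 {k R M : Type*} [Field k] [IsAlgClosed k]
    [CommRing R] [IsDomain R] [Algebra k R] [Algebra.FiniteType k R]
    (𝒜 : ℝ → Submodule k R) [GradedAlgebra 𝒜]
    (h𝒜_neg : ∀ t : ℝ, t < 0 → 𝒜 t = ⊥) (h𝒜_zero : 𝒜 0 = 1)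
    (n : ℕ) (hn : ringKrullDim R = n) (hn_pos : 1 ≤ n)
    [AddCommGroup M] [Module R M] [Module k M] [IsScalarTower k R M]
    [Module.Finite R M] [Module.IsTorsionFree R M]
    (ℳ : ℝ → Submodule k M) [DirectSum.Decomposition ℳ] [SetLike.GradedSMul 𝒜 ℳ] :
    (∃! c : ℝ × ℝ, IsRiemannRoch n 𝒜 c.1 c.2) ∧
    (∃! c : ℝ × ℝ, IsRiemannRoch n ℳ c.1 c.2) ∧
    (∃! F : (l : ℕ) × (Fin (l + 1) → Submodule R M), IsHarderNarasimhan n 𝒜 ℳ F.2) := by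
  obtain ⟨φ, hinj, hfin⟩ := exists_finite_injective_mvPolynomial_of_ringKrullDim_eq (k := k) hn
  obtain ⟨gens, hgens, htop⟩ := exists_homogeneous_algebra_generators 𝒜 h𝒜_neg h𝒜_zero
  have H : HasHilbertExpansion R (gens.map Prod.snd) n ℳ :=
    hasHilbertExpansion hgens htop hn_pos hfin
  have HR : HasHilbertExpansion R (gens.map Prod.snd) n 𝒜 :=
    hasHilbertExpansion hgens htop hn_pos hfin
  exact ⟨HR.hasRiemannRoch_dimLE.existsUnique_isRiemannRoch hn_pos,
    H.hasRiemannRoch_dimLE.existsUnique_isRiemannRoch hn_pos,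
    H.existsUnique_isHarderNarasimhan HR (HR.leadCoeff_top_pos h𝒜_zero hinj)⟩
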